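/- **Setting.** An anytime-competitive MDP (A-CMDP) has $H\ge 1$ rounds per episode, states $x_h\in\mathcal X$ and actions $a_h\in\mathcal A$ in (separable) metric spaces, known rewards $r_h(x,a)$, costs $c_h(x,a)$, a policy prior $\pi^\dagger$, and dynamics $x_{h+1}=f_h(x_h,a_h)$, where the transition functions $f_h\in\mathcal F$ are drawn independently from an unknown distribution $g$ in a known class $\mathcal G$; initial states are drawn independently from a fixed law. Costs are at least $\epsilon\ge0$ and $L_c$-Lipschitz in $(x,a)$, every $f\in\mathcal F$ is $L_f$-Lipschitz in $(x,a)$, and $\pi^\dagger$ is $L_{\pi^\dagger}$-Lipschitz and telescoping: applying $\pi^\dagger$ for $n$ rounds from two states under the same transition functions gives states at distance at most $p(n)$ times the initial distance, with $p(0)=1$. Let $\lambda,b\ge 0$ and, for $j\le i$, $$q_{j,i}=L_c\mathbf 1(j=i)+L_c(1+L_{\pi^\dagger})L_f\,p(i-1-j)\mathbf 1(j<i),\qquad \Gamma_{j,n}=\sum_{i=n}^H q_{j,i}.$$ With $d_i=\|a_i-\pi^\dagger(x_i)\|$, $c_i=c_i(x_i,a_i)$ and $\hat c_i^\dagger=\max\{\epsilon,\,c_i-\sum_{j\le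 i}q_{j,i}d_j\}$, the allowed deviation is $D_1=\lambda\epsilon+b$ and $$D_h=\max\Big\{D_{h-1}+\lambda\epsilon+b-\Gamma_{h-1,h-1}d_{h-1},\ \sum_{i=1}^{h-1}\big((1+\lambda)\hat c_i^\dagger-c_i-\Gamma_{i,h}d_i\big)+\lambda\epsilon+b\Big\}.$$ The augmented state $s_h$ consists of $x_h$, $D_h$ and the histories $(c_i)_{i<h},(d_i)_{i<h}$. An ACD policy executes $a_h=P_{s_h}(\tilde\pi(s_h))$, where $\tilde\pi$ is an ML policy and $P_{s_h}$ is the projection onto the safe set $\{a:\Gamma_{h,h}\|a-\pi^\dagger(x_h)\|\le D_h\}$. $V_h^{\pi}$ denotes its expected reward from round $h$ on under the true $g$, and $\pi^\circ$ is an ACD policy maximizing $V_1^\pi(s_1)$ for every initial state. For $g\in\mathcal G$, value iteration defines $\tilde Q_h^g(s,\tilde a)=r_h(x,a)+\mathbb E_g[\tilde V_{h+1}^g(s')\mid s,a]$ with $a=P_s(\tilde a)$, $\tilde V_h^g(s)=\max_{\tilde a\in\mathcal A}\tilde Q_h^g(s,\tilde a)$, $\tilde V_{H+1}^g=0$. **Algorithm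 ACRL.** In episode $k$, with $\tilde V^i=\tilde V^{g^i}$ for $i<k$: $\hat g^k\in\mathcal G$ minimizes $\sum_{i<k}\sum_{h\le H}\big(\mathbb E_g[\tilde V^i_{h+1}(s')\mid s_h^i,a_h^i]-\tilde V^i_{h+1}(s^i_{h+1})\big)^2$ over $g\in\mathcal G$; $\mathcal G_k$ is the set of $g\in\mathcal G$ with $\sum_{i<k}\sum_{h\le H}\big(\mathbb E_g[\tilde V^i_{h+1}(s')\mid s_h^i,a_h^i]-\mathbb E_{\hat g^k}[\tilde V^i_{h+1}(s')\mid s_h^i,a_h^i]\big)^2\le\beta_k$ (so $\mathcal G_1=\mathcal G$); $g^k\in\mathcal G_k$ maximizes $\tilde V_1^g(s_1^k)$; and the ACD policy $\pi^k$ with ML policy $\tilde\pi^k(s_h)\in\arg\max_{a}\tilde Q_h^{g^k}(s_h,a)$ is run. The maximizers, minimizers and projections are assumed to exist. **Theorem.** Let $K\ge1$ and $\delta\in(0,1)$, and assume that the value functions ($V^\pi_h$ for all ACD policies under the true $g$, and $\tilde Q^g_h$ for all $g\in\mathcal G$) are bounded by $\bar V$ in absolute value. Let $\mathcal V=\{\tilde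 V^g:g\in\mathcal G\}$ and $$\mathcal Q=\{q\mid\exists g\in\mathcal G\ \forall(s,a,v):\ q(s,a,v)=\mathbb E_{f\sim g}[v(s')\mid s,a]\},$$ where $(s,a)$ ranges over the state-action pairs of the ACD decision process (reachable augmented states $s$ and safe actions $a$ at $s$) and $v$ over $\mathcal V$. Let $\mathcal N(\mathcal Q,\alpha,\|\cdot\|_\infty)$ be the covering number at $\alpha=1/(KH\log(KH/\delta))$ and $d_{\mathcal Q}=\dim_E(\mathcal Q,\frac1{KH})$ the Eluder dimension, that is, the largest length of a sequence such that, for some $\varepsilon'\ge\frac1{KH}$, for each element $z$ there are $q,q'\in\mathcal Q$ with $\big(\sum_y(q(y)-q'(y))^2\big)^{1/2}\le\varepsilon'$ over the predecessors $y$ of $z$ and $|q(z)-q'(z)|>\varepsilon'$. There is an absolute constant $C_0>0$ such that for every constant $C\ge C_0$ the following holds for ACRL with $$\beta_k=2(\bar VH)^2\log\Big(\frac{2\mathcal N(\mathcal Q,\alpha,\|\cdot\|_\infty)}{\delta}\Big)+C\bar VH .$$ 1. If $\mathcal N(\mathcal Q,\alpha,\|\cdot\|_\infty)$ and $d_{\mathcal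 Q}$ are finite, then with probability at least $1-\delta$ over the past episodes the pseudo regret $\mathrm{PReg}(K)=\mathbb E_{x_1}\big[\sum_{k=1}^K\big(V_1^{\pi^\circ}(s_1)-V_1^{\pi^k}(s_1)\big)\big]$ satisfies $$\mathrm{PReg}(K)\le 1+d_{\mathcal Q}H\bar V+4\sqrt{d_{\mathcal Q}\beta_KKH}+H\sqrt{2KH\log(1/\delta)} .$$ 2. Linear transition kernels: there is a constant $c$, depending only on $C$, such that if the members of $\mathcal G$ have densities $g(f)=\langle\phi(f),\theta\rangle$ with $\theta\in\mathbb R^{d_\theta}$, and if $\bar V\ge1$ and $\delta\le\frac12$, then with probability at least $1-\delta$ $$\mathrm{PReg}(K)\le c\,d_\theta\log(2+d_\theta KH\bar V)\sqrt{H^3\bar V^2K\log(1/\delta)}=\tilde O\big(\sqrt{H^3\bar V^2K\log(1/\delta)}\big).$$ -/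

import Mathlib

open MeasureTheory ProbabilityTheory
open scoped NNReal ENNReal

noncomputable section

/-! ### Eluder dimension and covering number of a class of real functions -/

/-- `z` is `ε`-dependent on the points `y 0, …, y (n - 1)` with respect to the class `Q`: two members
of `Q` that are `ε`-close on these points (in Euclidean norm) are `ε`-close at `z`. -/
def EluderDependent {Z : Type*} (Q : Set (Z → ℝ)) (ε : ℝ) {n : ℕ} (y : Fin n → Z) (z : Z) : Prop :=
  ∀ q ∈ Q, ∀ q' ∈ Q, √(∑ i, (q (y i) - q' (y i)) ^ 2) ≤ ε → |q z - q' z| ≤ ε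

/-- The `ε`-Eluder dimension: the supremum of the lengths of the finite sequences for which there is
one `ε' ≥ ε` such that every element is `ε'`-independent of its predecessors. -/
def eluderDim {Z : Type*} (Q : Set (Z → ℝ)) (ε : ℝ) : ℕ∞ :=
  ⨆ (n : ℕ) (_ : ∃ ε' : ℝ, ε ≤ ε' ∧ ∃ z : Fin n → Z, ∀ i : Fin n,
    ¬ EluderDependent Q ε' (fun j : Fin i => z (Fin.castLE i.isLt.le j)) (z i)), (n : ℕ∞)

/-- The covering number `𝒩(Q, α, ‖·‖_∞)`. -/
def supCoveringNumber {Z : Type*} (Q : Set (Z → ℝ)) (α : ℝ≥0) : ℕ∞ :=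
  Metric.coveringNumber α (UniformFun.ofFun '' Q)

/-! ### The anytime-competitive Markov decision process -/

/-- The data of an A-CMDP with states `X`, actions `A` and a set `F` of transition functions. Rounds
are numbered `0, …, H - 1`, so that round `h` here is round `h + 1` in the usual numbering. The class
`𝒢` of candidate distributions on `F` is the family `(trans θ)_{θ ∈ Θ}`. -/
structure ACMDP (X A F Θ : Type*) [MeasurableSpace X] [MeasurableSpace F] [MeasurableSpace Θ] where
  /-- number of rounds of an episode -/
  H : ℕ
  /-- `step f x a = f (x, a)` -/
  step : F → X → A → X
  /-- reward functions `r_h` -/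
  reward : ℕ → X → A → ℝ
  /-- cost functions `c_h` -/
  cost : ℕ → X → A → ℝ
  /-- the policy prior `π†` -/
  prior : ℕ → X → A
  /-- law of the initial state -/
  initLaw : Measure X
  /-- the candidate distributions of the random transition function -/
  trans : Kernel Θ F
  /-- index of the true distribution, unknown to the agent -/
  truth : Θ
  /-- the relaxation parameter `λ` -/
  lam : ℝ
  /-- the relaxation parameter `b` -/
  b : ℝ
  /-- minimum cost `ε` -/
  eps : ℝ
  /-- Lipschitz constant of the costs -/
  Lc : ℝ
  /-- Lipschitz constant of the transition functions -/
  Lf : ℝ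
  /-- Lipschitz constant of the policy prior -/
  Lprior : ℝ
  /-- perturbation function of the policy prior -/
  p : ℕ → ℝ

/-- Augmented state: `(h, x_h, D_h, (c_i)_{i<h}, (d_i)_{i<h})`, that is the round, the original state,
the allowed deviation, the past costs and the past action differences (histories are continued
by zero). -/
abbrev AugState (X : Type*) := ℕ × X × ℝ × (ℕ → ℝ) × (ℕ → ℝ)

namespace AugState
variable {X : Type*}
/-- round -/
abbrev rd (s : AugState X) : ℕ := s.1
/-- original state -/
abbrev pos (s : AugState X) : X := s.2.1
/-- allowed deviation -/
abbrev dev (s : AugState X) : ℝ := s.2.2.1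
/-- past costs -/
abbrev costs (s : AugState X) : ℕ → ℝ := s.2.2.2.1
/-- past action differences -/
abbrev diffs (s : AugState X) : ℕ → ℝ := s.2.2.2.2
end AugState

/-- What is recorded of an episode: the selected model, the augmented states at rounds `0, …, H` and the
executed actions at rounds `0, …, H - 1`. -/
abbrev EpisodeData (X A Θ : Type*) (H : ℕ) := Θ × (Fin (H + 1) → AugState X) × (Fin H → A)

/-- The randomness of an episode: its initial state and its transition functions. -/
abbrev Noise (X F : Type*) (H : ℕ) := X × (Fin H → F)

/-- The choices made by a learner that selects models. In the `k`-th episode (`k = 0, 1, …`) they depend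
on the data of the `k` previous episodes and, for `select` and `policy`, on the initial state. -/
structure Learner (X A Θ : Type*) (H : ℕ) where
  /-- the fitted model `ĝ^k` -/
  fit : (k : ℕ) → (Fin k → EpisodeData X A Θ H) → Θ
  /-- the selected (optimistic) model `g^k` -/
  select : (k : ℕ) → (Fin k → EpisodeData X A Θ H) → X → Θ
  /-- the ML policy `π̃^k` -/
  policy : (k : ℕ) → (Fin k → EpisodeData X A Θ H) → X → AugState X → A

namespace ACMDP

variable {X A F Θ : Type*} [MetricSpace X] [MeasurableSpace X] [MetricSpace A] [MeasurableSpace A]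
  [MeasurableSpace F] [MeasurableSpace Θ] (M : ACMDP X A F Θ)

/-- The states obtained by applying the policy prior from round `h` and state `x` on, when the
transition function of round `i` is `f i`. -/
def priorTraj (f : ℕ → F) (h : ℕ) (x : X) : ℕ → X
  | 0 => x
  | n + 1 => M.step (f (h + n)) (priorTraj f h x n) (M.prior (h + n) (priorTraj f h x n))

/-- The standing assumptions on an A-CMDP: costs bounded below and Lipschitz, Lipschitz transition
functions, and a Lipschitz policy prior with the telescoping property. -/
structure Standing : Prop where
  lam_nonneg : 0 ≤ M.lam
  b_nonneg : 0 ≤ M.b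
  eps_nonneg : 0 ≤ M.eps
  Lc_nonneg : 0 ≤ M.Lc
  Lf_nonneg : 0 ≤ M.Lf
  Lprior_nonneg : 0 ≤ M.Lprior
  eps_le_cost : ∀ h < M.H, ∀ x a, M.eps ≤ M.cost h x a
  cost_lipschitz : ∀ h < M.H, ∀ x x' a a',
    |M.cost h x a - M.cost h x' a'| ≤ M.Lc * (dist x x' + dist a a')
  step_lipschitz : ∀ f x x' a a',
    dist (M.step f x a) (M.step f x' a') ≤ M.Lf * (dist x x' + dist a a')
  prior_lipschitz : ∀ h < M.H, ∀ x x', dist (M.prior h x) (M.prior h x') ≤ M.Lprior * dist x x'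
  p_zero : M.p 0 = 1
  telescoping : ∀ (f : ℕ → F) (h n : ℕ) (x x' : X), h + n < M.H →
    dist (M.priorTraj f h x n) (M.priorTraj f h x' n) ≤ M.p n * dist x x'

/-- `q_{j,i}` for `j ≤ i`. -/
def qw (j i : ℕ) : ℝ :=
  if j = i then M.Lc else if j < i then M.Lc * (1 + M.Lprior) * M.Lf * M.p (i - 1 - j) else 0

/-- `Γ_{j,n} = ∑_{i=n}^{last round} q_{j,i}`. -/
def Gam (j n : ℕ) : ℝ := ∑ i ∈ Finset.Ico n M.H, M.qw j i

/-- `ĉ†_i`, the lower bound on the cost of the prior at round `i`. -/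
def priorCostLB (c d : ℕ → ℝ) (i : ℕ) : ℝ :=
  max M.eps (c i - ∑ j ∈ Finset.range (i + 1), M.qw j i * d j)

/-- `R` at the beginning of round `h`, from the costs and action differences of the rounds `< h`. -/
def Rgain (c d : ℕ → ℝ) (h : ℕ) : ℝ :=
  ∑ i ∈ Finset.range h, ((1 + M.lam) * M.priorCostLB c d i - c i - M.Gam i h * d i)

/-- The initial augmented state, with `D = λ ε + b`. -/
def initState (x : X) : AugState X := (0, x, M.lam * M.eps + M.b, fun _ => 0, fun _ => 0)

/-- The safe action set `{a | Γ_{h,h} ‖a - π†(x_h)‖ ≤ D_h}`. -/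
def safe (s : AugState X) : Set A := {a | M.Gam s.rd s.rd * dist a (M.prior s.rd s.pos) ≤ s.dev}

/-- The next augmented state when `a` is executed in `s` and the transition function is `f`. -/
def next (s : AugState X) (a : A) (f : F) : AugState X :=
  let d := dist a (M.prior s.rd s.pos)
  let c' : ℕ → ℝ := fun i => if i = s.rd then M.cost s.rd s.pos a else s.costs i
  let d' : ℕ → ℝ := fun i => if i = s.rd then d else s.diffs i
  (s.rd + 1, M.step f s.pos a,
    max (s.dev + M.lam * M.eps + M.b - M.Gam s.rd s.rd * d)
      (M.Rgain c' d' (s.rd + 1) + M.lam * M.eps + M.b),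
    c', d')

/-- The augmented states that can occur when safe actions are executed. -/
inductive Reachable : AugState X → Prop
  | start (x : X) : Reachable (M.initState x)
  | move (s : AugState X) (a : A) (f : F) : Reachable s → s.rd < M.H → a ∈ M.safe s →
      Reachable (M.next s a f)

/-- The augmented states of the rounds at which an action is taken. -/
def stateSpace : Set (AugState X) := {s | M.Reachable s ∧ s.rd < M.H}

/-- `P s` projects actions onto the safe action set of `s`. -/
def IsProjection (P : AugState X → A → A) : Prop :=
  ∀ s ∈ M.stateSpace, ∀ a : A, P s a ∈ M.safe s ∧ ∀ a' ∈ M.safe s, dist (P s a) a ≤ dist a' a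

/-- `E_g[v(s_{h+1}) | s_h = s, a_h = a]` for `g = trans θ`. -/
def expNext (θ : Θ) (s : AugState X) (a : A) (v : AugState X → ℝ) : ℝ :=
  ∫ f, v (M.next s a f) ∂(M.trans θ)

variable (P : AugState X → A → A)

/-- Value of the ML policy `π` (with projection) under model `θ` when `n` rounds remain. -/
def policyValueAux (θ : Θ) (π : AugState X → A) : ℕ → AugState X → ℝ
  | 0, _ => 0
  | n + 1, s => M.reward s.rd s.pos (P s (π s)) +
      M.expNext θ s (P s (π s)) (policyValueAux θ π n)

/-- The value function of the ACD policy with ML policy `π`, under model `θ`. -/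
def policyValue (θ : Θ) (π : AugState X → A) (s : AugState X) : ℝ :=
  M.policyValueAux P θ π (M.H - s.rd) s

/-- Value iteration under model `θ` when `n` rounds remain. -/
def optValueAux (θ : Θ) : ℕ → AugState X → ℝ
  | 0, _ => 0
  | n + 1, s => ⨆ a : A, (M.reward s.rd s.pos (P s a) + M.expNext θ s (P s a) (optValueAux θ n))

/-- `Ṽ` from value iteration under model `θ`; it is zero after the last round. -/
def optValue (θ : Θ) (s : AugState X) : ℝ := M.optValueAux P θ (M.H - s.rd) s

/-- `Q̃` from value iteration under model `θ`, as a function of the ML output `a`. -/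
def optQ (θ : Θ) (s : AugState X) (a : A) : ℝ :=
  M.reward s.rd s.pos (P s a) + M.expNext θ s (P s a) (M.optValue P θ)

/-- The value functions are bounded by `Vbar`: those of all policies in the true environment, and
those produced by value iteration under the candidate models. -/
def ValueBounded (Vbar : ℝ) : Prop :=
  (∀ π : AugState X → A, Measurable π → ∀ s ∈ M.stateSpace, |M.policyValue P M.truth π s| ≤ Vbar) ∧
  (∀ θ, ∀ s ∈ M.stateSpace, ∀ a, |M.optQ P θ s a| ≤ Vbar)

/-- `π` is an optimal ML policy; together with the projection it gives the optimal ACD policy `π°`. -/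
def IsOptimalPolicy (π : AugState X → A) : Prop :=
  Measurable π ∧ ∀ π' : AugState X → A, Measurable π' → ∀ x,
    M.policyValue P M.truth π' (M.initState x) ≤ M.policyValue P M.truth π (M.initState x)

/-- The set `𝒱` of value functions of the candidate models. -/
def valueClass : Set (AugState X → ℝ) := Set.range (M.optValue P)

/-- The triples `(s, a, v)` formed by a state-action pair of the decision process (`s` an augmented state,
`a` a safe action at `s`) and a value function `v ∈ 𝒱`. -/
def Triple : Type _ :=
  {z : AugState X × A × (AugState X → ℝ) //
    z.1 ∈ M.stateSpace ∧ z.2.1 ∈ M.safe z.1 ∧ z.2.2 ∈ M.valueClass P}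

/-- The function class `𝒬 = {q | ∃ g ∈ 𝒢, ∀ (s, a, v), q (s, a, v) = E_g[v(s') | s, a]}`. -/
def qClass : Set (M.Triple P → ℝ) :=
  {q | ∃ θ, ∀ z : M.Triple P, q z = M.expNext θ z.1.1 z.1.2.1 z.1.2.2}

/-- `𝒩(𝒬, α, ‖·‖_∞)` with `α = 1 / (K H log (K H / δ))`. -/
def covNum (K : ℕ) (δ : ℝ) : ℕ∞ :=
  supCoveringNumber (M.qClass P) (1 / (K * M.H * Real.log (K * M.H / δ))).toNNReal

/-- `d_𝒬 = dim_E(𝒬, 1 / (K H))`. -/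
def dimQ (K : ℕ) : ℕ∞ := eluderDim (M.qClass P) (1 / (K * M.H))

/-- The confidence parameter `2 (V̄ H)² log (2 𝒩 / δ) + C V̄ H`. -/
def conf (K : ℕ) (Vbar δ C : ℝ) : ℝ :=
  2 * (Vbar * M.H) ^ 2 * Real.log (2 * ((M.covNum P K δ).toNat : ℝ) / δ) + C * Vbar * M.H

/-! ### The learning algorithm -/

/-- The augmented states of an episode in which ACD is run with ML policy `π`. -/
def rollout (π : AugState X → A) (ξ : Noise X F M.H) : ℕ → AugState X
  | 0 => M.initState ξ.1
  | n + 1 => if hn : n < M.H then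
      M.next (rollout π ξ n) (P (rollout π ξ n) (π (rollout π ξ n))) (ξ.2 ⟨n, hn⟩)
    else rollout π ξ n

/-- The data of the episode that follows the data `w` of `k` episodes. -/
def episode (L : Learner X A Θ M.H) (k : ℕ) (w : Fin k → EpisodeData X A Θ M.H)
    (ξ : Noise X F M.H) : EpisodeData X A Θ M.H :=
  let π := L.policy k w ξ.1
  (L.select k w ξ.1, fun h => M.rollout P π ξ h,
    fun h => P (M.rollout P π ξ h) (π (M.rollout P π ξ h)))

/-- The data of the first `k` episodes, as a function of their randomness. -/
def history (L : Learner X A Θ M.H) :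
    (k : ℕ) → (Fin k → Noise X F M.H) → (Fin k → EpisodeData X A Θ M.H)
  | 0, _ => Fin.elim0
  | k + 1, ω => Fin.snoc (α := fun _ => EpisodeData X A Θ M.H) (history L k (Fin.init ω))
      (M.episode P L k (history L k (Fin.init ω)) (ω (Fin.last k)))

/-- The least-squares criterion that defines the fitted model. -/
def fitLoss {k : ℕ} (w : Fin k → EpisodeData X A Θ M.H) (θ : Θ) : ℝ :=
  ∑ i, ∑ h : Fin M.H,
    (M.expNext θ ((w i).2.1 h.castSucc) ((w i).2.2 h) (M.optValue P (w i).1) -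
      M.optValue P (w i).1 ((w i).2.1 h.succ)) ^ 2

/-- The confidence set around the fitted model `θhat` (the whole class when there are no data). -/
def confSet {k : ℕ} (w : Fin k → EpisodeData X A Θ M.H) (θhat : Θ) (β : ℝ) : Set Θ :=
  {θ | ∑ i, ∑ h : Fin M.H,
    (M.expNext θ ((w i).2.1 h.castSucc) ((w i).2.2 h) (M.optValue P (w i).1) -
      M.expNext θhat ((w i).2.1 h.castSucc) ((w i).2.2 h) (M.optValue P (w i).1)) ^ 2 ≤ β}

/-- `L` follows ACRL for `K` episodes with confidence parameters `β 0, …, β (K - 1)`. -/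
structure IsACRL (L : Learner X A Θ M.H) (K : ℕ) (β : ℕ → ℝ) : Prop where
  /-- the fitted model minimizes the least-squares criterion -/
  fit_min : ∀ k < K, ∀ (ω : Fin k → Noise X F M.H) (θ : Θ),
    M.fitLoss P (M.history P L k ω) (L.fit k (M.history P L k ω)) ≤
      M.fitLoss P (M.history P L k ω) θ
  /-- the selected model lies in the confidence set -/
  select_mem : ∀ k < K, ∀ (ω : Fin k → Noise X F M.H) (x : X),
    L.select k (M.history P L k ω) x ∈
      M.confSet P (M.history P L k ω) (L.fit k (M.history P L k ω)) (β k)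
  /-- the selected model maximizes the value of the initial state over the confidence set -/
  select_max : ∀ k < K, ∀ (ω : Fin k → Noise X F M.H) (x : X),
    ∀ θ ∈ M.confSet P (M.history P L k ω) (L.fit k (M.history P L k ω)) (β k),
      M.optValue P θ (M.initState x) ≤
        M.optValue P (L.select k (M.history P L k ω) x) (M.initState x)
  /-- the ML policy maximizes `Q̃` of the selected model -/
  greedy : ∀ k < K, ∀ (ω : Fin k → Noise X F M.H) (x : X), ∀ s ∈ M.stateSpace, ∀ a : A,
    M.optQ P (L.select k (M.history P L k ω) x) s a ≤
      M.optQ P (L.select k (M.history P L k ω) x) s (L.policy k (M.history P L k ω) x s)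

/-- Measurability of the primitives, of the value functions and of the choices of the learner. -/
structure IsMeasurable (L : Learner X A Θ M.H) : Prop where
  step : Measurable fun z : F × X × A => M.step z.1 z.2.1 z.2.2
  reward : ∀ h, Measurable fun z : X × A => M.reward h z.1 z.2
  cost : ∀ h, Measurable fun z : X × A => M.cost h z.1 z.2
  prior : ∀ h, Measurable (M.prior h)
  proj : Measurable fun z : AugState X × A => P z.1 z.2
  value : Measurable fun z : Θ × AugState X => M.optValue P z.1 z.2
  select : ∀ k, Measurable fun z : (Fin k → EpisodeData X A Θ M.H) × X => L.select k z.1 z.2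
  policy : ∀ k, Measurable fun z : (Fin k → EpisodeData X A Θ M.H) × X × AugState X =>
    L.policy k z.1 z.2.1 z.2.2

/-- The law of the randomness of `K` episodes: initial states are independent with law `initLaw`, and
transition functions are independent with the true distribution. -/
def noiseLaw (K : ℕ) : Measure (Fin K → Noise X F M.H) :=
  Measure.pi fun _ => M.initLaw.prod (Measure.pi fun _ => M.trans M.truth)

/-- The pseudo regret `∑_k E_{x_1}[V_1^{π°}(s_1) - V_1^{π^k}(s_1)]`, where `π^k` is the policy played in
episode `k`, given the past episodes, when the initial state is `x_1`. It is random through the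
past episodes. -/
def pseudoRegret (L : Learner X A Θ M.H) (πopt : AugState X → A) (K : ℕ)
    (ω : Fin K → Noise X F M.H) : ℝ :=
  ∑ k : Fin K, ∫ x, (M.policyValue P M.truth πopt (M.initState x) -
    M.policyValue P M.truth
      (L.policy k (M.history P L k fun i => ω (Fin.castLE k.isLt.le i)) x) (M.initState x)) ∂M.initLaw

/-- The setting of the regret bound: ACRL is run for `K` episodes with the confidence parameter `conf`
on an A-CMDP whose value functions are bounded by `Vbar`. -/
structure Setting (πopt : AugState X → A) (L : Learner X A Θ M.H) (K : ℕ) (Vbar δ C : ℝ) :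
    Prop where
  standing : M.Standing
  H_pos : 1 ≤ M.H
  K_pos : 1 ≤ K
  δ_pos : 0 < δ
  δ_lt_one : δ < 1
  projection : M.IsProjection P
  measurable : M.IsMeasurable P L
  bounded : M.ValueBounded P Vbar
  optimal : M.IsOptimalPolicy P πopt
  acrl : M.IsACRL P L K fun _ => M.conf P K Vbar δ C

/-- Linear transition kernels of dimension `d`: with respect to a reference measure (the counting measure
when `F` is discrete), the candidate distributions have densities `f ↦ ⟨φ f, w θ⟩`. -/
def IsLinear (d : ℕ) : Prop :=
  ∃ (ν : Measure F) (φ : F → EuclideanSpace ℝ (Fin d)) (w : Θ → EuclideanSpace ℝ (Fin d)),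
    Measurable φ ∧ ∀ θ, (∀ᵐ f ∂ν, 0 ≤ inner ℝ (φ f) (w θ)) ∧
      M.trans θ = ν.withDensity fun f => ENNReal.ofReal (inner ℝ (φ f) (w θ))

end ACMDP

end

/-!
The regret of optimistic value-targeted regression is controlled as follows.

*The truth stays in the confidence sets.* Each model `θ` has a prediction map in the class `𝒬`. On the
data, the least-squares criterion of `θ` minus that of the truth is the sum of the squared prediction
gaps between `θ` and the truth, plus a part that is linear in the gaps and has conditional mean zero
given the past. The values being bounded by `V̄`, Hoeffding's lemma turns this part into the logarithm
of an exponential supermartingale, and Ville's maximal inequality (`measure_exists_le_partialSum_le`)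
bounds it in all episodes at once, without a union bound over episodes. A union bound over a finite
`α`-net of `𝒬` then reaches every model, in particular the fitted one
(`ACMDP.sum_sq_dataGap_fit_le`).

*Optimism.* When the confidence set contains the truth, the value of the selected model dominates the
optimal value, and the simulation lemma bounds the regret of the episode by the expected sum, over its
rounds, of the prediction gaps of the selected model at the visited triples `(s, a, Ṽ)`
(`ACMDP.regret_le_integral_gapSum`). These sums lie in `[0, 2 V̄ H]`, so Azuma's inequality over the
episodes (`measure_azuma_le`) replaces the expected sums by the realized ones. Each of the two
deviation events is given half of `δ`.

*Eluder counting.* The realized gaps are listed round after round (`ACMDP.sum_gapSum_le`). At each point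
of this list, the selected model is close in `ℓ²` to the truth on all earlier episodes. The Eluder
dimension bounds the number of gaps above a given level, hence their sum
(`sum_gap_le_of_eluderDim`). The earlier rounds of the running episode are not controlled by the
confidence set, but they contribute at most `4 V̄²` each, which is small compared with `β`, and the last
round has no gap because all value functions vanish after it. The deviation term of Azuma's inequality
is absorbed by the slack in the main term, so that `ACMDP.regret_bound` does not need the last term of
the claimed bound. When the Eluder dimension is zero, all models agree up to `1 / (K H)` and the regret
is at most one.

*Linear kernels.* If the densities are `⟨φ f, θ⟩` with `θ` in dimension `d_θ`, then `𝒬` spans a space of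
dimension `r ≤ d_θ` and has a barycentric spanner: `r` points that determine every `q ∈ 𝒬` linearly, with
coefficients bounded by `2`. Rounding the values at these points gives a cover
(`supCoveringNumber_le_of_spanner`), and the determinant potential of the coefficient vectors bounds
the Eluder dimension by a multiple of `d_θ log (2 + d_θ K H V̄)` (`pow_le_of_spanner`). With these two
estimates, the bound for general classes gives the rate.
-/

set_option linter.unusedSectionVars false

noncomputable section

/-! ### Sums controlled by level counts -/

theorem Real.one_div_sqrt_add_two_mul_sqrt_sub_one_le {x : ℝ} (hx : 1 ≤ x) :
    1 / √x + 2 * √(x - 1) ≤ 2 * √x := by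
  have hs : 0 < √x := Real.sqrt_pos.2 (by linarith)
  have h1 : √x ^ 2 = x := Real.sq_sqrt (by linarith)
  have h2 : √(x - 1) ^ 2 = x - 1 := Real.sq_sqrt (by linarith)
  have h3 : 1 / √x * √x = 1 := by field_simp
  nlinarith [sq_nonneg (√x - √(x - 1)), Real.sqrt_nonneg (x - 1)]

/-- If at most `d (B² / ε² + 1)` of the numbers `w i` exceed any level `ε ≥ ε₀`, the sum of the `w i`
over a finite set is controlled: the `d` largest are bounded by `W`, and the `(d + j)`-th largest
by `B √(d / j)` or by `ε₀`. -/
theorem sum_le_of_card_level_le {ι : Type*} [DecidableEq ι] (S : Finset ι) (w : ι → ℝ) {d : ℕ}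
    {B W ε₀ : ℝ} (hB : 0 ≤ B) (hW : 0 ≤ W) (hε₀ : 0 < ε₀) (hw : ∀ i, w i ≤ W)
    (hcard : ∀ ε, ε₀ ≤ ε → ((S.filter fun i => ε < w i).card : ℝ) ≤ d * (B ^ 2 / ε ^ 2 + 1)) :
    ∑ i ∈ S, w i ≤ S.card * ε₀ + d * W + 2 * B * √d * √(S.card - d) := by
  induction hn : S.card generalizing S with
  | zero =>
    rw [Finset.card_eq_zero] at hn
    subst hn
    simp only [Finset.sum_empty]
    positivity
  | succ n ih =>
    rcases le_or_gt (n + 1) d with hnd | hnd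
    · calc ∑ i ∈ S, w i ≤ S.card • W := Finset.sum_le_card_nsmul _ _ _ fun i _ => hw i
        _ ≤ d * W := by
          rw [nsmul_eq_mul, hn]; gcongr
        _ ≤ _ := by
          have : 0 ≤ ((n + 1 : ℕ) : ℝ) * ε₀ + 2 * B * √d * √((n + 1 : ℕ) - d) := by positivity
          linarith
    · obtain ⟨i₀, hi₀, hmin⟩ := S.exists_min_image w (Finset.card_pos.1 (by omega))
      have hsum := Finset.add_sum_erase S w hi₀
      have hih := ih (S.erase i₀) (fun ε hε => le_trans (by
        exact_mod_cast Finset.card_le_card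
          (Finset.filter_subset_filter _ (Finset.erase_subset _ _))) (hcard ε hε))
        (by rw [Finset.card_erase_of_mem hi₀, hn]; rfl)
      have hx : (1 : ℝ) ≤ (n + 1 : ℕ) - d := by
        have : ((d + 1 : ℕ) : ℝ) ≤ (n + 1 : ℕ) := by exact_mod_cast hnd
        push_cast at this ⊢; linarith
      have hstep : w i₀ + 2 * B * √d * √((n : ℝ) - d) ≤ ε₀ + 2 * B * √d * √((n + 1 : ℕ) - d) := by
        rcases le_or_gt (w i₀) ε₀ with hm | hm
        · have : √((n : ℝ) - d) ≤ √((n + 1 : ℕ) - d) := by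
            apply Real.sqrt_le_sqrt; push_cast; linarith
          have := mul_le_mul_of_nonneg_left this (by positivity : 0 ≤ 2 * B * √d)
          linarith
        · set x : ℝ := (n + 1 : ℕ) - d with hxdef
          have hx0 : 0 < √x := Real.sqrt_pos.2 (by linarith)
          have hle : w i₀ ≤ B * √d / √x := by
            by_contra! hlt
            set ε := (max ε₀ (B * √d / √x) + w i₀) / 2 with hε
            have hmax : max ε₀ (B * √d / √x) < w i₀ := max_lt hm hlt
            have h1 : ε₀ ≤ ε := by have := le_max_left ε₀ (B * √d / √x); linarith
            have h2 : B * √d / √x < ε := by have := le_max_right ε₀ (B * √d / √x); linarith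
            have h3 : ε < w i₀ := by linarith
            have hall : S.filter (fun i => ε < w i) = S :=
              Finset.filter_true_of_mem fun i hi => h3.trans_le (hmin i hi)
            have hc := hcard ε h1
            rw [hall, hn] at hc
            have hεpos : 0 < ε := hε₀.trans_le h1
            have h4 : B * √d < ε * √x := (div_lt_iff₀ hx0).1 h2
            have h5 : (B * √d) ^ 2 < (ε * √x) ^ 2 := by gcongr
            rw [mul_pow, mul_pow, Real.sq_sqrt (by positivity), Real.sq_sqrt (by linarith)] at h5
            have h6 : (d : ℝ) * (B ^ 2 / ε ^ 2 + 1) * ε ^ 2 = d * B ^ 2 + d * ε ^ 2 := by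
              field_simp
            have h7 := mul_le_mul_of_nonneg_right hc (sq_nonneg ε)
            rw [h6] at h7
            rw [hxdef] at h5
            nlinarith
          have h8 := mul_le_mul_of_nonneg_left
            (Real.one_div_sqrt_add_two_mul_sqrt_sub_one_le hx) (by positivity : 0 ≤ B * √d)
          have h9 : x - 1 = (n : ℝ) - d := by rw [hxdef]; push_cast; ring
          rw [h9] at h8
          have h10 : B * √d * (1 / √x + 2 * √((n : ℝ) - d)) =
            B * √d / √x + 2 * B * √d * √((n : ℝ) - d) := by ring
          nlinarith
      rw [← hsum]
      push_cast at hstep ⊢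
      nlinarith

/-! ### Eluder dimension: counting large deviations -/

section Eluder

variable {Z : Type*}

/-- An independent finite set of indices is no larger than the Eluder dimension. -/
theorem card_le_of_eluderDim {Q : Set (Z → ℝ)} {ε : ℝ} {d : ℕ} (hd : eluderDim Q ε ≤ d) {ε' : ℝ}
    (hε : ε ≤ ε') (z : ℕ → Z) (S : Finset ℕ)
    (hS : ∀ t ∈ S, ∃ q ∈ Q, ∃ q' ∈ Q,
      √(∑ s ∈ S.filter (· < t), (q (z s) - q' (z s)) ^ 2) ≤ ε' ∧ ε' < |q (z t) - q' (z t)|) :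
    S.card ≤ d := by
  have h : (S.card : ℕ∞) ≤ eluderDim Q ε := by
    refine le_iSup₂_of_le (f := fun (n : ℕ) _ => (n : ℕ∞)) S.card
      ⟨ε', hε, fun i => z (S.orderEmbOfFin rfl i), ?_⟩ le_rfl
    intro i hdep
    obtain ⟨q, hq, q', hq', h1, h2⟩ := hS _ (S.orderEmbOfFin_mem rfl i)
    refine absurd (hdep q hq q' hq' (le_trans (Real.sqrt_le_sqrt ?_) h1)) (not_le.2 h2)
    have hinj : Function.Injective
        fun j : Fin i => S.orderEmbOfFin rfl (Fin.castLE i.isLt.le j) :=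
      fun a b hab => Fin.castLE_injective _ ((S.orderEmbOfFin rfl).injective hab)
    rw [← Finset.sum_image (s := Finset.univ) (f := fun s => (q (z s) - q' (z s)) ^ 2)
      (g := fun j : Fin i => S.orderEmbOfFin rfl (Fin.castLE i.isLt.le j)) fun a _ b _ hab => hinj hab]
    refine Finset.sum_le_sum_of_subset_of_nonneg ?_ fun _ _ _ => sq_nonneg _
    intro s hs
    obtain ⟨j, -, rfl⟩ := Finset.mem_image.1 hs
    refine Finset.mem_filter.2 ⟨S.orderEmbOfFin_mem rfl _, ?_⟩
    exact (S.orderEmbOfFin rfl).lt_iff_lt.2 (Fin.lt_def.2 j.isLt)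
  exact_mod_cast h.trans hd

/-- Along a sequence of pairs of members of `Q` that are `B`-close in `ℓ²` on the earlier points, a gap
larger than `ε'` occurs at most `d (B² / ε'² + 1)` times. The points with a large gap are distributed
over `⌊B² / ε'²⌋ + 1` bins, each one independent: a point that depends on every bin would have
`ℓ²`-gap larger than `B` on its predecessors. -/
theorem card_gap_le_of_eluderDim {Q : Set (Z → ℝ)} {ε : ℝ} {d : ℕ} (hd : eluderDim Q ε ≤ d) {ε' B : ℝ}
    (hε : ε ≤ ε') (hε' : 0 < ε') (z : ℕ → Z) (q q' : ℕ → Z → ℝ) (hq : ∀ t, q t ∈ Q)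
    (hq' : ∀ t, q' t ∈ Q) (S : Finset ℕ)
    (hB : ∀ t ∈ S, ∑ s ∈ S.filter (· < t), (q t (z s) - q' t (z s)) ^ 2 ≤ B ^ 2) :
    ((S.filter fun t => ε' < |q t (z t) - q' t (z t)|).card : ℝ) ≤ d * (B ^ 2 / ε' ^ 2 + 1) := by
  classical
  set T := S.filter fun t => ε' < |q t (z t) - q' t (z t)| with hT
  set m := ⌊B ^ 2 / ε' ^ 2⌋₊ + 1 with hm
  have hmB : B ^ 2 < m * ε' ^ 2 := by
    have := Nat.lt_floor_add_one (B ^ 2 / ε' ^ 2)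
    rw [div_lt_iff₀ (by positivity)] at this
    rw [hm]; push_cast; exact this
  have key : ∀ N : ℕ, ∃ col : ℕ → Fin m, ∀ t ∈ T, t < N →
      √(∑ s ∈ (T.filter fun s => col s = col t).filter (· < t),
        (q t (z s) - q' t (z s)) ^ 2) ≤ ε' := by
    intro N
    induction N with
    | zero => exact ⟨fun _ => ⟨0, by omega⟩, fun t _ h => absurd h (by omega)⟩
    | succ N ih =>
      obtain ⟨col, hcol⟩ := ih
      by_cases hN : N ∈ T
      · -- some bin has small `ℓ²`-gap for the new point
        obtain ⟨b, hb⟩ : ∃ b : Fin m, ∑ s ∈ (T.filter (· < N)).filter (fun s => col s = b),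
            (q N (z s) - q' N (z s)) ^ 2 ≤ ε' ^ 2 := by
          by_contra! hall
          have h1 : ∑ b : Fin m, ε' ^ 2 ≤ ∑ b : Fin m,
              ∑ s ∈ (T.filter (· < N)).filter (fun s => col s = b),
                (q N (z s) - q' N (z s)) ^ 2 := Finset.sum_le_sum fun b _ => (hall b).le
          rw [Finset.sum_fiberwise, Finset.sum_const, Finset.card_univ, Fintype.card_fin,
            nsmul_eq_mul] at h1
          have h2 := hB N (Finset.filter_subset _ _ hN)
          have h3 : ∑ s ∈ T.filter (· < N), (q N (z s) - q' N (z s)) ^ 2 ≤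
              ∑ s ∈ S.filter (· < N), (q N (z s) - q' N (z s)) ^ 2 :=
            Finset.sum_le_sum_of_subset_of_nonneg
              (Finset.filter_subset_filter _ (Finset.filter_subset _ _)) fun _ _ _ => sq_nonneg _
          linarith
        refine ⟨Function.update col N b, fun t ht htN => ?_⟩
        have hset : (T.filter fun s => Function.update col N b s = Function.update col N b t).filter
            (· < t) = (T.filter (· < t)).filter fun s => col s = Function.update col N b t := by
          ext s
          simp only [Finset.mem_filter]
          constructor
          · rintro ⟨⟨h1, h2⟩, h3⟩
            rw [Function.update_of_ne (by omega)] at h2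
            exact ⟨⟨h1, h3⟩, h2⟩
          · rintro ⟨⟨h1, h3⟩, h2⟩
            refine ⟨⟨h1, ?_⟩, h3⟩
            rwa [Function.update_of_ne (by omega)]
        rw [hset]
        rcases Nat.lt_succ_iff_lt_or_eq.1 htN with h | h
        · rw [Function.update_of_ne h.ne]
          rw [Finset.filter_comm]
          exact hcol t ht h
        · subst h
          rw [Function.update_self]
          exact Real.sqrt_le_iff.2 ⟨hε'.le, hb⟩
      · refine ⟨col, fun t ht htN => hcol t ht ?_⟩
        rcases Nat.lt_succ_iff_lt_or_eq.1 htN with h | h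
        · exact h
        · exact absurd (h ▸ ht) hN
  obtain ⟨col, hcol⟩ := key (T.sup id + 1)
  have hbin : ∀ b : Fin m, (T.filter fun s => col s = b).card ≤ d := by
    intro b
    refine card_le_of_eluderDim hd hε z _ fun t ht => ?_
    obtain ⟨ht, hb⟩ := Finset.mem_filter.1 ht
    refine ⟨q t, hq t, q' t, hq' t, ?_, (Finset.mem_filter.1 ht).2⟩
    rw [← hb]
    exact hcol t ht (Nat.lt_succ_of_le (Finset.le_sup (f := id) ht))
  have hcard : T.card ≤ m * d := by
    have := Finset.card_le_mul_card_image_of_maps_to (s := T) (t := (Finset.univ : Finset (Fin m)))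
      (f := col) (fun _ _ => Finset.mem_univ _) d fun b _ => hbin b
    simpa [mul_comm] using this
  have hmle : (m : ℝ) ≤ B ^ 2 / ε' ^ 2 + 1 := by
    rw [hm]; push_cast
    have := Nat.floor_le (by positivity : 0 ≤ B ^ 2 / ε' ^ 2)
    linarith
  calc (T.card : ℝ) ≤ (m * d : ℕ) := by exact_mod_cast hcard
    _ = d * m := by push_cast; ring
    _ ≤ _ := by gcongr

/-- The sum of the gaps along a sequence of pairs of members of `Q` that are `B`-close in `ℓ²` on the
earlier points. -/
theorem sum_gap_le_of_eluderDim {Q : Set (Z → ℝ)} {ε : ℝ} {d : ℕ} (hd : eluderDim Q ε ≤ d)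
    (hε : 0 < ε) {B W : ℝ} (hB0 : 0 ≤ B) (hW : 0 ≤ W) (z : ℕ → Z) (q q' : ℕ → Z → ℝ)
    (hq : ∀ t, q t ∈ Q) (hq' : ∀ t, q' t ∈ Q) (hQW : ∀ t, |q t (z t) - q' t (z t)| ≤ W)
    (S : Finset ℕ)
    (hB : ∀ t ∈ S, ∑ s ∈ S.filter (· < t), (q t (z s) - q' t (z s)) ^ 2 ≤ B ^ 2) :
    ∑ t ∈ S, |q t (z t) - q' t (z t)| ≤ S.card * ε + d * W + 2 * B * √d * √S.card := by
  have := sum_le_of_card_level_le S (fun t => |q t (z t) - q' t (z t)|) hB0 hW hε hQW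
    fun ε' hε' => card_gap_le_of_eluderDim hd hε' (hε.trans_le hε') z q q' hq hq' S hB
  refine this.trans ?_
  gcongr
  simp

/-- If the Eluder dimension vanishes, any two members of the class are uniformly close. -/
theorem abs_sub_le_of_eluderDim_zero {Q : Set (Z → ℝ)} {ε : ℝ} (hd : eluderDim Q ε = 0) (hε : 0 ≤ ε)
    {q q' : Z → ℝ} (hq : q ∈ Q) (hq' : q' ∈ Q) (z : Z) : |q z - q' z| ≤ ε := by
  by_contra! h
  have := card_le_of_eluderDim (d := 0) hd.le le_rfl (fun _ => z) {0} (by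
    intro t ht
    obtain rfl := Finset.mem_singleton.1 ht
    refine ⟨q, hq, q', hq', ?_, h⟩
    simpa using hε)
  simp at this

end Eluder

/-! ### A maximal inequality on product spaces -/

section Ville

variable {E : Type*}

/-- The first `k` terms of a finite sequence. -/
def prefixOf {K : ℕ} (ω : Fin K → E) (k : ℕ) (hk : k ≤ K) : Fin k → E := fun j => ω (Fin.castLE hk j)

/-- The sum of increments that depend on the past and on the present noise. -/
def partialSum (x : (k : ℕ) → (Fin k → E) → E → ℝ) (k : ℕ) (w : Fin k → E) : ℝ :=
  ∑ i : Fin k, x i (prefixOf w i i.isLt.le) (w i)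

/-- The partial sums, frozen once they have reached the level `ℓ`. -/
def stoppedSum (x : (k : ℕ) → (Fin k → E) → E → ℝ) (ℓ : ℝ) : (k : ℕ) → (Fin k → E) → ℝ
  | 0, _ => 0
  | k + 1, w => if ℓ ≤ stoppedSum x ℓ k (Fin.init w) then stoppedSum x ℓ k (Fin.init w)
      else stoppedSum x ℓ k (Fin.init w) + x k (Fin.init w) (w (Fin.last k))

theorem partialSum_succ (x : (k : ℕ) → (Fin k → E) → E → ℝ) (k : ℕ) (w : Fin (k + 1) → E) :
    partialSum x (k + 1) w = partialSum x k (Fin.init w) + x k (Fin.init w) (w (Fin.last k)) := by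
  unfold partialSum
  rw [Fin.sum_univ_castSucc]
  rfl

theorem partialSum_lt_of_stoppedSum_lt (x : (k : ℕ) → (Fin k → E) → E → ℝ) (ℓ : ℝ) :
    ∀ (k : ℕ) (w : Fin k → E), stoppedSum x ℓ k w < ℓ →
      stoppedSum x ℓ k w = partialSum x k w ∧
        ∀ j (hj : j ≤ k), partialSum x j (prefixOf w j hj) < ℓ := by
  intro k
  induction k with
  | zero =>
    intro w h
    refine ⟨by simp [stoppedSum, partialSum], fun j hj => ?_⟩
    obtain rfl : j = 0 := by omega
    simpa [stoppedSum, partialSum] using h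
  | succ k ih =>
    intro w h
    have hlt : stoppedSum x ℓ k (Fin.init w) < ℓ := by
      by_contra! hge
      rw [stoppedSum, if_pos hge] at h
      exact absurd h (not_lt.2 hge)
    obtain ⟨h1, h2⟩ := ih _ hlt
    have h3 : stoppedSum x ℓ (k + 1) w = partialSum x (k + 1) w := by
      rw [stoppedSum, if_neg (not_le.2 hlt), partialSum_succ, h1]
    refine ⟨h3, fun j hj => ?_⟩
    rcases Nat.lt_or_ge j (k + 1) with hjk | hjk
    · exact h2 j (by omega)
    · obtain rfl : j = k + 1 := by omega
      rw [h3] at h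
      exact h

variable [MeasurableSpace E]

theorem measurable_fin_init (k : ℕ) : Measurable fun w : Fin (k + 1) → E => Fin.init w :=
  measurable_pi_lambda _ fun _ => measurable_pi_apply _

theorem measurable_stoppedSum {x : (k : ℕ) → (Fin k → E) → E → ℝ}
    (hx : ∀ k, Measurable fun p : (Fin k → E) × E => x k p.1 p.2) (ℓ : ℝ) (k : ℕ) :
    Measurable (stoppedSum x ℓ k) := by
  induction k with
  | zero => exact measurable_const
  | succ k ih =>
    have h1 : Measurable fun w : Fin (k + 1) → E => stoppedSum x ℓ k (Fin.init w) :=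
      ih.comp (measurable_fin_init k)
    have h2 : Measurable fun w : Fin (k + 1) → E => x k (Fin.init w) (w (Fin.last k)) :=
      (hx k).comp ((measurable_fin_init k).prodMk (measurable_pi_apply _))
    exact Measurable.ite (measurableSet_le measurable_const h1) h1 (h1.add h2)

theorem measurePreserving_init_last (μ : Measure E) [IsProbabilityMeasure μ] (k : ℕ) :
    MeasurePreserving (fun w : Fin (k + 1) → E => (Fin.init w, w (Fin.last k)))
      (Measure.pi fun _ => μ) ((Measure.pi fun _ => μ).prod μ) := by
  have h := (measurePreserving_piFinSuccAbove (fun _ : Fin (k + 1) => μ) (Fin.last k))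
  have h2 := (Measure.measurePreserving_swap (μ := μ)
    (ν := Measure.pi fun _ : Fin k => μ)).comp h
  convert h2 using 1
  funext w
  simp [MeasurableEquiv.piFinSuccAbove, Fin.insertNthEquiv, Fin.removeNth_last]

theorem lintegral_exp_stoppedSum_le_one (μ : Measure E) [IsProbabilityMeasure μ]
    {x : (k : ℕ) → (Fin k → E) → E → ℝ}
    (hx : ∀ k, Measurable fun p : (Fin k → E) × E => x k p.1 p.2)
    (hle : ∀ k w, ∫⁻ ξ, ENNReal.ofReal (Real.exp (x k w ξ)) ∂μ ≤ 1) (ℓ : ℝ) (k : ℕ) :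
    ∫⁻ w, ENNReal.ofReal (Real.exp (stoppedSum x ℓ k w)) ∂(Measure.pi fun _ => μ) ≤ 1 := by
  induction k with
  | zero => simp [stoppedSum]
  | succ k ih =>
    let G : (Fin k → E) × E → ℝ := fun p => if ℓ ≤ stoppedSum x ℓ k p.1 then stoppedSum x ℓ k p.1
      else stoppedSum x ℓ k p.1 + x k p.1 p.2
    have h1 : Measurable fun p : (Fin k → E) × E => stoppedSum x ℓ k p.1 :=
      (measurable_stoppedSum hx ℓ k).comp measurable_fst
    have hG : Measurable G := Measurable.ite (measurableSet_le measurable_const h1) h1 (h1.add (hx k))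
    have hG' : Measurable fun p => ENNReal.ofReal (Real.exp (G p)) :=
      (Real.measurable_exp.comp hG).ennreal_ofReal
    calc ∫⁻ w, ENNReal.ofReal (Real.exp (stoppedSum x ℓ (k + 1) w)) ∂(Measure.pi fun _ => μ)
        = ∫⁻ w, ENNReal.ofReal (Real.exp (G (Fin.init w, w (Fin.last k))))
            ∂(Measure.pi fun _ => μ) := rfl
      _ = ∫⁻ p, ENNReal.ofReal (Real.exp (G p)) ∂((Measure.pi fun _ => μ).prod μ) :=
          (measurePreserving_init_last μ k).lintegral_comp hG'
      _ = ∫⁻ w, ∫⁻ ξ, ENNReal.ofReal (Real.exp (G (w, ξ))) ∂μ ∂(Measure.pi fun _ => μ) :=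
          lintegral_prod _ hG'.aemeasurable
      _ ≤ ∫⁻ w, ENNReal.ofReal (Real.exp (stoppedSum x ℓ k w)) ∂(Measure.pi fun _ => μ) := by
          refine lintegral_mono fun w => ?_
          by_cases hw : ℓ ≤ stoppedSum x ℓ k w
          · simp [G, hw]
          · simp only [G, hw, if_false, Real.exp_add]
            simp_rw [ENNReal.ofReal_mul (Real.exp_pos _).le]
            have hxw : Measurable fun ξ => x k w ξ := (hx k).comp measurable_prodMk_left
            rw [lintegral_const_mul _ hxw.exp.ennreal_ofReal]
            exact (mul_le_mul_right (hle k w) _).trans (mul_one _).le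
      _ ≤ 1 := ih

/-- **Ville's inequality** for the exponential supermartingale with increments `exp (x k)`. -/
theorem measure_exists_le_partialSum_le (μ : Measure E) [IsProbabilityMeasure μ]
    {x : (k : ℕ) → (Fin k → E) → E → ℝ}
    (hx : ∀ k, Measurable fun p : (Fin k → E) × E => x k p.1 p.2)
    (hle : ∀ k w, ∫⁻ ξ, ENNReal.ofReal (Real.exp (x k w ξ)) ∂μ ≤ 1) (ℓ : ℝ) (K : ℕ) :
    (Measure.pi fun _ : Fin K => μ).real
      {ω | ∃ k, ∃ hk : k ≤ K, ℓ ≤ partialSum x k (prefixOf ω k hk)} ≤ Real.exp (-ℓ) := by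
  have hmeas := measurable_stoppedSum hx ℓ K
  have hsub : {ω : Fin K → E | ∃ k, ∃ hk : k ≤ K, ℓ ≤ partialSum x k (prefixOf ω k hk)} ⊆
      {ω | ENNReal.ofReal (Real.exp ℓ) ≤ ENNReal.ofReal (Real.exp (stoppedSum x ℓ K ω))} := by
    rintro ω ⟨k, hk, h⟩
    refine ENNReal.ofReal_le_ofReal (Real.exp_le_exp.2 ?_)
    by_contra! hlt
    exact absurd ((partialSum_lt_of_stoppedSum_lt x ℓ K ω hlt).2 k hk) (not_lt.2 h)
  have hmarkov := meas_ge_le_lintegral_div (μ := Measure.pi fun _ : Fin K => μ)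
    (f := fun ω => ENNReal.ofReal (Real.exp (stoppedSum x ℓ K ω)))
    (Real.measurable_exp.comp hmeas).ennreal_ofReal.aemeasurable
    (ε := ENNReal.ofReal (Real.exp ℓ)) (by simp [Real.exp_pos]) ENNReal.ofReal_ne_top
  refine ENNReal.toReal_le_of_le_ofReal (Real.exp_pos _).le ?_
  refine (measure_mono hsub).trans (hmarkov.trans ?_)
  rw [Real.exp_neg, ENNReal.ofReal_inv_of_pos (Real.exp_pos _), ENNReal.div_eq_inv_mul]
  exact (mul_le_mul_right (lintegral_exp_stoppedSum_le_one μ hx hle ℓ K) _).trans (mul_one _).le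

/-- **Hoeffding's lemma** in exponential form. -/
theorem lintegral_exp_centered_le_one (μ : Measure E) [IsProbabilityMeasure μ] {f : E → ℝ}
    (hf : Measurable f) {a b : ℝ} (hab : ∀ ξ, f ξ ∈ Set.Icc a b) (t : ℝ) :
    ∫⁻ ξ, ENNReal.ofReal (Real.exp (t * (∫ ξ', f ξ' ∂μ - f ξ) - t ^ 2 * ((b - a) / 2) ^ 2 / 2)) ∂μ
      ≤ 1 := by
  have h := hasSubgaussianMGF_of_mem_Icc (μ := μ) hf.aemeasurable (.of_forall hab)
  have hint := h.integrable_exp_mul (-t)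
  have hmgf := h.mgf_le (-t)
  have heq : ∀ ξ, Real.exp (t * (∫ ξ', f ξ' ∂μ - f ξ) - t ^ 2 * ((b - a) / 2) ^ 2 / 2) =
      Real.exp (- (t ^ 2 * ((b - a) / 2) ^ 2 / 2)) * Real.exp (-t * (f ξ - ∫ ξ', f ξ' ∂μ)) := by
    intro ξ
    rw [← Real.exp_add]
    ring_nf
  simp_rw [heq]
  rw [← ofReal_integral_eq_lintegral_ofReal (hint.const_mul _)
    (.of_forall fun ξ => by positivity), integral_const_mul]
  rw [← ENNReal.ofReal_one]
  refine ENNReal.ofReal_le_ofReal ?_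
  have h2 : ∫ ξ, Real.exp (-t * (f ξ - ∫ ξ', f ξ' ∂μ)) ∂μ ≤
      Real.exp (t ^ 2 * ((b - a) / 2) ^ 2 / 2) := by
    refine hmgf.trans (le_of_eq ?_)
    congr 1
    push_cast
    rw [Real.norm_eq_abs, div_pow, sq_abs]
    ring
  calc _ ≤ Real.exp (- (t ^ 2 * ((b - a) / 2) ^ 2 / 2)) *
        Real.exp (t ^ 2 * ((b - a) / 2) ^ 2 / 2) := by gcongr
    _ = 1 := by rw [← Real.exp_add]; simp

/-- Azuma's inequality for functions of the past and the present noise. -/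
theorem measure_azuma_le (μ : Measure E) [IsProbabilityMeasure μ]
    {W : (k : ℕ) → (Fin k → E) → E → ℝ}
    (hW : ∀ k, Measurable fun p : (Fin k → E) × E => W k p.1 p.2) {R : ℝ} (hR : 0 < R)
    (hb : ∀ k w ξ, W k w ξ ∈ Set.Icc 0 (2 * R)) {ℓ : ℝ} (hℓ : 0 < ℓ) {K : ℕ} (hK : 1 ≤ K) :
    (Measure.pi fun _ : Fin K => μ).real
      {ω | R * √(2 * K * ℓ) ≤ ∑ k : Fin K, (∫ ξ, W k (prefixOf ω k k.isLt.le) ξ ∂μ -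
        W k (prefixOf ω k k.isLt.le) (ω k))} ≤ Real.exp (-ℓ) := by
  have hK0 : (0 : ℝ) < K := by exact_mod_cast hK
  set t : ℝ := √(2 * K * ℓ) / (K * R) with ht
  have hs : √(2 * K * ℓ) ^ 2 = 2 * K * ℓ := Real.sq_sqrt (by positivity)
  have hs0 : 0 < √(2 * K * ℓ) := Real.sqrt_pos.2 (by positivity)
  have ht0 : 0 < t := by positivity
  have htR : t * R * K = √(2 * K * ℓ) := by rw [ht]; field_simp
  let x : (k : ℕ) → (Fin k → E) → E → ℝ := fun k w ξ =>
    t * (∫ ξ', W k w ξ' ∂μ - W k w ξ) - t ^ 2 * ((2 * R - 0) / 2) ^ 2 / 2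
  have hx : ∀ k, Measurable fun p : (Fin k → E) × E => x k p.1 p.2 := by
    intro k
    have h1 : Measurable fun w : Fin k → E => ∫ ξ', W k w ξ' ∂μ :=
      (hW k).stronglyMeasurable.integral_prod_right'.measurable
    exact (((h1.comp measurable_fst).sub (hW k)).const_mul t).sub_const _
  have := measure_exists_le_partialSum_le μ hx (fun k w =>
    lintegral_exp_centered_le_one μ ((hW k).comp measurable_prodMk_left) (hb k w) t) ℓ K
  refine (measureReal_mono ?_).trans this
  intro ω hω
  refine ⟨K, le_rfl, ?_⟩
  have h2 : partialSum x K (prefixOf ω K le_rfl) =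
      t * ∑ k : Fin K, (∫ ξ, W k (prefixOf ω k k.isLt.le) ξ ∂μ -
        W k (prefixOf ω k k.isLt.le) (ω k)) - K * (t ^ 2 * R ^ 2 / 2) := by
    have : partialSum x K (prefixOf ω K le_rfl) = ∑ k : Fin K,
      (t * (∫ ξ, W k (prefixOf ω k k.isLt.le) ξ ∂μ - W k (prefixOf ω k k.isLt.le) (ω k)) -
        t ^ 2 * ((2 * R - 0) / 2) ^ 2 / 2) := rfl
    rw [this, Finset.sum_sub_distrib, ← Finset.mul_sum]
    simp only [Finset.sum_const, Finset.card_univ, Fintype.card_fin, nsmul_eq_mul]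
    ring
  rw [h2]
  have h3 := mul_le_mul_of_nonneg_left (show _ ≤ _ from hω) ht0.le
  have h4 : t * (R * √(2 * K * ℓ)) * K = 2 * K * ℓ := by
    calc t * (R * √(2 * K * ℓ)) * K = (t * R * K) * √(2 * K * ℓ) := by ring
      _ = 2 * K * ℓ := by rw [htR, ← sq, hs]
  have h5 : t * (R * √(2 * K * ℓ)) = 2 * ℓ := by
    have : (t * (R * √(2 * K * ℓ)) - 2 * ℓ) * K = 0 := by linarith
    rcases mul_eq_zero.1 this with h | h
    · linarith
    · exact absurd h hK0.ne'
  have h6 : K * (t ^ 2 * R ^ 2 / 2) = ℓ := by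
    have : (K * (t ^ 2 * R ^ 2 / 2) - ℓ) * K = 0 := by
      have : (t * R * K) ^ 2 = 2 * K * ℓ := by rw [htR, hs]
      nlinarith
    rcases mul_eq_zero.1 this with h | h
    · linarith
    · exact absurd h hK0.ne'
  linarith

end Ville

/-! ### Resampling one coordinate -/

theorem measurePreserving_update {ι F : Type*} [Fintype ι] [DecidableEq ι] [MeasurableSpace F]
    (ν : Measure F) [IsProbabilityMeasure ν] (i : ι) :
    MeasurePreserving (fun p : (ι → F) × F => Function.update p.1 i p.2)
      ((Measure.pi fun _ => ν).prod ν) (Measure.pi fun _ => ν) := by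
  have hm : Measurable fun p : (ι → F) × F => Function.update p.1 i p.2 := by
    refine measurable_pi_lambda _ fun j => ?_
    by_cases h : j = i
    · subst h; simpa using measurable_snd
    · simp only [Function.update_of_ne h]
      exact (measurable_pi_apply j).comp measurable_fst
  refine ⟨hm, (Measure.pi_eq fun s hs => ?_).symm⟩
  rw [Measure.map_apply hm (MeasurableSet.univ_pi hs)]
  have hpre : (fun p : (ι → F) × F => Function.update p.1 i p.2) ⁻¹' (Set.univ.pi s) =
      (Set.univ.pi (Function.update s i Set.univ)) ×ˢ s i := by
    ext p
    simp only [Set.mem_preimage, Set.mem_pi, Set.mem_univ, true_imp_iff, Set.mem_prod]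
    constructor
    · intro h
      refine ⟨fun j => ?_, by simpa using h i⟩
      by_cases hj : j = i
      · subst hj; simp
      · simpa [hj] using h j
    · rintro ⟨h1, h2⟩ j
      by_cases hj : j = i
      · subst hj; simpa using h2
      · simpa [hj] using h1 j
  rw [hpre, Measure.prod_prod, Measure.pi_pi, ← Finset.mul_prod_erase _ _ (Finset.mem_univ i),
    ← Finset.mul_prod_erase _ (fun j => ν (s j)) (Finset.mem_univ i)]
  simp only [Function.update_self, measure_univ, one_mul]
  rw [mul_comm]
  congr 1
  refine Finset.prod_congr rfl fun j hj => ?_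
  rw [Function.update_of_ne (Finset.ne_of_mem_erase hj)]

section Resample

variable {X F : Type*}

/-- Replace one of the transition functions of an episode. -/
def resample {H : ℕ} (h : Fin H) (ξ : Noise X F H) (y : F) : Noise X F H :=
  (ξ.1, Function.update ξ.2 h y)

variable [MeasurableSpace X] [MeasurableSpace F]

theorem measurePreserving_resample (μ : Measure X) [IsProbabilityMeasure μ] (ν : Measure F)
    [IsProbabilityMeasure ν] {H : ℕ} (h : Fin H) :
    MeasurePreserving (fun p : Noise X F H × F => resample h p.1 p.2)
      ((μ.prod (Measure.pi fun _ => ν)).prod ν) (μ.prod (Measure.pi fun _ => ν)) :=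
  ((MeasurePreserving.id μ).prod (measurePreserving_update ν h)).comp
    (MeasurePreserving.mk MeasurableEquiv.prodAssoc.measurable
      Measure.prodAssoc_prod)

end Resample

theorem Measurable.nat_param {Ω β : Type*} [MeasurableSpace Ω] [MeasurableSpace β] {f : Ω → ℕ}
    (hf : Measurable f) {g : ℕ → Ω → β} (hg : ∀ n, Measurable (g n)) :
    Measurable fun z => g (f z) z :=
  (measurable_from_prod_countable_right (f := fun p : ℕ × Ω => g p.1 p.2) hg).comp
    (hf.prodMk measurable_id)

namespace ACMDP

variable {X A F Θ : Type*} [MetricSpace X] [MeasurableSpace X] [MetricSpace A] [MeasurableSpace A]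
  [MeasurableSpace F] [MeasurableSpace Θ] {M : ACMDP X A F Θ} {P : AugState X → A → A}

/-! ### Reachable states -/

theorem rollout_succ (π : AugState X → A) (ξ : Noise X F M.H) (h : Fin M.H) :
    M.rollout P π ξ (h + 1) = M.next (M.rollout P π ξ h)
      (P (M.rollout P π ξ h) (π (M.rollout P π ξ h))) (ξ.2 h) := by
  rw [rollout, dif_pos h.isLt]

theorem rollout_resample (π : AugState X → A) (ξ : Noise X F M.H) (h : Fin M.H) (y : F) :
    ∀ n ≤ (h : ℕ), M.rollout P π (resample h ξ y) n = M.rollout P π ξ n := by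
  intro n
  induction n with
  | zero => intro _; rfl
  | succ n ih =>
    intro hn
    have hnH : n < M.H := by omega
    have e1 := rollout_succ (P := P) π (resample h ξ y) ⟨n, hnH⟩
    have e2 := rollout_succ (P := P) π ξ ⟨n, hnH⟩
    simp only at e1 e2
    rw [e1, e2, ih (by omega)]
    congr 1
    exact Function.update_of_ne (fun hh => by simp [Fin.ext_iff] at hh; omega) _ _

theorem rollout_succ_resample (π : AugState X → A) (ξ : Noise X F M.H) (h : Fin M.H) (y : F) :
    M.rollout P π (resample h ξ y) (h + 1) = M.next (M.rollout P π ξ h)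
      (P (M.rollout P π ξ h) (π (M.rollout P π ξ h))) y := by
  rw [rollout_succ, rollout_resample _ _ _ _ _ le_rfl]
  congr 1
  exact Function.update_self _ _ _

theorem rollout_reachable (hP : M.IsProjection P) (π : AugState X → A) (ξ : Noise X F M.H) :
    ∀ n ≤ M.H, M.Reachable (M.rollout P π ξ n) ∧ (M.rollout P π ξ n).rd = n := by
  intro n
  induction n with
  | zero => exact fun _ => ⟨.start _, rfl⟩
  | succ n ih =>
    intro hn
    obtain ⟨h1, h2⟩ := ih (by omega)
    have e := rollout_succ (P := P) π ξ ⟨n, hn⟩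
    simp only at e
    rw [e]
    have hlt : (M.rollout P π ξ n).rd < M.H := by rw [h2]; exact hn
    refine ⟨.move _ _ _ h1 hlt (hP _ ⟨h1, hlt⟩ _).1, ?_⟩
    change (M.rollout P π ξ n).rd + 1 = n + 1
    rw [h2]

theorem rollout_mem_stateSpace (hP : M.IsProjection P) (π : AugState X → A) (ξ : Noise X F M.H)
    (h : Fin M.H) : M.rollout P π ξ h ∈ M.stateSpace := by
  obtain ⟨h1, h2⟩ := rollout_reachable hP π ξ h h.isLt.le
  exact ⟨h1, by rw [h2]; exact h.isLt⟩

theorem initState_mem_stateSpace (hH : 1 ≤ M.H) (x : X) : M.initState x ∈ M.stateSpace :=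
  ⟨.start x, by change 0 < M.H; omega⟩

/-! ### Measurability -/

section Measurability

variable [SecondCountableTopology A] [BorelSpace A] {L : Learner X A Θ M.H}

theorem measurable_rd : Measurable fun s : AugState X => s.rd := measurable_fst

theorem measurable_priorDist (hm : M.IsMeasurable P L) :
    Measurable fun z : AugState X × A => dist z.2 (M.prior z.1.rd z.1.pos) := by
  refine measurable_snd.dist (Measurable.nat_param (f := fun z : AugState X × A => z.1.rd)
    (measurable_rd.comp measurable_fst) (g := fun n z => M.prior n z.1.pos) fun n => ?_)
  exact (hm.prior n).comp (by fun_prop)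

theorem measurable_costAt (hm : M.IsMeasurable P L) :
    Measurable fun z : AugState X × A => M.cost z.1.rd z.1.pos z.2 := by
  refine Measurable.nat_param (f := fun z : AugState X × A => z.1.rd)
    (measurable_rd.comp measurable_fst) (g := fun n z => M.cost n z.1.pos z.2) fun n => ?_
  exact (hm.cost n).comp (by fun_prop : Measurable fun z : AugState X × A => (z.1.pos, z.2))

theorem measurable_rewardAt (hm : M.IsMeasurable P L) :
    Measurable fun z : AugState X × A => M.reward z.1.rd z.1.pos z.2 := by
  refine Measurable.nat_param (f := fun z : AugState X × A => z.1.rd)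
    (measurable_rd.comp measurable_fst) (g := fun n z => M.reward n z.1.pos z.2) fun n => ?_
  exact (hm.reward n).comp (by fun_prop : Measurable fun z : AugState X × A => (z.1.pos, z.2))

theorem measurable_Rgain (n : ℕ) :
    Measurable fun z : (ℕ → ℝ) × (ℕ → ℝ) => M.Rgain z.1 z.2 n := by
  unfold Rgain priorCostLB
  fun_prop

theorem measurable_next (hm : M.IsMeasurable P L) :
    Measurable fun z : (AugState X × A) × F => M.next z.1.1 z.1.2 z.2 := by
  have hrd : Measurable fun z : (AugState X × A) × F => z.1.1.rd := by fun_prop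
  have hd : Measurable fun z : (AugState X × A) × F =>
      dist z.1.2 (M.prior z.1.1.rd z.1.1.pos) := (measurable_priorDist hm).comp measurable_fst
  have hc : Measurable fun z : (AugState X × A) × F => M.cost z.1.1.rd z.1.1.pos z.1.2 :=
    (measurable_costAt hm).comp measurable_fst
  have hc' : Measurable fun z : (AugState X × A) × F => fun i : ℕ =>
      if i = z.1.1.rd then M.cost z.1.1.rd z.1.1.pos z.1.2 else z.1.1.costs i :=
    measurable_pi_lambda _ fun i =>
      Measurable.ite (measurableSet_eq_fun measurable_const hrd) hc (by fun_prop)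
  have hd' : Measurable fun z : (AugState X × A) × F => fun i : ℕ =>
      if i = z.1.1.rd then dist z.1.2 (M.prior z.1.1.rd z.1.1.pos) else z.1.1.diffs i :=
    measurable_pi_lambda _ fun i =>
      Measurable.ite (measurableSet_eq_fun measurable_const hrd) hd (by fun_prop)
  have hG : Measurable fun z : (AugState X × A) × F => M.Gam z.1.1.rd z.1.1.rd :=
    (measurable_from_nat (f := fun n => M.Gam n n)).comp hrd
  have hstep : Measurable fun z : (AugState X × A) × F => M.step z.2 z.1.1.pos z.1.2 :=
    hm.step.comp (by fun_prop :
      Measurable fun z : (AugState X × A) × F => (z.2, z.1.1.pos, z.1.2))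
  have hdev : Measurable fun z : (AugState X × A) × F => z.1.1.dev := by fun_prop
  have hR := Measurable.nat_param (hrd.add_const 1) fun n =>
    (measurable_Rgain (M := M) n).comp (hc'.prodMk hd')
  exact (hrd.add_const 1).prodMk (hstep.prodMk
    (((((hdev.add_const _).add_const _).sub (hG.mul hd)).max
      ((hR.add_const _).add_const _)).prodMk (hc'.prodMk hd')))

variable {Ω : Type*} [MeasurableSpace Ω]

theorem measurable_expNext [IsMarkovKernel M.trans] (hm : M.IsMeasurable P L) {θ : Ω → Θ}
    {s : Ω → AugState X} {a : Ω → A} {v : Ω → AugState X → ℝ} (hθ : Measurable θ)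
    (hs : Measurable s) (ha : Measurable a) (hv : Measurable fun p : Ω × AugState X => v p.1 p.2) :
    Measurable fun ω => M.expNext (θ ω) (s ω) (a ω) (v ω) := by
  have h1 : Measurable fun p : Ω × F => v p.1 (M.next (s p.1) (a p.1) p.2) :=
    hv.comp (measurable_fst.prodMk ((measurable_next hm).comp
      (((hs.comp measurable_fst).prodMk (ha.comp measurable_fst)).prodMk measurable_snd)))
  exact (h1.stronglyMeasurable.integral_kernel_prod_right' (κ := M.trans.comap θ hθ)).measurable

theorem measurable_policyValueAux [IsMarkovKernel M.trans] (hm : M.IsMeasurable P L)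
    {π : Ω → AugState X → A} (hπ : Measurable fun p : Ω × AugState X => π p.1 p.2) (n : ℕ) :
    Measurable fun p : Ω × AugState X => M.policyValueAux P M.truth (π p.1) n p.2 := by
  induction n with
  | zero => exact measurable_const
  | succ n ih =>
    have ha : Measurable fun p : Ω × AugState X => P p.2 (π p.1 p.2) :=
      hm.proj.comp (measurable_snd.prodMk hπ)
    refine ((measurable_rewardAt hm).comp (measurable_snd.prodMk ha)).add ?_
    exact measurable_expNext hm measurable_const measurable_snd ha
      (v := fun p => M.policyValueAux P M.truth (π p.1) n)
      (ih.comp ((measurable_fst.comp measurable_fst).prodMk measurable_snd))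

theorem measurable_policyValue [IsMarkovKernel M.trans] (hm : M.IsMeasurable P L)
    {π : Ω → AugState X → A} (hπ : Measurable fun p : Ω × AugState X => π p.1 p.2) :
    Measurable fun p : Ω × AugState X => M.policyValue P M.truth (π p.1) p.2 :=
  Measurable.nat_param (f := fun p : Ω × AugState X => M.H - p.2.rd)
    ((measurable_from_nat (f := fun n => M.H - n)).comp (measurable_rd.comp measurable_snd))
    fun n => measurable_policyValueAux hm hπ n

theorem measurable_initState : Measurable fun x : X => M.initState x := by
  unfold initState
  fun_prop

theorem measurable_rollout (hm : M.IsMeasurable P L) {π : Ω → AugState X → A}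
    (hπ : Measurable fun p : Ω × AugState X => π p.1 p.2) {ξ : Ω → Noise X F M.H}
    (hξ : Measurable ξ) (n : ℕ) : Measurable fun ω => M.rollout P (π ω) (ξ ω) n := by
  induction n with
  | zero => exact measurable_initState.comp hξ.fst
  | succ n ih =>
    by_cases hn : n < M.H
    · simp only [rollout, dif_pos hn]
      have h1 : Measurable fun ω => π ω (M.rollout P (π ω) (ξ ω) n) :=
        hπ.comp (measurable_id.prodMk ih)
      exact (measurable_next hm).comp
        ((ih.prodMk (hm.proj.comp (ih.prodMk h1))).prodMk ((measurable_pi_apply _).comp hξ.snd))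
    · simpa only [rollout, dif_neg hn] using ih

theorem measurable_episode (hm : M.IsMeasurable P L) (k : ℕ) :
    Measurable fun p : (Fin k → EpisodeData X A Θ M.H) × Noise X F M.H =>
      M.episode P L k p.1 p.2 := by
  have hπ : Measurable fun q : ((Fin k → EpisodeData X A Θ M.H) × Noise X F M.H) × AugState X =>
      L.policy k q.1.1 q.1.2.1 q.2 :=
    (hm.policy k).comp (by fun_prop :
      Measurable fun q : ((Fin k → EpisodeData X A Θ M.H) × Noise X F M.H) × AugState X =>
        (q.1.1, q.1.2.1, q.2))
  have hs := fun n => measurable_rollout hm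
    (π := fun p : (Fin k → EpisodeData X A Θ M.H) × Noise X F M.H => L.policy k p.1 p.2.1)
    hπ measurable_snd n
  refine ((hm.select k).comp (by fun_prop :
    Measurable fun p : (Fin k → EpisodeData X A Θ M.H) × Noise X F M.H =>
      (p.1, p.2.1))).prodMk (Measurable.prodMk ?_ ?_)
  · exact measurable_pi_lambda _ fun h => hs h
  · exact measurable_pi_lambda _ fun h =>
      hm.proj.comp ((hs h).prodMk (hπ.comp (measurable_id.prodMk (hs h))))

theorem measurable_history (hm : M.IsMeasurable P L) (k : ℕ) : Measurable (M.history P L k) := by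
  induction k with
  | zero => exact measurable_const
  | succ k ih =>
    have h1 : Measurable fun ω : Fin (k + 1) → Noise X F M.H => M.history P L k (Fin.init ω) :=
      ih.comp (measurable_fin_init k)
    have h2 : Measurable fun ω : Fin (k + 1) → Noise X F M.H =>
        M.episode P L k (M.history P L k (Fin.init ω)) (ω (Fin.last k)) :=
      (measurable_episode hm k).comp (h1.prodMk (measurable_pi_apply _))
    refine measurable_pi_lambda _ fun i => ?_
    refine Fin.lastCases ?_ (fun j => ?_) i
    · simpa [history] using h2
    · simp only [history, Fin.snoc_castSucc]
      exact (measurable_pi_apply j).comp h1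

end Measurability

theorem history_apply (L : Learner X A Θ M.H) (k : ℕ) (ω : Fin k → Noise X F M.H) (i : Fin k) :
    M.history P L k ω i =
      M.episode P L i (M.history P L i (prefixOf ω i i.isLt.le)) (ω i) := by
  induction k with
  | zero => exact i.elim0
  | succ k ih =>
    refine Fin.lastCases ?_ (fun j => ?_) i
    · simp only [history, Fin.snoc_last]
      rfl
    · simp only [history, Fin.snoc_castSucc]
      exact ih _ j

/-! ### Bounds on value functions -/

/-- `v` is measurable, and bounded by `V` on the states that can occur. -/
structure IsBdd (M : ACMDP X A F Θ) (V : ℝ) (v : AugState X → ℝ) : Prop where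
  measurable : Measurable v
  abs_le : ∀ s, M.Reachable s → s.rd ≤ M.H → |v s| ≤ V

section Bounds

variable [SecondCountableTopology A] [BorelSpace A] {L : Learner X A Θ M.H} {V : ℝ}

theorem IsBdd.integrable (hm : M.IsMeasurable P L) {v : AugState X → ℝ} (hv : M.IsBdd V v)
    {s : AugState X} {a : A} (hs : s ∈ M.stateSpace) (ha : a ∈ M.safe s) (μ : Measure F)
    [IsFiniteMeasure μ] : Integrable (fun f => v (M.next s a f)) μ := by
  have h1 : Measurable fun f => v (M.next s a f) :=
    hv.measurable.comp ((measurable_next hm).comp (measurable_prodMk_left (x := (s, a))))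
  refine Integrable.of_bound h1.aestronglyMeasurable V (.of_forall fun f => ?_)
  exact hv.abs_le _ (.move _ _ _ hs.1 hs.2 ha) (Nat.succ_le_of_lt hs.2)

theorem IsBdd.abs_next_le {v : AugState X → ℝ} (hv : M.IsBdd V v)
    {s : AugState X} {a : A} (hs : s ∈ M.stateSpace) (ha : a ∈ M.safe s) (f : F) :
    |v (M.next s a f)| ≤ V :=
  hv.abs_le _ (.move _ _ _ hs.1 hs.2 ha) (Nat.succ_le_of_lt hs.2)

theorem IsBdd.abs_expNext_le [IsMarkovKernel M.trans] {v : AugState X → ℝ} (hv : M.IsBdd V v)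
    {s : AugState X} {a : A} (hs : s ∈ M.stateSpace) (ha : a ∈ M.safe s) (θ : Θ) :
    |M.expNext θ s a v| ≤ V := by
  have := norm_integral_le_of_norm_le_const (μ := M.trans θ) (f := fun f => v (M.next s a f))
    (.of_forall fun f => hv.abs_next_le hs ha f)
  simpa [expNext] using this

theorem optValue_eq_iSup (θ : Θ) {s : AugState X} (hs : s.rd < M.H) :
    M.optValue P θ s = ⨆ a, M.optQ P θ s a := by
  obtain ⟨n, hn⟩ : ∃ n, M.H - s.rd = n + 1 := ⟨M.H - s.rd - 1, by omega⟩
  have h : ∀ a f, M.H - (M.next s a f).rd = n := fun a f => by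
    change M.H - (s.rd + 1) = n
    omega
  simp only [optValue, hn, optValueAux, optQ, expNext, h]

theorem optValue_eq_zero (θ : Θ) {s : AugState X} (hs : s.rd = M.H) : M.optValue P θ s = 0 := by
  simp [optValue, hs, optValueAux]

theorem policyValue_eq_zero (θ : Θ) (π : AugState X → A) {s : AugState X} (hs : s.rd = M.H) :
    M.policyValue P θ π s = 0 := by
  simp [policyValue, hs, policyValueAux]

theorem policyValue_eq (θ : Θ) (π : AugState X → A) {s : AugState X} (hs : s.rd < M.H) :
    M.policyValue P θ π s = M.reward s.rd s.pos (P s (π s)) +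
      M.expNext θ s (P s (π s)) (M.policyValue P θ π) := by
  obtain ⟨n, hn⟩ : ∃ n, M.H - s.rd = n + 1 := ⟨M.H - s.rd - 1, by omega⟩
  have h : ∀ a f, M.H - (M.next s a f).rd = n := fun a f => by
    change M.H - (s.rd + 1) = n
    omega
  simp only [policyValue, hn, policyValueAux, expNext, h]

theorem optQ_le_optValue (hb : M.ValueBounded P V) (θ : Θ) {s : AugState X}
    (hs : s ∈ M.stateSpace) (a : A) : M.optQ P θ s a ≤ M.optValue P θ s := by
  rw [optValue_eq_iSup θ hs.2]
  refine le_ciSup (f := fun a => M.optQ P θ s a) ⟨V, ?_⟩ a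
  rintro _ ⟨a', rfl⟩
  exact (abs_le.1 (hb.2 θ s hs a')).2

theorem isBdd_optValue [Nonempty A] (hm : M.IsMeasurable P L) (hV : 0 ≤ V)
    (hb : M.ValueBounded P V) (θ : Θ) : M.IsBdd V (M.optValue P θ) := by
  refine ⟨hm.value.comp measurable_prodMk_left, fun s hs hsH => ?_⟩
  rcases hsH.lt_or_eq with h | h
  · have hsS : s ∈ M.stateSpace := ⟨hs, h⟩
    rw [abs_le]
    constructor
    · obtain ⟨a⟩ := ‹Nonempty A›
      exact (abs_le.1 (hb.2 θ s hsS a)).1.trans (optQ_le_optValue hb θ hsS a)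
    · rw [optValue_eq_iSup θ h]
      exact ciSup_le fun a => (abs_le.1 (hb.2 θ s hsS a)).2
  · rw [optValue_eq_zero θ h, abs_zero]
    exact hV

theorem isBdd_policyValue [IsMarkovKernel M.trans] (hm : M.IsMeasurable P L) (hV : 0 ≤ V)
    (hb : M.ValueBounded P V) {π : AugState X → A} (hπ : Measurable π) :
    M.IsBdd V (M.policyValue P M.truth π) := by
  refine ⟨(measurable_policyValue hm (π := fun _ : Unit => π) (hπ.comp measurable_snd)).comp
    (measurable_prodMk_left (x := ())), fun s hs hsH => ?_⟩
  rcases hsH.lt_or_eq with h | h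
  · exact hb.1 π hπ s ⟨hs, h⟩
  · rw [policyValue_eq_zero _ _ h, abs_zero]
    exact hV

/-- No policy does better than the optimal value of the true model. -/
theorem policyValue_le_optValue [Nonempty A] [IsMarkovKernel M.trans] (hP : M.IsProjection P)
    (hm : M.IsMeasurable P L) (hV : 0 ≤ V) (hb : M.ValueBounded P V) {π : AugState X → A}
    (hπ : Measurable π) :
    ∀ (n : ℕ) (s : AugState X), M.Reachable s → s.rd + n = M.H →
      M.policyValue P M.truth π s ≤ M.optValue P M.truth s := by
  intro n
  induction n with
  | zero =>
    intro s _ h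
    rw [policyValue_eq_zero _ _ (by simpa using h), optValue_eq_zero _ (by simpa using h)]
  | succ n ih =>
    intro s hs h
    have hlt : s.rd < M.H := by omega
    have ha := (hP s ⟨hs, hlt⟩ (π s)).1
    rw [policyValue_eq _ _ hlt]
    refine le_trans ?_ (optQ_le_optValue hb M.truth ⟨hs, hlt⟩ (π s))
    refine add_le_add_right (integral_mono
      ((isBdd_policyValue hm hV hb hπ).integrable hm ⟨hs, hlt⟩ ha _)
      ((isBdd_optValue hm hV hb _).integrable hm ⟨hs, hlt⟩ ha _) fun f => ?_) _
    exact ih _ (.move _ _ _ hs hlt ha) (by change s.rd + 1 + n = M.H; omega)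

/-- The prediction gap between two models at a state-action pair. -/
def gap (M : ACMDP X A F Θ) (θ θ' : Θ) (s : AugState X) (a : A) (v : AugState X → ℝ) : ℝ :=
  M.expNext θ s a v - M.expNext θ' s a v

/-- One step of the simulation identity, for a greedy action. -/
theorem optValue_sub_policyValue [Nonempty A] [IsMarkovKernel M.trans] (hP : M.IsProjection P)
    (hm : M.IsMeasurable P L) (hV : 0 ≤ V) (hb : M.ValueBounded P V) {π : AugState X → A}
    (hπ : Measurable π) {θ : Θ} {s : AugState X} (hs : s ∈ M.stateSpace)
    (hgreedy : ∀ a, M.optQ P θ s a ≤ M.optQ P θ s (π s)) :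
    M.optValue P θ s - M.policyValue P M.truth π s =
      M.gap θ M.truth s (P s (π s)) (M.optValue P θ) +
      M.expNext M.truth s (P s (π s)) fun s' => M.optValue P θ s' - M.policyValue P M.truth π s' := by
  have ha := (hP s hs (π s)).1
  have h1 : M.optValue P θ s = M.optQ P θ s (π s) := by
    refine le_antisymm ?_ (optQ_le_optValue hb θ hs _)
    rw [optValue_eq_iSup θ hs.2]
    exact ciSup_le hgreedy
  have h2 : M.expNext M.truth s (P s (π s))
      (fun s' => M.optValue P θ s' - M.policyValue P M.truth π s') =
      M.expNext M.truth s (P s (π s)) (M.optValue P θ) -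
        M.expNext M.truth s (P s (π s)) (M.policyValue P M.truth π) :=
    integral_sub ((isBdd_optValue hm hV hb _).integrable hm hs ha _)
      ((isBdd_policyValue hm hV hb hπ).integrable hm hs ha _)
  rw [h1, h2, policyValue_eq _ _ hs.2, gap, optQ]
  ring

end Bounds

end ACMDP

namespace ACMDP

variable {X A F Θ : Type*} [MetricSpace X] [MeasurableSpace X] [MetricSpace A] [MeasurableSpace A]
  [MeasurableSpace F] [MeasurableSpace Θ]

/-! ### One episode -/

/-- The law of the randomness of one episode. -/
def episodeLaw (M : ACMDP X A F Θ) : Measure (Noise X F M.H) :=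
  M.initLaw.prod (Measure.pi fun _ => M.trans M.truth)

instance (M : ACMDP X A F Θ) [IsProbabilityMeasure M.initLaw] [IsMarkovKernel M.trans] :
    IsProbabilityMeasure M.episodeLaw := by
  unfold episodeLaw; infer_instance

/-- The state at round `n` of an episode whose ML policy `ρ` may depend on the initial state. -/
def stateAt (M : ACMDP X A F Θ) (P : AugState X → A → A) (ρ : X → AugState X → A)
    (ξ : Noise X F M.H) (n : ℕ) : AugState X := M.rollout P (ρ ξ.1) ξ n

/-- The action executed at round `n`. -/
def actionAt (M : ACMDP X A F Θ) (P : AugState X → A → A) (ρ : X → AugState X → A)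
    (ξ : Noise X F M.H) (n : ℕ) : A := P (M.stateAt P ρ ξ n) (ρ ξ.1 (M.stateAt P ρ ξ n))

/-- The prediction gap between `θ` and the truth at round `n`, for the value function of the model `σ`
selected for the episode. -/
def gapAt (M : ACMDP X A F Θ) (P : AugState X → A → A) (θ : Θ) (σ : X → Θ)
    (ρ : X → AugState X → A) (ξ : Noise X F M.H) (n : ℕ) : ℝ :=
  M.gap θ M.truth (M.stateAt P ρ ξ n) (M.actionAt P ρ ξ n) (M.optValue P (σ ξ.1))

/-- The error of the true model in predicting the next value. -/
def noiseAt (M : ACMDP X A F Θ) (P : AugState X → A → A) (σ : X → Θ)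
    (ρ : X → AugState X → A) (ξ : Noise X F M.H) (n : ℕ) : ℝ :=
  M.optValue P (σ ξ.1) (M.stateAt P ρ ξ (n + 1)) -
    M.expNext M.truth (M.stateAt P ρ ξ n) (M.actionAt P ρ ξ n) (M.optValue P (σ ξ.1))

variable {M : ACMDP X A F Θ} {P : AugState X → A → A}

theorem stateAt_mem (hP : M.IsProjection P) (ρ : X → AugState X → A) (ξ : Noise X F M.H) {n : ℕ}
    (hn : n < M.H) : M.stateAt P ρ ξ n ∈ M.stateSpace :=
  rollout_mem_stateSpace hP _ ξ ⟨n, hn⟩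

theorem actionAt_mem (hP : M.IsProjection P) (ρ : X → AugState X → A) (ξ : Noise X F M.H) {n : ℕ}
    (hn : n < M.H) : M.actionAt P ρ ξ n ∈ M.safe (M.stateAt P ρ ξ n) :=
  (hP _ (stateAt_mem hP ρ ξ hn) _).1

theorem stateAt_reachable (hP : M.IsProjection P) (ρ : X → AugState X → A) (ξ : Noise X F M.H)
    {n : ℕ} (hn : n ≤ M.H) :
    M.Reachable (M.stateAt P ρ ξ n) ∧ (M.stateAt P ρ ξ n).rd = n :=
  rollout_reachable hP _ ξ n hn

theorem stateAt_resample (ρ : X → AugState X → A) (ξ : Noise X F M.H) (h : Fin M.H) (y : F) {n : ℕ}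
    (hn : n ≤ h) : M.stateAt P ρ (resample h ξ y) n = M.stateAt P ρ ξ n :=
  rollout_resample _ ξ h y n hn

theorem actionAt_resample (ρ : X → AugState X → A) (ξ : Noise X F M.H) (h : Fin M.H) (y : F) {n : ℕ}
    (hn : n ≤ h) : M.actionAt P ρ (resample h ξ y) n = M.actionAt P ρ ξ n := by
  simp only [actionAt, stateAt_resample ρ ξ h y hn]
  rfl

theorem stateAt_succ_resample (ρ : X → AugState X → A) (ξ : Noise X F M.H) (h : Fin M.H) (y : F) :
    M.stateAt P ρ (resample h ξ y) (h + 1) =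
      M.next (M.stateAt P ρ ξ h) (M.actionAt P ρ ξ h) y :=
  rollout_succ_resample _ ξ h y

section

variable [SecondCountableTopology A] [BorelSpace A] [IsMarkovKernel M.trans]
  {L : Learner X A Θ M.H} {V : ℝ}

theorem gap_last (θ θ' : Θ) {s : AugState X} (hs : s.rd + 1 = M.H) (a : A) (η : Θ) :
    M.gap θ θ' s a (M.optValue P η) = 0 := by
  have h : ∀ f, M.optValue P η (M.next s a f) = 0 := fun f => optValue_eq_zero η hs
  simp [gap, expNext, h]

theorem measurable_stateAt (hm : M.IsMeasurable P L) {Ω : Type*} [MeasurableSpace Ω]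
    {ρ : Ω → X → AugState X → A}
    (hρ : Measurable fun p : Ω × X × AugState X => ρ p.1 p.2.1 p.2.2) (n : ℕ) :
    Measurable fun p : Ω × Noise X F M.H => M.stateAt P (ρ p.1) p.2 n :=
  measurable_rollout hm (π := fun p : Ω × Noise X F M.H => ρ p.1 p.2.1)
    (hρ.comp (by fun_prop : Measurable fun q : (Ω × Noise X F M.H) × AugState X =>
      (q.1.1, q.1.2.1, q.2))) measurable_snd n

theorem measurable_actionAt (hm : M.IsMeasurable P L) {Ω : Type*} [MeasurableSpace Ω]
    {ρ : Ω → X → AugState X → A}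
    (hρ : Measurable fun p : Ω × X × AugState X => ρ p.1 p.2.1 p.2.2) (n : ℕ) :
    Measurable fun p : Ω × Noise X F M.H => M.actionAt P (ρ p.1) p.2 n := by
  have hs := measurable_stateAt hm hρ n
  exact hm.proj.comp (hs.prodMk (hρ.comp (measurable_fst.prodMk
    ((measurable_fst.comp measurable_snd).prodMk hs))))

theorem measurable_expNextAt (hm : M.IsMeasurable P L) {Ω : Type*} [MeasurableSpace Ω]
    {ρ : Ω → X → AugState X → A}
    (hρ : Measurable fun p : Ω × X × AugState X => ρ p.1 p.2.1 p.2.2)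
    {σ : Ω → X → Θ} (hσ : Measurable fun p : Ω × X => σ p.1 p.2)
    {θ : Ω × Noise X F M.H → Θ} (hθ : Measurable θ) (n : ℕ) :
    Measurable fun p : Ω × Noise X F M.H => M.expNext (θ p) (M.stateAt P (ρ p.1) p.2 n)
      (M.actionAt P (ρ p.1) p.2 n) (M.optValue P (σ p.1 p.2.1)) := by
  refine measurable_expNext hm hθ (measurable_stateAt hm hρ n) (measurable_actionAt hm hρ n)
    (v := fun p => M.optValue P (σ p.1 p.2.1)) ?_
  exact hm.value.comp ((hσ.comp (by fun_prop : Measurable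
    fun q : (Ω × Noise X F M.H) × AugState X => (q.1.1, q.1.2.1))).prodMk measurable_snd)

theorem measurable_gapAt (hm : M.IsMeasurable P L) {Ω : Type*} [MeasurableSpace Ω]
    {ρ : Ω → X → AugState X → A}
    (hρ : Measurable fun p : Ω × X × AugState X => ρ p.1 p.2.1 p.2.2)
    {σ : Ω → X → Θ} (hσ : Measurable fun p : Ω × X => σ p.1 p.2)
    {θ : Ω × Noise X F M.H → Θ} (hθ : Measurable θ) (n : ℕ) :
    Measurable fun p : Ω × Noise X F M.H => M.gapAt P (θ p) (σ p.1) (ρ p.1) p.2 n :=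
  (measurable_expNextAt hm hρ hσ hθ n).sub (measurable_expNextAt hm hρ hσ measurable_const n)

theorem measurable_noiseAt (hm : M.IsMeasurable P L) {Ω : Type*} [MeasurableSpace Ω]
    {ρ : Ω → X → AugState X → A}
    (hρ : Measurable fun p : Ω × X × AugState X => ρ p.1 p.2.1 p.2.2)
    {σ : Ω → X → Θ} (hσ : Measurable fun p : Ω × X => σ p.1 p.2) (n : ℕ) :
    Measurable fun p : Ω × Noise X F M.H => M.noiseAt P (σ p.1) (ρ p.1) p.2 n := by
  refine Measurable.sub ?_ (measurable_expNextAt hm hρ hσ measurable_const n)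
  exact hm.value.comp ((hσ.comp (by fun_prop : Measurable
    fun q : Ω × Noise X F M.H => (q.1, q.2.1))).prodMk (measurable_stateAt hm hρ (n + 1)))

variable [Nonempty A]

theorem abs_gapAt_le (hP : M.IsProjection P) (hm : M.IsMeasurable P L) (hV : 0 ≤ V)
    (hb : M.ValueBounded P V) (θ : Θ) (σ : X → Θ) (ρ : X → AugState X → A) (ξ : Noise X F M.H)
    {n : ℕ} (hn : n < M.H) : |M.gapAt P θ σ ρ ξ n| ≤ 2 * V := by
  have h1 := (isBdd_optValue hm hV hb (σ ξ.1)).abs_expNext_le (stateAt_mem hP ρ ξ hn)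
    (actionAt_mem hP ρ ξ hn) θ
  have h2 := (isBdd_optValue hm hV hb (σ ξ.1)).abs_expNext_le (stateAt_mem hP ρ ξ hn)
    (actionAt_mem hP ρ ξ hn) M.truth
  rw [abs_le] at h1 h2 ⊢
  unfold gapAt gap
  constructor <;> linarith

theorem abs_noiseAt_le (hP : M.IsProjection P) (hm : M.IsMeasurable P L) (hV : 0 ≤ V)
    (hb : M.ValueBounded P V) (σ : X → Θ) (ρ : X → AugState X → A) (ξ : Noise X F M.H)
    {n : ℕ} (hn : n < M.H) : |M.noiseAt P σ ρ ξ n| ≤ 2 * V := by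
  have h1 := (isBdd_optValue hm hV hb (σ ξ.1)).abs_expNext_le (stateAt_mem hP ρ ξ hn)
    (actionAt_mem hP ρ ξ hn) M.truth
  obtain ⟨hr, hrd⟩ := stateAt_reachable hP ρ ξ (Nat.succ_le_of_lt hn)
  have h2 := (isBdd_optValue hm hV hb (σ ξ.1)).abs_le _ hr (by rw [hrd]; omega)
  rw [abs_le] at h1 h2 ⊢
  unfold noiseAt
  constructor <;> linarith

/-- The exponential supermartingale of an episode: multiplied by the prediction gap of a fixed model,
the prediction noise has conditional variance proxy `V² gap²`. -/
theorem lintegral_exp_gap_noise_le_one [IsProbabilityMeasure M.initLaw] (hP : M.IsProjection P)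
    (hm : M.IsMeasurable P L) (hV : 0 ≤ V) (hb : M.ValueBounded P V) (θ : Θ) {σ : X → Θ}
    (hσ : Measurable σ) {ρ : X → AugState X → A}
    (hρ : Measurable fun p : X × AugState X => ρ p.1 p.2) (t : ℝ) :
    ∀ n ≤ M.H, ∫⁻ ξ, ENNReal.ofReal (Real.exp (∑ h ∈ Finset.range n,
      (t * (M.gapAt P θ σ ρ ξ h * M.noiseAt P σ ρ ξ h) -
        t ^ 2 * V ^ 2 * M.gapAt P θ σ ρ ξ h ^ 2 / 2))) ∂M.episodeLaw ≤ 1 := by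
  intro n
  induction n with
  | zero => intro _; simp
  | succ n ih =>
    intro hn
    have hg : ∀ h, Measurable fun ξ => M.gapAt P θ σ ρ ξ h := fun h =>
      (measurable_gapAt hm (Ω := Unit) (ρ := fun _ => ρ) (hρ.comp measurable_snd)
        (σ := fun _ => σ) (hσ.comp measurable_snd) (measurable_const (a := θ)) h).comp
        (measurable_prodMk_left (x := ()))
    have hz : ∀ h, Measurable fun ξ => M.noiseAt P σ ρ ξ h := fun h =>
      (measurable_noiseAt hm (Ω := Unit) (ρ := fun _ => ρ) (hρ.comp measurable_snd)
        (σ := fun _ => σ) (hσ.comp measurable_snd) h).comp (measurable_prodMk_left (x := ()))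
    set inc : Noise X F M.H → ℕ → ℝ := fun ξ h =>
      t * (M.gapAt P θ σ ρ ξ h * M.noiseAt P σ ρ ξ h) -
        t ^ 2 * V ^ 2 * M.gapAt P θ σ ρ ξ h ^ 2 / 2 with hinc
    have hmi : ∀ h, Measurable fun ξ => inc ξ h := fun h =>
      (((hg h).mul (hz h)).const_mul t).sub ((((hg h).pow_const 2).const_mul _).div_const _)
    have hms : ∀ N, Measurable fun ξ => ENNReal.ofReal
        (Real.exp (∑ h ∈ Finset.range N, inc ξ h)) := fun N =>
      (Finset.measurable_sum _ fun h _ => hmi h).exp.ennreal_ofReal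
    let i : Fin M.H := ⟨n, hn⟩
    have hres := measurePreserving_resample (F := F) M.initLaw (M.trans M.truth) i
    -- the earlier increments do not see the resampled transition function
    have hold : ∀ ξ y, ∀ h < n, inc (resample i ξ y) h = inc ξ h := by
      intro ξ y h hh
      have e1 : M.gapAt P θ σ ρ (resample i ξ y) h = M.gapAt P θ σ ρ ξ h := by
        simp only [gapAt, stateAt_resample ρ ξ i y hh.le, actionAt_resample ρ ξ i y hh.le]
        rfl
      have e2 : M.noiseAt P σ ρ (resample i ξ y) h = M.noiseAt P σ ρ ξ h := by
        simp only [noiseAt, stateAt_resample ρ ξ i y hh.le, actionAt_resample ρ ξ i y hh.le,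
          stateAt_resample ρ ξ i y (Nat.succ_le_of_lt hh)]
        rfl
      simp only [hinc, e1, e2]
    have hnew : ∀ ξ, ∫⁻ y, ENNReal.ofReal (Real.exp (inc (resample i ξ y) n))
        ∂(M.trans M.truth) ≤ 1 := by
      intro ξ
      have hs := stateAt_mem hP ρ ξ hn
      have ha := actionAt_mem hP ρ ξ hn
      have hv := isBdd_optValue hm hV hb (σ ξ.1)
      have hvm : Measurable fun y =>
          M.optValue P (σ ξ.1) (M.next (M.stateAt P ρ ξ n) (M.actionAt P ρ ξ n) y) :=
        hv.measurable.comp ((measurable_next hm).comp (measurable_prodMk_left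
          (x := (M.stateAt P ρ ξ n, M.actionAt P ρ ξ n))))
      refine le_trans (le_of_eq ?_) (lintegral_exp_centered_le_one (M.trans M.truth) hvm
        (a := -V) (b := V) (fun y => abs_le.1 (hv.abs_next_le hs ha y))
        (-(t * M.gapAt P θ σ ρ ξ n)))
      refine lintegral_congr fun y => ?_
      have e1 : M.gapAt P θ σ ρ (resample i ξ y) n = M.gapAt P θ σ ρ ξ n := by
        simp only [gapAt, stateAt_resample ρ ξ i y (le_refl n), actionAt_resample ρ ξ i y (le_refl n)]
        rfl
      have e2 : M.noiseAt P σ ρ (resample i ξ y) n =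
          M.optValue P (σ ξ.1) (M.next (M.stateAt P ρ ξ n) (M.actionAt P ρ ξ n) y) -
          ∫ y', M.optValue P (σ ξ.1) (M.next (M.stateAt P ρ ξ n) (M.actionAt P ρ ξ n) y')
            ∂(M.trans M.truth) := by
        have := stateAt_succ_resample (P := P) ρ ξ i y
        simp only [i] at this
        simp only [noiseAt, stateAt_resample ρ ξ i y (le_refl n),
          actionAt_resample ρ ξ i y (le_refl n)]
        simp only [i, this]
        rfl
      congr 2
      simp only [hinc, e1, e2]
      ring
    calc ∫⁻ ξ, ENNReal.ofReal (Real.exp (∑ h ∈ Finset.range (n + 1), inc ξ h)) ∂M.episodeLaw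
        = ∫⁻ p, ENNReal.ofReal (Real.exp (∑ h ∈ Finset.range (n + 1), inc (resample i p.1 p.2) h))
            ∂(M.episodeLaw.prod (M.trans M.truth)) := (hres.lintegral_comp (hms (n + 1))).symm
      _ = ∫⁻ ξ, ∫⁻ y, ENNReal.ofReal
            (Real.exp (∑ h ∈ Finset.range (n + 1), inc (resample i ξ y) h))
            ∂(M.trans M.truth) ∂M.episodeLaw :=
          lintegral_prod _ ((hms (n + 1)).comp hres.measurable).aemeasurable
      _ ≤ ∫⁻ ξ, ENNReal.ofReal (Real.exp (∑ h ∈ Finset.range n, inc ξ h)) ∂M.episodeLaw := by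
          refine lintegral_mono fun ξ => ?_
          have e : ∀ y, ENNReal.ofReal
              (Real.exp (∑ h ∈ Finset.range (n + 1), inc (resample i ξ y) h)) =
              ENNReal.ofReal (Real.exp (∑ h ∈ Finset.range n, inc ξ h)) *
                ENNReal.ofReal (Real.exp (inc (resample i ξ y) n)) := by
            intro y
            rw [Finset.sum_range_succ, Real.exp_add, ENNReal.ofReal_mul (Real.exp_pos _).le,
              Finset.sum_congr rfl fun h hh => hold ξ y h (Finset.mem_range.1 hh)]
          have hmy : Measurable fun y => ENNReal.ofReal (Real.exp (inc (resample i ξ y) n)) :=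
            ((hmi n).comp (hres.measurable.comp (measurable_prodMk_left (x := ξ)))).exp.ennreal_ofReal
          simp only [e]
          rw [lintegral_const_mul _ hmy]
          exact (mul_le_mul_right (hnew ξ) _).trans (mul_one _).le
      _ ≤ 1 := ih (by omega)

/-- The simulation lemma: the excess of the predicted over the true value of a greedy policy is at most the
expected sum of the prediction gaps along an episode. -/
theorem integral_optValue_sub_policyValue_le [IsProbabilityMeasure M.initLaw]
    (hP : M.IsProjection P) (hm : M.IsMeasurable P L) (hV : 0 ≤ V) (hb : M.ValueBounded P V)
    {σ : X → Θ} (hσ : Measurable σ) {ρ : X → AugState X → A}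
    (hρ : Measurable fun p : X × AugState X => ρ p.1 p.2)
    (hgreedy : ∀ x, ∀ s ∈ M.stateSpace, ∀ a, M.optQ P (σ x) s a ≤ M.optQ P (σ x) s (ρ x s)) :
    ∫ x, (M.optValue P (σ x) (M.initState x) - M.policyValue P M.truth (ρ x) (M.initState x))
      ∂M.initLaw ≤
    ∫ ξ, ∑ h ∈ Finset.range M.H, |M.gapAt P (σ ξ.1) σ ρ ξ h| ∂M.episodeLaw := by
  set D : X → AugState X → ℝ := fun x s =>
    M.optValue P (σ x) s - M.policyValue P M.truth (ρ x) s with hD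
  have hρx : ∀ x, Measurable (ρ x) := fun x => hρ.comp measurable_prodMk_left
  have hDm : Measurable fun p : X × AugState X => D p.1 p.2 :=
    (hm.value.comp ((hσ.comp measurable_fst).prodMk measurable_snd)).sub
      (measurable_policyValue hm hρ)
  have hDb : ∀ x s, M.Reachable s → s.rd ≤ M.H → |D x s| ≤ 2 * V := by
    intro x s h1 h2
    have h3 := abs_le.1 ((isBdd_optValue hm hV hb (σ x)).abs_le s h1 h2)
    have h4 := abs_le.1 ((isBdd_policyValue hm hV hb (hρx x)).abs_le s h1 h2)
    rw [abs_le]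
    constructor <;> simp only [hD] <;> linarith
  have hst : ∀ n, Measurable fun ξ => M.stateAt P ρ ξ n := fun n =>
    (measurable_stateAt hm (Ω := Unit) (ρ := fun _ => ρ) (hρ.comp measurable_snd) n).comp
      (measurable_prodMk_left (x := ()))
  have hat : ∀ n, Measurable fun ξ => M.actionAt P ρ ξ n := fun n =>
    (measurable_actionAt hm (Ω := Unit) (ρ := fun _ => ρ) (hρ.comp measurable_snd) n).comp
      (measurable_prodMk_left (x := ()))
  have hgm : ∀ n, Measurable fun ξ => M.gapAt P (σ ξ.1) σ ρ ξ n := fun n =>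
    (measurable_gapAt hm (Ω := Unit) (ρ := fun _ => ρ) (hρ.comp measurable_snd)
      (σ := fun _ => σ) (hσ.comp measurable_snd) (θ := fun p => σ p.2.1)
      (hσ.comp (measurable_fst.comp measurable_snd)) n).comp (measurable_prodMk_left (x := ()))
  have hDn : ∀ n ≤ M.H, Integrable (fun ξ => D ξ.1 (M.stateAt P ρ ξ n)) M.episodeLaw := by
    intro n hn
    refine Integrable.of_bound (hDm.comp (measurable_fst.prodMk (hst n))).aestronglyMeasurable
      (2 * V) (.of_forall fun ξ => ?_)
    obtain ⟨h1, h2⟩ := stateAt_reachable hP ρ ξ hn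
    exact hDb _ _ h1 (by rw [h2]; exact hn)
  have hgi : ∀ n < M.H, Integrable (fun ξ => M.gapAt P (σ ξ.1) σ ρ ξ n) M.episodeLaw := by
    intro n hn
    exact Integrable.of_bound (hgm n).aestronglyMeasurable (2 * V)
      (.of_forall fun ξ => abs_gapAt_le hP hm hV hb _ _ _ _ hn)
  have hstep : ∀ n < M.H, ∫ ξ, D ξ.1 (M.stateAt P ρ ξ n) ∂M.episodeLaw =
      ∫ ξ, M.gapAt P (σ ξ.1) σ ρ ξ n ∂M.episodeLaw +
        ∫ ξ, D ξ.1 (M.stateAt P ρ ξ (n + 1)) ∂M.episodeLaw := by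
    intro n hn
    let i : Fin M.H := ⟨n, hn⟩
    have hres := measurePreserving_resample (F := F) M.initLaw (M.trans M.truth) i
    have e1 : ∫ ξ, D ξ.1 (M.stateAt P ρ ξ (n + 1)) ∂M.episodeLaw =
        ∫ ξ, M.expNext M.truth (M.stateAt P ρ ξ n) (M.actionAt P ρ ξ n) (D ξ.1)
          ∂M.episodeLaw := by
      have hDn1 := hDn (n + 1) hn
      calc ∫ ξ, D ξ.1 (M.stateAt P ρ ξ (n + 1)) ∂M.episodeLaw
          = ∫ p : Noise X F M.H × F, D (resample i p.1 p.2).1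
              (M.stateAt P ρ (resample i p.1 p.2) (n + 1))
              ∂(M.episodeLaw.prod (M.trans M.truth)) := by
            have hmap := hres.map_eq
            change Measure.map _ (M.episodeLaw.prod (M.trans M.truth)) = M.episodeLaw at hmap
            conv_lhs => rw [← hmap]
            rw [integral_map hres.measurable.aemeasurable]
            exact (hDm.comp (measurable_fst.prodMk (hst (n + 1)))).aestronglyMeasurable
        _ = ∫ ξ, ∫ y, D (resample i ξ y).1 (M.stateAt P ρ (resample i ξ y) (n + 1))
              ∂(M.trans M.truth) ∂M.episodeLaw :=
            integral_prod _ (hres.integrable_comp_of_integrable hDn1)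
        _ = _ := by
            refine integral_congr_ae (.of_forall fun ξ => ?_)
            refine integral_congr_ae (.of_forall fun y => ?_)
            have := stateAt_succ_resample (P := P) ρ ξ i y
            simp only [i] at this
            simp only [i, this]
            rfl
    have hei : Integrable (fun ξ => M.expNext M.truth (M.stateAt P ρ ξ n) (M.actionAt P ρ ξ n)
        (D ξ.1)) M.episodeLaw := by
      have hme : Measurable fun ξ : Noise X F M.H => M.expNext M.truth (M.stateAt P ρ ξ n)
          (M.actionAt P ρ ξ n) (D ξ.1) :=
        measurable_expNext hm measurable_const (hst n) (hat n) (v := fun ξ => D ξ.1)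
          (hDm.comp ((measurable_fst.comp measurable_fst).prodMk measurable_snd))
      refine Integrable.of_bound hme.aestronglyMeasurable (2 * V) (.of_forall fun ξ => ?_)
      have hbd : M.IsBdd (2 * V) (D ξ.1) := ⟨hDm.comp measurable_prodMk_left, hDb ξ.1⟩
      exact hbd.abs_expNext_le (stateAt_mem hP ρ ξ hn) (actionAt_mem hP ρ ξ hn) _
    rw [e1, ← integral_add (hgi n hn) hei]
    refine integral_congr_ae (.of_forall fun ξ => ?_)
    exact optValue_sub_policyValue hP hm hV hb (hρx ξ.1) (stateAt_mem hP ρ ξ hn)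
      (hgreedy ξ.1 _ (stateAt_mem hP ρ ξ hn))
  have hsum : ∀ n ≤ M.H, ∫ ξ, D ξ.1 (M.stateAt P ρ ξ 0) ∂M.episodeLaw =
      ∑ h ∈ Finset.range n, ∫ ξ, M.gapAt P (σ ξ.1) σ ρ ξ h ∂M.episodeLaw +
        ∫ ξ, D ξ.1 (M.stateAt P ρ ξ n) ∂M.episodeLaw := by
    intro n
    induction n with
    | zero => intro _; simp
    | succ n ih =>
      intro hn
      rw [ih (by omega), hstep n hn, Finset.sum_range_succ]
      ring
  have hfirst : ∫ x, D x (M.initState x) ∂M.initLaw =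
      ∫ ξ, D ξ.1 (M.stateAt P ρ ξ 0) ∂M.episodeLaw :=
    (integral_fun_fst (μ := M.initLaw)
      (ν := Measure.pi fun _ : Fin M.H => M.trans M.truth)
      (fun x => D x (M.initState x))).symm ▸ (by simp)
  have hlast : ∫ ξ, D ξ.1 (M.stateAt P ρ ξ M.H) ∂M.episodeLaw = 0 := by
    refine (integral_congr_ae (.of_forall fun ξ => ?_)).trans (integral_zero _ _)
    have h := (stateAt_reachable hP ρ ξ (le_refl M.H)).2
    simp [hD, optValue_eq_zero _ h, policyValue_eq_zero _ _ h]
  change ∫ x, D x (M.initState x) ∂M.initLaw ≤ _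
  rw [hfirst, hsum M.H le_rfl, hlast, add_zero, ← integral_finsetSum _ fun h hh =>
    hgi h (Finset.mem_range.1 hh)]
  refine integral_mono (integrable_finsetSum _ fun h hh => hgi h (Finset.mem_range.1 hh))
    (integrable_finsetSum _ fun h hh => (hgi h (Finset.mem_range.1 hh)).abs) fun ξ => ?_
  exact Finset.sum_le_sum fun h _ => le_abs_self _

end

end ACMDP

theorem Finset.sum_range_mul_eq (f : ℕ → ℝ) (k H : ℕ) :
    ∑ t ∈ Finset.range (k * H), f t =
      ∑ i ∈ Finset.range k, ∑ h ∈ Finset.range H, f (i * H + h) := by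
  induction k with
  | zero => simp
  | succ k ih => rw [Nat.succ_mul, Finset.sum_range_add, ih, Finset.sum_range_succ]

/-- The past of an infinite sequence at time `k`. -/
def pastOf {E : Type*} (u : ℕ → E) (k : ℕ) : Fin k → E := fun i => u i

theorem partialSum_pastOf {E : Type*} (x : (k : ℕ) → (Fin k → E) → E → ℝ) (u : ℕ → E) (k : ℕ) :
    partialSum x k (pastOf u k) = ∑ i ∈ Finset.range k, x i (pastOf u i) (u i) :=
  (Finset.sum_range fun i => x i (pastOf u i) (u i)).symm

namespace ACMDP

variable {X A F Θ : Type*} [MetricSpace X] [MeasurableSpace X] [MetricSpace A] [MeasurableSpace A]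
  [MeasurableSpace F] [MeasurableSpace Θ] {M : ACMDP X A F Θ} {P : AugState X → A → A}

/-! ### The function class -/

/-- The member of the class `𝒬` that belongs to the model `θ`. -/
def qFun (M : ACMDP X A F Θ) (P : AugState X → A → A) (θ : Θ) : M.Triple P → ℝ :=
  fun z => M.expNext θ z.1.1 z.1.2.1 z.1.2.2

theorem qFun_mem (θ : Θ) : M.qFun P θ ∈ M.qClass P := ⟨θ, fun _ => rfl⟩

theorem qClass_eq_range : M.qClass P = Set.range (M.qFun P) := by
  ext q
  constructor
  · rintro ⟨θ, h⟩
    exact ⟨θ, funext fun z => (h z).symm⟩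
  · rintro ⟨θ, rfl⟩
    exact qFun_mem θ

/-- A finite covering number provides a finite net of models. -/
theorem exists_net {α : ℝ} (hα : 0 ≤ α) {N : ℕ}
    (hN : supCoveringNumber (M.qClass P) α.toNNReal = N) :
    ∃ T : Finset Θ, T.card ≤ N ∧
      ∀ θ, ∃ θ' ∈ T, ∀ z, |M.qFun P θ z - M.qFun P θ' z| ≤ α := by
  classical
  obtain ⟨C, hCsub, hCfin, hCcov, hCcard⟩ := Metric.exists_set_encard_eq_coveringNumber
    (ε := α.toNNReal) (A := UniformFun.ofFun '' M.qClass P) (by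
      change supCoveringNumber _ _ ≠ ⊤
      rw [hN]; exact ENat.natCast_ne_top N)
  have hrep : ∀ c ∈ C, ∃ θ, UniformFun.ofFun (M.qFun P θ) = c := by
    intro c hc
    obtain ⟨q, hq, rfl⟩ := hCsub hc
    rw [qClass_eq_range] at hq
    obtain ⟨θ, rfl⟩ := hq
    exact ⟨θ, rfl⟩
  have : Nonempty Θ := ⟨M.truth⟩
  choose! g hg using hrep
  refine ⟨hCfin.toFinset.image g, ?_, fun θ => ?_⟩
  · refine Finset.card_image_le.trans ?_
    have h2 : C.encard = (N : ℕ∞) := hCcard.trans hN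
    rw [hCfin.encard_eq_coe_toFinset_card] at h2
    exact_mod_cast h2.le
  · obtain ⟨c, hc, hcd⟩ := hCcov (Set.mem_image_of_mem UniformFun.ofFun (qFun_mem (P := P) θ))
    refine ⟨g c, Finset.mem_image_of_mem _ (hCfin.mem_toFinset.2 hc), fun z => ?_⟩
    have h1 : edist (UniformFun.ofFun (M.qFun P θ)) c ≤ α.toNNReal := hcd
    rw [← hg c hc] at h1
    have h2 := UniformFun.edist_le.1 h1 z
    rw [edist_dist, Real.dist_eq] at h2
    have h3 : ENNReal.ofReal |M.qFun P θ z - M.qFun P (g c) z| ≤ ENNReal.ofReal α := h2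
    exact (ENNReal.ofReal_le_ofReal_iff hα).1 h3

theorem one_le_covNum {K : ℕ} {δ : ℝ} {N : ℕ} (h : M.covNum P K δ = N) : 1 ≤ N := by
  have hpos : 0 < M.covNum P K δ := by
    unfold covNum supCoveringNumber
    rw [Metric.coveringNumber_pos_iff]
    exact (Set.Nonempty.image _ ⟨_, qFun_mem M.truth⟩)
  rw [h] at hpos
  exact_mod_cast hpos

/-! ### The learner's data -/

section Data

/-- The model selected for the episode that follows the noise `w`. -/
def selectAt (M : ACMDP X A F Θ) (P : AugState X → A → A) (L : Learner X A Θ M.H) (k : ℕ)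
    (w : Fin k → Noise X F M.H) : X → Θ := L.select k (M.history P L k w)

/-- The ML policy played in the episode that follows the noise `w`. -/
def policyAt (M : ACMDP X A F Θ) (P : AugState X → A → A) (L : Learner X A Θ M.H) (k : ℕ)
    (w : Fin k → Noise X F M.H) : X → AugState X → A := L.policy k (M.history P L k w)

/-- The prediction gap of `θ` at round `h` of the episode with noise `ξ` that follows the noise `w`. -/
def dataGap (M : ACMDP X A F Θ) (P : AugState X → A → A) (L : Learner X A Θ M.H) (θ : Θ) (k : ℕ)
    (w : Fin k → Noise X F M.H) (ξ : Noise X F M.H) (h : ℕ) : ℝ :=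
  M.gapAt P θ (M.selectAt P L k w) (M.policyAt P L k w) ξ h

/-- The prediction noise at round `h` of the episode with noise `ξ` that follows the noise `w`. -/
def dataNoise (M : ACMDP X A F Θ) (P : AugState X → A → A) (L : Learner X A Θ M.H) (k : ℕ)
    (w : Fin k → Noise X F M.H) (ξ : Noise X F M.H) (h : ℕ) : ℝ :=
  M.noiseAt P (M.selectAt P L k w) (M.policyAt P L k w) ξ h

/-- The triple `(s, a, v)` visited at round `h` of the episode with noise `ξ` that follows the noise `w`. -/
def dataTriple (hP : M.IsProjection P) (L : Learner X A Θ M.H) (k : ℕ)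
    (w : Fin k → Noise X F M.H) (ξ : Noise X F M.H) (h : Fin M.H) : M.Triple P :=
  ⟨(M.stateAt P (M.policyAt P L k w) ξ h, M.actionAt P (M.policyAt P L k w) ξ h,
    M.optValue P (M.selectAt P L k w ξ.1)), stateAt_mem hP _ ξ h.isLt, actionAt_mem hP _ ξ h.isLt,
    ⟨_, rfl⟩⟩

theorem dataGap_eq (hP : M.IsProjection P) (L : Learner X A Θ M.H) (θ : Θ) (k : ℕ)
    (w : Fin k → Noise X F M.H) (ξ : Noise X F M.H) (h : Fin M.H) :
    M.dataGap P L θ k w ξ h = M.qFun P θ (dataTriple hP L k w ξ h) -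
      M.qFun P M.truth (dataTriple hP L k w ξ h) := rfl

variable {L : Learner X A Θ M.H} {u : ℕ → Noise X F M.H}

theorem fitLoss_sub (k : ℕ) (θ : Θ) :
    M.fitLoss P (M.history P L k (pastOf u k)) θ -
      M.fitLoss P (M.history P L k (pastOf u k)) M.truth =
    ∑ i ∈ Finset.range k, ∑ h ∈ Finset.range M.H,
      (M.dataGap P L θ i (pastOf u i) (u i) h ^ 2 -
        2 * (M.dataGap P L θ i (pastOf u i) (u i) h * M.dataNoise P L i (pastOf u i) (u i) h)) := by
  unfold fitLoss
  rw [← Finset.sum_sub_distrib, Finset.sum_range]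
  refine Finset.sum_congr rfl fun i _ => ?_
  rw [← Finset.sum_sub_distrib, Finset.sum_range]
  refine Finset.sum_congr rfl fun h _ => ?_
  rw [history_apply]
  change (M.expNext θ (M.stateAt P (M.policyAt P L i (pastOf u i)) (u i) h)
      (M.actionAt P (M.policyAt P L i (pastOf u i)) (u i) h)
      (M.optValue P (M.selectAt P L i (pastOf u i) (u i).1)) -
    M.optValue P (M.selectAt P L i (pastOf u i) (u i).1)
      (M.stateAt P (M.policyAt P L i (pastOf u i)) (u i) (h + 1))) ^ 2 -
    (M.expNext M.truth (M.stateAt P (M.policyAt P L i (pastOf u i)) (u i) h)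
      (M.actionAt P (M.policyAt P L i (pastOf u i)) (u i) h)
      (M.optValue P (M.selectAt P L i (pastOf u i) (u i).1)) -
    M.optValue P (M.selectAt P L i (pastOf u i) (u i).1)
      (M.stateAt P (M.policyAt P L i (pastOf u i)) (u i) (h + 1))) ^ 2 = _
  unfold dataGap dataNoise gapAt noiseAt gap
  ring

theorem mem_confSet_iff (k : ℕ) (θ θhat : Θ) (β : ℝ) :
    θ ∈ M.confSet P (M.history P L k (pastOf u k)) θhat β ↔
    ∑ i ∈ Finset.range k, ∑ h ∈ Finset.range M.H,
      (M.dataGap P L θ i (pastOf u i) (u i) h - M.dataGap P L θhat i (pastOf u i) (u i) h) ^ 2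
        ≤ β := by
  unfold confSet
  rw [Set.mem_ofPred_eq]
  refine iff_of_eq ?_
  congr 1
  rw [Finset.sum_range]
  refine Finset.sum_congr rfl fun i _ => ?_
  rw [Finset.sum_range]
  refine Finset.sum_congr rfl fun h _ => ?_
  rw [history_apply]
  change (M.expNext θ (M.stateAt P (M.policyAt P L i (pastOf u i)) (u i) h)
      (M.actionAt P (M.policyAt P L i (pastOf u i)) (u i) h)
      (M.optValue P (M.selectAt P L i (pastOf u i) (u i).1)) -
    M.expNext θhat (M.stateAt P (M.policyAt P L i (pastOf u i)) (u i) h)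
      (M.actionAt P (M.policyAt P L i (pastOf u i)) (u i) h)
      (M.optValue P (M.selectAt P L i (pastOf u i) (u i).1))) ^ 2 = _
  unfold dataGap gapAt gap
  ring

theorem dataGap_truth (k : ℕ) (w : Fin k → Noise X F M.H) (ξ : Noise X F M.H) (h : ℕ) :
    M.dataGap P L M.truth k w ξ h = 0 := by
  simp [dataGap, gapAt, gap]

end Data

variable [SecondCountableTopology A] [BorelSpace A] [IsMarkovKernel M.trans] [Nonempty A]
  {L : Learner X A Θ M.H} {V : ℝ}

theorem dataGap_last (hP : M.IsProjection P) (θ : Θ) (k : ℕ) (w : Fin k → Noise X F M.H)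
    (ξ : Noise X F M.H) {h : ℕ} (hh : h + 1 = M.H) : M.dataGap P L θ k w ξ h = 0 := by
  refine gap_last _ _ ?_ _ _
  rw [(stateAt_reachable hP _ ξ (by omega : h ≤ M.H)).2, hh]

theorem measurable_selectAt (hm : M.IsMeasurable P L) (k : ℕ) :
    Measurable fun p : (Fin k → Noise X F M.H) × X => M.selectAt P L k p.1 p.2 :=
  (hm.select k).comp (((measurable_history hm k).comp measurable_fst).prodMk measurable_snd)

theorem measurable_policyAt (hm : M.IsMeasurable P L) (k : ℕ) :
    Measurable fun p : (Fin k → Noise X F M.H) × X × AugState X =>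
      M.policyAt P L k p.1 p.2.1 p.2.2 :=
  (hm.policy k).comp (((measurable_history hm k).comp measurable_fst).prodMk measurable_snd)

/-! ### The confidence sets -/

/-- The logarithm of the exponential supermartingale of the model `θ`, for one episode. The factor
`1 / (2 V²)` is the one that leaves half of the squared gaps in the least-squares comparison. -/
def logIncrement (M : ACMDP X A F Θ) (P : AugState X → A → A) (L : Learner X A Θ M.H) (V : ℝ) (θ : Θ)
    (k : ℕ) (w : Fin k → Noise X F M.H) (ξ : Noise X F M.H) : ℝ :=
  ∑ h ∈ Finset.range M.H, (1 / (2 * V ^ 2) * (M.dataGap P L θ k w ξ h * M.dataNoise P L k w ξ h) -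
    (1 / (2 * V ^ 2)) ^ 2 * V ^ 2 * M.dataGap P L θ k w ξ h ^ 2 / 2)

theorem measure_exists_le_logIncrement_le [IsProbabilityMeasure M.initLaw] (hP : M.IsProjection P)
    (hm : M.IsMeasurable P L) (hV : 0 ≤ V) (hb : M.ValueBounded P V) (θ : Θ) (ℓ : ℝ) (K : ℕ) :
    (M.noiseLaw K).real {ω | ∃ k, ∃ hk : k ≤ K,
      ℓ ≤ partialSum (M.logIncrement P L V θ) k (prefixOf ω k hk)} ≤ Real.exp (-ℓ) := by
  refine measure_exists_le_partialSum_le M.episodeLaw (fun k => ?_) (fun k w => ?_) ℓ K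
  · have hg : ∀ h, Measurable fun p : (Fin k → Noise X F M.H) × Noise X F M.H =>
        M.dataGap P L θ k p.1 p.2 h := fun h =>
      measurable_gapAt hm (measurable_policyAt hm k) (measurable_selectAt hm k)
        (measurable_const (a := θ)) h
    have hz : ∀ h, Measurable fun p : (Fin k → Noise X F M.H) × Noise X F M.H =>
        M.dataNoise P L k p.1 p.2 h := fun h =>
      measurable_noiseAt hm (measurable_policyAt hm k) (measurable_selectAt hm k) h
    exact Finset.measurable_sum _ fun h _ => (((hg h).mul (hz h)).const_mul _).sub
      ((((hg h).pow_const 2).const_mul _).div_const _)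
  · exact lintegral_exp_gap_noise_le_one hP hm hV hb θ
      ((measurable_selectAt hm k).comp measurable_prodMk_left)
      ((measurable_policyAt hm k).comp measurable_prodMk_left) _ M.H le_rfl

/-- If none of the exponential supermartingales of a net of models is large, the truth is close to the
fitted model on the data. -/
theorem sum_sq_dataGap_fit_le (hP : M.IsProjection P)
    (hm : M.IsMeasurable P L) (hV : 0 < V) (hb : M.ValueBounded P V) {T : Finset Θ} {α ℓ : ℝ}
    (hT : ∀ θ, ∃ θ' ∈ T, ∀ z, |M.qFun P θ z - M.qFun P θ' z| ≤ α) (u : ℕ → Noise X F M.H) (k : ℕ)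
    (hgood : ∀ θ ∈ T, partialSum (M.logIncrement P L V θ) k (pastOf u k) ≤ ℓ) {θ : Θ}
    (hfit : M.fitLoss P (M.history P L k (pastOf u k)) θ ≤
      M.fitLoss P (M.history P L k (pastOf u k)) M.truth) :
    ∑ i ∈ Finset.range k, ∑ h ∈ Finset.range M.H,
      M.dataGap P L θ i (pastOf u i) (u i) h ^ 2 ≤ 8 * V ^ 2 * ℓ + 12 * V * α * (k * M.H) := by
  obtain ⟨θ', hθ', hclose⟩ := hT θ
  have h1 := hgood θ' hθ'
  rw [partialSum_pastOf] at h1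
  have h2 : ∑ i ∈ Finset.range k, ∑ h ∈ Finset.range M.H,
      (M.dataGap P L θ i (pastOf u i) (u i) h ^ 2 -
        2 * (M.dataGap P L θ i (pastOf u i) (u i) h * M.dataNoise P L i (pastOf u i) (u i) h)) ≤ 0 := by
    rw [← fitLoss_sub]; linarith
  have h3 : ∑ i ∈ Finset.range k, ∑ h ∈ Finset.range M.H,
      M.dataGap P L θ i (pastOf u i) (u i) h ^ 2 ≤
      ∑ i ∈ Finset.range k, ∑ h ∈ Finset.range M.H,
        (2 * (M.dataGap P L θ i (pastOf u i) (u i) h ^ 2 -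
          2 * (M.dataGap P L θ i (pastOf u i) (u i) h *
            M.dataNoise P L i (pastOf u i) (u i) h)) +
        8 * V ^ 2 * (1 / (2 * V ^ 2) * (M.dataGap P L θ' i (pastOf u i) (u i) h *
            M.dataNoise P L i (pastOf u i) (u i) h) -
          (1 / (2 * V ^ 2)) ^ 2 * V ^ 2 * M.dataGap P L θ' i (pastOf u i) (u i) h ^ 2 / 2) +
        12 * V * α) := by
    refine Finset.sum_le_sum fun i _ => Finset.sum_le_sum fun h hh => ?_
    have hh := Finset.mem_range.1 hh
    have b1 : |M.dataGap P L θ i (pastOf u i) (u i) h| ≤ 2 * V :=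
      abs_gapAt_le hP hm hV.le hb _ _ _ _ hh
    have b2 : |M.dataGap P L θ' i (pastOf u i) (u i) h| ≤ 2 * V :=
      abs_gapAt_le hP hm hV.le hb _ _ _ _ hh
    have b3 : |M.dataNoise P L i (pastOf u i) (u i) h| ≤ 2 * V :=
      abs_noiseAt_le hP hm hV.le hb _ _ _ hh
    have b4 : |M.dataGap P L θ i (pastOf u i) (u i) h - M.dataGap P L θ' i (pastOf u i) (u i) h| ≤
        α := by
      have e1 := dataGap_eq hP L θ i (pastOf u i) (u i) ⟨h, hh⟩
      have e2 := dataGap_eq hP L θ' i (pastOf u i) (u i) ⟨h, hh⟩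
      simp only at e1 e2
      rw [e1, e2, sub_sub_sub_cancel_right]
      exact hclose _
    generalize M.dataGap P L θ i (pastOf u i) (u i) h = g at *
    generalize M.dataGap P L θ' i (pastOf u i) (u i) h = g' at *
    generalize M.dataNoise P L i (pastOf u i) (u i) h = z at *
    have e : 8 * V ^ 2 * (1 / (2 * V ^ 2) * (g' * z) - (1 / (2 * V ^ 2)) ^ 2 * V ^ 2 * g' ^ 2 / 2) =
        4 * (g' * z) - g' ^ 2 := by
      field_simp
      ring
    rw [e]
    have c1 : |g - g'| * |g + g' - 4 * z| ≤ α * (12 * V) := by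
      refine mul_le_mul b4 ?_ (abs_nonneg _) ((abs_nonneg _).trans b4)
      rw [abs_le] at b1 b2 b3 ⊢
      constructor <;> linarith
    rw [← abs_mul, abs_le] at c1
    nlinarith [c1.1]
  have h4 : ∑ i ∈ Finset.range k, ∑ h ∈ Finset.range M.H,
        (2 * (M.dataGap P L θ i (pastOf u i) (u i) h ^ 2 -
          2 * (M.dataGap P L θ i (pastOf u i) (u i) h *
            M.dataNoise P L i (pastOf u i) (u i) h)) +
        8 * V ^ 2 * (1 / (2 * V ^ 2) * (M.dataGap P L θ' i (pastOf u i) (u i) h *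
            M.dataNoise P L i (pastOf u i) (u i) h) -
          (1 / (2 * V ^ 2)) ^ 2 * V ^ 2 * M.dataGap P L θ' i (pastOf u i) (u i) h ^ 2 / 2) +
        12 * V * α) = 2 * (∑ i ∈ Finset.range k, ∑ h ∈ Finset.range M.H,
      (M.dataGap P L θ i (pastOf u i) (u i) h ^ 2 -
        2 * (M.dataGap P L θ i (pastOf u i) (u i) h * M.dataNoise P L i (pastOf u i) (u i) h))) +
      8 * V ^ 2 * (∑ i ∈ Finset.range k, M.logIncrement P L V θ' i (pastOf u i) (u i)) +
      12 * V * α * (k * M.H) := by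
    simp only [logIncrement, Finset.sum_add_distrib, Finset.mul_sum, Finset.sum_const,
      Finset.card_range, nsmul_eq_mul]
    ring
  rw [h4] at h3
  have h5 : 8 * V ^ 2 * (∑ i ∈ Finset.range k, M.logIncrement P L V θ' i (pastOf u i) (u i)) ≤
      8 * V ^ 2 * ℓ := by gcongr
  linarith

/-! ### Optimism -/

/-- The sum of the prediction gaps of the selected model along an episode. -/
def gapSum (M : ACMDP X A F Θ) (P : AugState X → A → A) (L : Learner X A Θ M.H) (k : ℕ)
    (w : Fin k → Noise X F M.H) (ξ : Noise X F M.H) : ℝ :=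
  ∑ h ∈ Finset.range M.H, |M.dataGap P L (M.selectAt P L k w ξ.1) k w ξ h|

theorem measurable_gapSum (hm : M.IsMeasurable P L) (k : ℕ) :
    Measurable fun p : (Fin k → Noise X F M.H) × Noise X F M.H => M.gapSum P L k p.1 p.2 :=
  Finset.measurable_sum _ fun h _ =>
    (measurable_gapAt hm (measurable_policyAt hm k) (measurable_selectAt hm k)
      (θ := fun p => M.selectAt P L k p.1 p.2.1)
      ((measurable_selectAt hm k).comp (by fun_prop : Measurable
        fun p : (Fin k → Noise X F M.H) × Noise X F M.H => (p.1, p.2.1))) h).abs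

theorem gapSum_mem_Icc (hP : M.IsProjection P) (hm : M.IsMeasurable P L) (hV : 0 ≤ V)
    (hb : M.ValueBounded P V) (k : ℕ) (w : Fin k → Noise X F M.H) (ξ : Noise X F M.H) :
    M.gapSum P L k w ξ ∈ Set.Icc 0 (2 * (V * M.H)) := by
  refine ⟨Finset.sum_nonneg fun _ _ => abs_nonneg _, ?_⟩
  have := Finset.sum_le_card_nsmul (Finset.range M.H)
    (fun h => |M.dataGap P L (M.selectAt P L k w ξ.1) k w ξ h|) (2 * V)
    fun h hh => abs_gapAt_le hP hm hV hb _ _ _ _ (Finset.mem_range.1 hh)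
  rw [Finset.card_range, nsmul_eq_mul] at this
  calc M.gapSum P L k w ξ ≤ M.H * (2 * V) := this
    _ = _ := by ring

/-- If the confidence set contains the truth, the selected model is optimistic and the regret of the
episode is at most the expected sum of its prediction gaps. -/
theorem regret_le_integral_gapSum [IsProbabilityMeasure M.initLaw] (hP : M.IsProjection P)
    (hm : M.IsMeasurable P L) (hV : 0 ≤ V) (hb : M.ValueBounded P V)
    {πopt : AugState X → A} (hopt : Measurable πopt) {K : ℕ} {β : ℕ → ℝ} (hL : M.IsACRL P L K β)
    {k : ℕ} (hk : k < K) (w : Fin k → Noise X F M.H)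
    (hmem : M.truth ∈ M.confSet P (M.history P L k w) (L.fit k (M.history P L k w)) (β k)) :
    ∫ x, (M.policyValue P M.truth πopt (M.initState x) -
      M.policyValue P M.truth (L.policy k (M.history P L k w) x) (M.initState x)) ∂M.initLaw ≤
    ∫ ξ, M.gapSum P L k w ξ ∂M.episodeLaw := by
  have hσ : Measurable (M.selectAt P L k w) :=
    (measurable_selectAt hm k).comp measurable_prodMk_left
  have hρ : Measurable fun p : X × AugState X => M.policyAt P L k w p.1 p.2 :=
    (measurable_policyAt hm k).comp measurable_prodMk_left
  have hρx : ∀ x, Measurable (M.policyAt P L k w x) := fun x => hρ.comp measurable_prodMk_left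
  have hinit : ∀ x, M.Reachable (M.initState x) ∧ (M.initState x).rd ≤ M.H := fun x =>
    ⟨.start x, Nat.zero_le _⟩
  have hρi : Integrable (fun x => M.policyValue P M.truth (M.policyAt P L k w x) (M.initState x))
      M.initLaw :=
    Integrable.of_bound ((measurable_policyValue hm hρ).comp
      (measurable_id.prodMk measurable_initState)).aestronglyMeasurable V
      (.of_forall fun x => (isBdd_policyValue hm hV hb (hρx x)).abs_le _ (hinit x).1 (hinit x).2)
  have hoi : Integrable (fun x => M.policyValue P M.truth πopt (M.initState x)) M.initLaw :=
    Integrable.of_bound (((isBdd_policyValue hm hV hb hopt).measurable).comp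
      measurable_initState).aestronglyMeasurable V
      (.of_forall fun x => (isBdd_policyValue hm hV hb hopt).abs_le _ (hinit x).1 (hinit x).2)
  have hvi : Integrable (fun x => M.optValue P (M.selectAt P L k w x) (M.initState x))
      M.initLaw :=
    Integrable.of_bound (hm.value.comp (hσ.prodMk measurable_initState)).aestronglyMeasurable V
      (.of_forall fun x => (isBdd_optValue hm hV hb _).abs_le _ (hinit x).1 (hinit x).2)
  refine le_trans (integral_mono (hoi.sub hρi) (hvi.sub hρi) fun x => ?_)
    (integral_optValue_sub_policyValue_le hP hm hV hb hσ hρ fun x s hs a =>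
      hL.greedy k hk w x s hs a)
  refine sub_le_sub_right ?_ _
  exact (policyValue_le_optValue hP hm hV hb hopt M.H _ (hinit x).1 (Nat.zero_add _)).trans
    (hL.select_max k hk w x _ hmem)

end ACMDP

/-! ### Numerical estimates -/

/-- The squared distance `(x + y)²` of a selected model from the truth, with `x` the distance to the fitted
model and `y` the distance of the fitted model from the truth, is split with a weight `η`. The truth is
much closer to the fitted model than the confidence radius when `H ≥ 3`, which leaves room for the
gaps `4 V²` of the rounds of the running episode. -/
theorem exists_budget {V ℓ C : ℝ} {H : ℕ} (hV : 0 < V) (hH : 2 ≤ H) (hℓ : Real.log 2 ≤ ℓ)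
    (hC : 18 ≤ C) :
    ∃ κ η : ℝ, 0 < κ ∧ 0 < η ∧
      (1 + η) * (2 * (V * H) ^ 2 * ℓ + C * V * H) + (1 + 1 / η) * (8 * V ^ 2 * ℓ + 18 * V) +
        4 * V ^ 2 * (H - 2) ≤ κ * (2 * (V * H) ^ 2 * ℓ + C * V * H) ∧
      2 * √(κ * (H - 1)) + 1 ≤ 4 * √H := by
  have hl2 := Real.log_two_gt_d9
  have hℓ' : (0.69 : ℝ) ≤ ℓ := by linarith
  rcases hH.eq_or_lt with h | h
  · subst h
    refine ⟨4, 1, by norm_num, by norm_num, ?_, ?_⟩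
    · push_cast
      nlinarith
    · have h4 : √((4 : ℝ) * ((2 : ℕ) - 1)) = 2 := by
        rw [show (4 : ℝ) * ((2 : ℕ) - 1) = 2 ^ 2 by norm_num]
        exact Real.sqrt_sq (by norm_num)
      have h2 : (1.4 : ℝ) ≤ √2 := Real.le_sqrt_of_sq_le (by norm_num)
      rw [h4, Nat.cast_ofNat]
      linarith
  · have hH3 : (3 : ℝ) ≤ H := by exact_mod_cast h
    refine ⟨3.7, 0.8, by norm_num, by norm_num, ?_, ?_⟩
    · have h1 : 18 * V * 3 ≤ C * V * H := by
        have := mul_le_mul hC hH3 (by norm_num) (by linarith)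
        nlinarith
      have h2 : 11.4 * (H : ℝ) - 18 ≤ 3.8 * (H : ℝ) ^ 2 - 18 := by nlinarith
      have h3 : 4 * ((H : ℝ) - 2) ≤ (3.8 * (H : ℝ) ^ 2 - 18) * ℓ := by nlinarith
      have h4 := mul_le_mul_of_nonneg_left h3 (sq_nonneg V)
      nlinarith
    · set s := √(H : ℝ) with hs
      have hs2 : s ^ 2 = H := Real.sq_sqrt (by linarith)
      have hs1 : (1 : ℝ) ≤ s := Real.one_le_sqrt.2 (by linarith)
      have hq : √((3.7 : ℝ) * (H - 1)) ≤ (4 * s - 1) / 2 := by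
        refine Real.sqrt_le_iff.2 ⟨by linarith, ?_⟩
        rw [← hs2]
        nlinarith [sq_nonneg (1.2 * s - 4)]
      linarith

/-- The sum of the resolution, Eluder and Azuma terms. The last of these is at most `√(d β K)`, which the
slack between `2 √(κ (H - 1))` and `4 √H` absorbs. -/
theorem regret_arith {V β κ ℓ' : ℝ} {H K d : ℕ} (hV : 0 ≤ V) (hH : 2 ≤ H) (hK : 1 ≤ K) (hd : 1 ≤ d)
    (hβ : 0 ≤ β) (hκ : 0 < κ) (hℓ' : 0 ≤ ℓ') (hβℓ : 2 * (V * H) ^ 2 * ℓ' ≤ β)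
    (hκH : 2 * √(κ * (H - 1)) + 1 ≤ 4 * √H) :
    (K * (H - 1 : ℕ) : ℕ) * (1 / (K * H : ℝ)) + d * (2 * V) +
        2 * √(κ * β) * √d * √(K * (H - 1 : ℕ) : ℕ) + V * H * √(2 * K * ℓ') ≤
      1 + d * H * V + 4 * √(d * β * K * H) := by
  have hK0 : (0 : ℝ) < K := by exact_mod_cast hK
  have hH2 : (2 : ℝ) ≤ H := by exact_mod_cast hH
  have hd1 : (1 : ℝ) ≤ d := by exact_mod_cast hd
  have hH1 : ((H - 1 : ℕ) : ℝ) = H - 1 := by rw [Nat.cast_sub (by omega)]; simp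
  have hfirst : (K * (H - 1 : ℕ) : ℕ) * (1 / (K * H : ℝ)) ≤ 1 := by
    push_cast
    rw [hH1, mul_one_div, div_le_one (by positivity)]
    nlinarith
  have hsecond : d * (2 * V) ≤ d * H * V := by
    have : (d : ℝ) * V * 2 ≤ d * V * H := mul_le_mul_of_nonneg_left hH2 (by positivity)
    linarith
  have hthird : 2 * √(κ * β) * √d * √(K * (H - 1 : ℕ) : ℕ) =
      √(d * β * K) * (2 * √(κ * (H - 1))) := by
    push_cast
    have e : √(κ * β) * √d * √(K * (H - 1)) = √(d * β * K) * √(κ * (H - 1)) := by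
      rw [← Real.sqrt_mul (by positivity), ← Real.sqrt_mul (by positivity),
        ← Real.sqrt_mul (by positivity)]
      congr 1
      ring
    rw [hH1]
    linarith
  have hfourth : V * H * √(2 * K * ℓ') ≤ √(d * β * K) := by
    apply Real.le_sqrt_of_sq_le
    rw [mul_pow, Real.sq_sqrt (by positivity)]
    have h1 := mul_le_mul_of_nonneg_right hβℓ hK0.le
    have h2 : β * K ≤ d * (β * K) := le_mul_of_one_le_left (by positivity) hd1
    nlinarith
  have hfifth : √(d * β * K * H) = √(d * β * K) * √H := Real.sqrt_mul (by positivity) _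
  have := mul_le_mul_of_nonneg_left hκH (Real.sqrt_nonneg (d * β * K))
  rw [hthird, hfifth]
  nlinarith

namespace ACMDP

variable {X A F Θ : Type*} [MetricSpace X] [MeasurableSpace X] [MetricSpace A] [MeasurableSpace A]
  [MeasurableSpace F] [MeasurableSpace Θ] {M : ACMDP X A F Θ} {P : AugState X → A → A}
  [SecondCountableTopology A] [BorelSpace A] [IsMarkovKernel M.trans]
  {L : Learner X A Θ M.H} {V : ℝ}

/-! ### The sum of the prediction gaps -/

section

variable [Nonempty A]

theorem abs_qFun_sub_le (hm : M.IsMeasurable P L) (hV : 0 ≤ V)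
    (hb : M.ValueBounded P V) (θ θ' : Θ) (z : M.Triple P) :
    |M.qFun P θ z - M.qFun P θ' z| ≤ 2 * V := by
  obtain ⟨⟨s, a, v⟩, hs, ha, hv⟩ := z
  obtain ⟨η, rfl⟩ : ∃ η, M.optValue P η = v := hv
  have h1 := abs_le.1 ((isBdd_optValue hm hV hb η).abs_expNext_le hs ha θ)
  have h2 := abs_le.1 ((isBdd_optValue hm hV hb η).abs_expNext_le hs ha θ')
  rw [abs_le]
  simp only [qFun]
  constructor <;> linarith

theorem qFun_eq_of_H_eq_one (hH : M.H = 1) (θ θ' : Θ) (z : M.Triple P) :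
    M.qFun P θ z = M.qFun P θ' z := by
  obtain ⟨⟨s, a, v⟩, hs, ha, hv⟩ := z
  obtain ⟨η, rfl⟩ : ∃ η, M.optValue P η = v := hv
  have h : s.rd < M.H := hs.2
  exact sub_eq_zero.1 (gap_last (M := M) (P := P) θ θ' (s := s) (by omega) a η)

/-- The eluder argument for the flattened sequence of all rounds of all episodes. The confidence sets
control the gaps of the selected model on the earlier episodes; the earlier rounds of the running
episode contribute at most `4 V²` each, and the last round has no gap. -/
theorem sum_gapSum_le (hP : M.IsProjection P) (hm : M.IsMeasurable P L) (hV : 0 ≤ V)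
    (hb : M.ValueBounded P V) (hH : 2 ≤ M.H) {d : ℕ} {ε : ℝ} (hε : 0 < ε)
    (hd : eluderDim (M.qClass P) ε ≤ d) (u : ℕ → Noise X F M.H) (K : ℕ) {b B : ℝ} (hB : 0 ≤ B)
    (hbudget : b + 4 * V ^ 2 * (M.H - 2) ≤ B ^ 2)
    (hpast : ∀ k < K, ∑ i ∈ Finset.range k, ∑ h ∈ Finset.range M.H,
      M.dataGap P L (M.selectAt P L k (pastOf u k) (u k).1) i (pastOf u i) (u i) h ^ 2 ≤ b) :
    ∑ k ∈ Finset.range K, M.gapSum P L k (pastOf u k) (u k) ≤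
      (K * (M.H - 1) : ℕ) * ε + d * (2 * V) + 2 * B * √d * √(K * (M.H - 1) : ℕ) := by
  have hH0 : 0 < M.H := by omega
  let rnd : ℕ → Fin M.H := fun t => ⟨t % M.H, Nat.mod_lt _ hH0⟩
  let z : ℕ → M.Triple P := fun t => dataTriple hP L (t / M.H) (pastOf u (t / M.H)) (u (t / M.H)) (rnd t)
  let q : ℕ → M.Triple P → ℝ := fun t =>
    M.qFun P (M.selectAt P L (t / M.H) (pastOf u (t / M.H)) (u (t / M.H)).1)
  have hdiv : ∀ i h, h < M.H → (i * M.H + h) / M.H = i := fun i h hh => by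
    rw [mul_comm, Nat.mul_add_div hH0, Nat.div_eq_of_lt hh, add_zero]
  have hmod : ∀ i h, h < M.H → (i * M.H + h) % M.H = h := fun i h hh => by
    rw [mul_comm, Nat.mul_add_mod, Nat.mod_eq_of_lt hh]
  have hz : ∀ θ i h, h < M.H → M.qFun P θ (z (i * M.H + h)) - M.qFun P M.truth (z (i * M.H + h)) =
      M.dataGap P L θ i (pastOf u i) (u i) h := by
    intro θ i h hh
    have e := (dataGap_eq hP L θ ((i * M.H + h) / M.H) (pastOf u ((i * M.H + h) / M.H))
      (u ((i * M.H + h) / M.H)) (rnd (i * M.H + h))).symm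
    refine e.trans ?_
    simp only [rnd]
    rw [hdiv i h hh, hmod i h hh]
  have hq : ∀ i h, h < M.H → q (i * M.H + h) =
      M.qFun P (M.selectAt P L i (pastOf u i) (u i).1) := by
    intro i h hh
    simp only [q]
    rw [hdiv i h hh]
  set S : Finset ℕ := (Finset.range (K * M.H)).filter fun t => t % M.H + 1 < M.H with hS
  have hsumS : ∀ f : ℕ → ℝ, ∑ t ∈ S, f t = ∑ k ∈ Finset.range K, ∑ h ∈ Finset.range M.H,
      if h + 1 < M.H then f (k * M.H + h) else 0 := by
    intro f
    rw [hS, Finset.sum_filter, Finset.sum_range_mul_eq]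
    refine Finset.sum_congr rfl fun k _ => Finset.sum_congr rfl fun h hh => ?_
    rw [hmod k h (Finset.mem_range.1 hh)]
  have hcard : S.card = K * (M.H - 1) := by
    have h1 := hsumS fun _ => 1
    have h2 : ∑ h ∈ Finset.range M.H, (if h + 1 < M.H then (1 : ℝ) else 0) = (M.H - 1 : ℕ) := by
      rw [← Finset.sum_filter]
      have : (Finset.range M.H).filter (fun h => h + 1 < M.H) = Finset.range (M.H - 1) := by
        ext h; simp; omega
      simp [this]
    simp only [Finset.sum_const, nsmul_eq_mul, mul_one, h2, Finset.card_range] at h1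
    exact_mod_cast h1
  have key := sum_gap_le_of_eluderDim hd hε hB (by positivity : 0 ≤ 2 * V) z q
    (fun _ => M.qFun P M.truth) (fun t => qFun_mem _) (fun t => qFun_mem _)
    (fun t => abs_qFun_sub_le hm hV hb _ _ _) S ?_
  · rw [hcard] at key
    refine le_trans (le_of_eq ?_) key
    rw [hsumS]
    refine Finset.sum_congr rfl fun k _ => Finset.sum_congr rfl fun h hh => ?_
    have hh := Finset.mem_range.1 hh
    split_ifs with hlt
    · rw [hq k h hh, hz _ k h hh]
    · rw [dataGap_last hP _ _ _ _ (by omega : h + 1 = M.H), abs_zero]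
  · intro t ht
    obtain ⟨ht1, ht2⟩ := Finset.mem_filter.1 ht
    have htK := Finset.mem_range.1 ht1
    obtain ⟨k, h, hh, hkK, rfl⟩ : ∃ k h, h < M.H ∧ k < K ∧ t = k * M.H + h :=
      ⟨t / M.H, t % M.H, Nat.mod_lt _ hH0, Nat.div_lt_of_lt_mul (by rwa [mul_comm]),
        (Nat.div_add_mod' t M.H).symm⟩
    rw [hmod k h hh] at ht2
    rw [hq k h hh]
    set θ := M.selectAt P L k (pastOf u k) (u k).1
    calc ∑ s ∈ S.filter (· < k * M.H + h), (M.qFun P θ (z s) - M.qFun P M.truth (z s)) ^ 2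
        ≤ ∑ s ∈ Finset.range (k * M.H + h), (M.qFun P θ (z s) - M.qFun P M.truth (z s)) ^ 2 :=
          Finset.sum_le_sum_of_subset_of_nonneg
            (fun s hs => Finset.mem_range.2 (Finset.mem_filter.1 hs).2) fun _ _ _ => sq_nonneg _
      _ = ∑ i ∈ Finset.range k, ∑ j ∈ Finset.range M.H,
            M.dataGap P L θ i (pastOf u i) (u i) j ^ 2 +
          ∑ j ∈ Finset.range h, (M.qFun P θ (z (k * M.H + j)) -
            M.qFun P M.truth (z (k * M.H + j))) ^ 2 := by
          rw [Finset.sum_range_add, Finset.sum_range_mul_eq]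
          congr 1
          refine Finset.sum_congr rfl fun i _ => Finset.sum_congr rfl fun j hj => ?_
          rw [hz θ i j (Finset.mem_range.1 hj)]
      _ ≤ b + h * (4 * V ^ 2) := by
          refine add_le_add (hpast k hkK) ?_
          refine (Finset.sum_le_card_nsmul _ _ (4 * V ^ 2) fun j _ => ?_).trans
            (le_of_eq (by rw [Finset.card_range, nsmul_eq_mul]))
          have := abs_qFun_sub_le hm hV hb θ M.truth (z (k * M.H + j))
          rw [← sq_abs]
          nlinarith [abs_nonneg (M.qFun P θ (z (k * M.H + j)) - M.qFun P M.truth (z (k * M.H + j)))]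
      _ ≤ b + 4 * V ^ 2 * (M.H - 2) := by
          have : (h : ℝ) ≤ M.H - 2 := by
            have : h + 2 ≤ M.H := by omega
            have : ((h + 2 : ℕ) : ℝ) ≤ M.H := by exact_mod_cast this
            push_cast at this; linarith
          nlinarith [sq_nonneg V]
      _ ≤ B ^ 2 := hbudget

end

/-! ### The regret bound -/

theorem Setting.nonempty_action {πopt : AugState X → A} {K : ℕ} {Vbar δ C : ℝ}
    [IsProbabilityMeasure M.initLaw] (_hS : M.Setting P πopt L K Vbar δ C) : Nonempty A :=
  have : Nonempty X := nonempty_of_isProbabilityMeasure M.initLaw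
  ⟨πopt (M.initState this.some)⟩

theorem Setting.Vbar_nonneg {πopt : AugState X → A} {K : ℕ} {Vbar δ C : ℝ}
    [IsProbabilityMeasure M.initLaw] (hS : M.Setting P πopt L K Vbar δ C) : 0 ≤ Vbar := by
  have : Nonempty X := nonempty_of_isProbabilityMeasure M.initLaw
  have : Nonempty A := hS.nonempty_action
  obtain ⟨x⟩ := ‹Nonempty X›
  obtain ⟨a⟩ := ‹Nonempty A›
  exact (abs_nonneg _).trans
    (hS.bounded.2 M.truth _ (initState_mem_stateSpace hS.H_pos x) a)

/-- The confidence radius dominates its linear term. -/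
theorem le_conf {K : ℕ} {Vbar δ C : ℝ} {N : ℕ} (hN : M.covNum P K δ = N) (hδ : 0 < δ)
    (hδ1 : δ < 1) : C * Vbar * M.H ≤ M.conf P K Vbar δ C := by
  have h1 := one_le_covNum hN
  have h2 : (1 : ℝ) ≤ N := by exact_mod_cast h1
  unfold conf
  rw [hN, ENat.toNat_natCast]
  have : 0 ≤ Real.log (2 * N / δ) := Real.log_nonneg (by rw [le_div_iff₀ hδ]; linarith)
  have : 0 ≤ 2 * (Vbar * M.H) ^ 2 * Real.log (2 * N / δ) := by positivity
  linarith

/-- An episode-wise bound on the regret by the sum of the prediction gaps. -/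
theorem pseudoRegret_le [IsProbabilityMeasure M.initLaw] {πopt : AugState X → A} {K : ℕ}
    {Vbar δ C : ℝ} (hS : M.Setting P πopt L K Vbar δ C) (ω : Fin K → Noise X F M.H)
    (hmem : ∀ k : Fin K, M.truth ∈ M.confSet P (M.history P L k (prefixOf ω k k.isLt.le))
      (L.fit k (M.history P L k (prefixOf ω k k.isLt.le))) (M.conf P K Vbar δ C)) :
    M.pseudoRegret P L πopt K ω ≤
      ∑ k : Fin K, ∫ ξ, M.gapSum P L k (prefixOf ω k k.isLt.le) ξ ∂M.episodeLaw := by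
  have : Nonempty A := hS.nonempty_action
  exact Finset.sum_le_sum fun k _ => regret_le_integral_gapSum hS.projection hS.measurable
    hS.Vbar_nonneg hS.bounded hS.optimal.1 hS.acrl k.isLt _ (hmem k)

/-- If all models agree up to the resolution `1 / (K H)`, the regret is at most one. -/
theorem pseudoRegret_le_one [IsProbabilityMeasure M.initLaw] {πopt : AugState X → A} {K : ℕ}
    {Vbar δ C : ℝ} (hC : 2 ≤ C) {N : ℕ} (hN : M.covNum P K δ = N)
    (hS : M.Setting P πopt L K Vbar δ C)
    (hclose : ∀ θ θ' (z : M.Triple P), |M.qFun P θ z - M.qFun P θ' z| ≤ 1 / (K * M.H))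
    (ω : Fin K → Noise X F M.H) : M.pseudoRegret P L πopt K ω ≤ 1 := by
  have : Nonempty A := hS.nonempty_action
  have hV := hS.Vbar_nonneg
  have hH : (1 : ℝ) ≤ M.H := by exact_mod_cast hS.H_pos
  have hK : (1 : ℝ) ≤ K := by exact_mod_cast hS.K_pos
  have hgap : ∀ θ k (w : Fin k → Noise X F M.H) ξ, ∀ h < M.H,
      |M.dataGap P L θ k w ξ h| ≤ 1 / (K * M.H) := fun θ k w ξ h hh =>
    hclose θ M.truth (dataTriple hS.projection L k w ξ ⟨h, hh⟩)
  have hgap2 : ∀ θ k (w : Fin k → Noise X F M.H) ξ, ∀ h < M.H,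
      |M.dataGap P L θ k w ξ h| ≤ 2 * Vbar := fun θ k w ξ h hh =>
    abs_gapAt_le hS.projection hS.measurable hV hS.bounded _ _ _ _ hh
  refine (pseudoRegret_le hS ω fun k => ?_).trans ?_
  · -- extend the noise to an infinite sequence
    let u : ℕ → Noise X F M.H := fun i => if hi : i < K then ω ⟨i, hi⟩ else ω k
    have hu : prefixOf ω k k.isLt.le = pastOf u k := by
      funext i
      have : (i : ℕ) < K := i.isLt.trans k.isLt
      simp [prefixOf, pastOf, u, this, Fin.castLE]
    rw [hu, mem_confSet_iff]
    refine le_trans ?_ (le_conf hN hS.δ_pos hS.δ_lt_one)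
    calc _ ≤ ∑ i ∈ Finset.range (k : ℕ), ∑ h ∈ Finset.range M.H, 1 / (K * M.H) * (2 * Vbar) := by
          refine Finset.sum_le_sum fun i _ => Finset.sum_le_sum fun h hh => ?_
          rw [dataGap_truth, zero_sub, neg_sq, ← sq_abs, sq]
          exact mul_le_mul (hgap _ _ _ _ _ (Finset.mem_range.1 hh))
            (hgap2 _ _ _ _ _ (Finset.mem_range.1 hh)) (abs_nonneg _) (by positivity)
      _ = (k / K : ℝ) * (2 * Vbar) := by
          simp only [Finset.sum_const, Finset.card_range, nsmul_eq_mul]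
          field_simp
      _ ≤ 1 * (2 * Vbar) := by
          gcongr
          rw [div_le_one (by linarith)]
          exact_mod_cast k.isLt.le
      _ ≤ C * Vbar * M.H := by
          have h1 : 2 * Vbar ≤ C * Vbar := by gcongr
          have h2 : C * Vbar * 1 ≤ C * Vbar * M.H := by gcongr
          linarith
  · calc _ ≤ ∑ k : Fin K, (1 / K : ℝ) := by
          refine Finset.sum_le_sum fun k _ => ?_
          have hle : ∀ ξ, M.gapSum P L k (prefixOf ω k k.isLt.le) ξ ≤ 1 / K := by
            intro ξ
            refine (Finset.sum_le_card_nsmul _ _ _ fun h hh =>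
              hgap _ _ _ _ h (Finset.mem_range.1 hh)).trans (le_of_eq ?_)
            rw [Finset.card_range, nsmul_eq_mul]
            field_simp
          have hint : Integrable (fun ξ => M.gapSum P L k (prefixOf ω k k.isLt.le) ξ)
              M.episodeLaw := by
            refine Integrable.of_bound ((measurable_gapSum hS.measurable k).comp
              measurable_prodMk_left).aestronglyMeasurable (1 / K) (.of_forall fun ξ => ?_)
            rw [Real.norm_of_nonneg
              (gapSum_mem_Icc hS.projection hS.measurable hV hS.bounded _ _ _).1]
            exact hle ξ
          refine (integral_mono hint (integrable_const _) hle).trans (le_of_eq ?_)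
          simp
      _ = 1 := by
          rw [Finset.sum_const, Finset.card_univ, Fintype.card_fin, nsmul_eq_mul]
          field_simp

instance [IsProbabilityMeasure M.initLaw] (K : ℕ) : IsProbabilityMeasure (M.noiseLaw K) := by
  unfold noiseLaw; infer_instance

/-- The regret bound on the event that the exponential supermartingales of a net of models stay below
`exp ℓ` and that the realized sums of the prediction gaps are close to their conditional
expectations. -/
theorem pseudoRegret_le_of_good [IsProbabilityMeasure M.initLaw] {πopt : AugState X → A} {K : ℕ}
    {Vbar δ C : ℝ} (hC : 18 ≤ C) (hS : M.Setting P πopt L K Vbar δ C) (hV : 0 < Vbar)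
    (hH : 2 ≤ M.H) {d : ℕ} (hd1 : 1 ≤ d) (hd : M.dimQ P K = d) {ℓ ℓ' : ℝ} (hℓ'ℓ : ℓ' ≤ ℓ)
    (hlog2 : Real.log 2 ≤ ℓ')
    (hβℓ : M.conf P K Vbar δ C = 2 * (Vbar * M.H) ^ 2 * ℓ + C * Vbar * M.H) {T : Finset Θ} {α : ℝ}
    (hα0 : 0 ≤ α) (hαKH : 12 * α * (K * M.H) ≤ 18)
    (hT : ∀ θ, ∃ θ' ∈ T, ∀ z, |M.qFun P θ z - M.qFun P θ' z| ≤ α) (ω : Fin K → Noise X F M.H)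
    (h1 : ∀ θ ∈ T, ∀ k (hk : k ≤ K),
      partialSum (M.logIncrement P L Vbar θ) k (prefixOf ω k hk) < ℓ)
    (h2 : ∑ k : Fin K, (∫ ξ, M.gapSum P L k (prefixOf ω k k.isLt.le) ξ ∂M.episodeLaw -
      M.gapSum P L k (prefixOf ω k k.isLt.le) (ω k)) ≤ Vbar * M.H * √(2 * K * ℓ')) :
    M.pseudoRegret P L πopt K ω ≤
      1 + d * M.H * Vbar + 4 * √(d * M.conf P K Vbar δ C * K * M.H) := by
  have : Nonempty A := hS.nonempty_action
  have hP := hS.projection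
  have hm := hS.measurable
  have hb := hS.bounded
  have hH1 : (1 : ℝ) ≤ M.H := by exact_mod_cast hS.H_pos
  have hK1 : (1 : ℝ) ≤ K := by exact_mod_cast hS.K_pos
  have hKH : 0 < 1 / (K * M.H : ℝ) := by positivity
  have hlog2pos := Real.log_two_gt_d9
  have hℓ0 : 0 ≤ ℓ := by linarith
  obtain ⟨κ, η, hκ, hη, hbudget, hκH⟩ := exists_budget hV hH (hlog2.trans hℓ'ℓ) hC
  rw [← hβℓ] at hbudget
  have hβ0 : 0 ≤ M.conf P K Vbar δ C := by
    rw [hβℓ]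
    positivity
  have hacrl := hS.acrl
  have hreg := pseudoRegret_le hS ω
  generalize M.conf P K Vbar δ C = β at *
  let u : ℕ → Noise X F M.H := fun i => if hi : i < K then ω ⟨i, hi⟩ else ω ⟨0, hS.K_pos⟩
  have huk : ∀ k : Fin K, u k = ω k := fun k => by simp [u]
  have hu : ∀ k (hk : k ≤ K), prefixOf ω k hk = pastOf u k := by
    intro k hk
    funext i
    have : (i : ℕ) < K := i.isLt.trans_le hk
    simp [prefixOf, pastOf, u, this, Fin.castLE]
  have hsup : ∀ k < K, ∑ i ∈ Finset.range k, ∑ h ∈ Finset.range M.H,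
      M.dataGap P L (L.fit k (M.history P L k (pastOf u k))) i (pastOf u i) (u i) h ^ 2 ≤
        8 * Vbar ^ 2 * ℓ + 18 * Vbar := by
    intro k hk
    have hfit : ∀ θ ∈ T, partialSum (M.logIncrement P L Vbar θ) k (pastOf u k) ≤ ℓ := by
      intro θ hθ
      by_contra! hlt
      have := h1 θ hθ k hk.le
      rw [hu k hk.le] at this
      linarith
    refine (sum_sq_dataGap_fit_le hP hm hV hb hT u k hfit
      (hacrl.fit_min k hk _ M.truth)).trans ?_
    have h3 : 12 * Vbar * α * (k * M.H) ≤ 12 * Vbar * α * (K * M.H) := by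
      gcongr
    have h4 : Vbar * (12 * α * (K * M.H)) ≤ Vbar * 18 := mul_le_mul_of_nonneg_left hαKH hV.le
    nlinarith
  have hβle : 8 * Vbar ^ 2 * ℓ + 18 * Vbar ≤ β := by
    rw [hβℓ]
    have hH2 : (2 : ℝ) ≤ M.H := by exact_mod_cast hH
    have hℓ0 : 0 ≤ ℓ := by linarith
    have e1 : 18 * Vbar ≤ C * Vbar * M.H := by
      have : 18 * Vbar ≤ C * Vbar := by gcongr
      nlinarith
    have e2 : 4 * (Vbar ^ 2 * ℓ) ≤ (M.H : ℝ) ^ 2 * (Vbar ^ 2 * ℓ) :=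
      mul_le_mul_of_nonneg_right (by nlinarith) (by positivity)
    nlinarith
  have hmem : ∀ k : Fin K, M.truth ∈ M.confSet P (M.history P L k (prefixOf ω k k.isLt.le))
      (L.fit k (M.history P L k (prefixOf ω k k.isLt.le))) β := by
    intro k
    rw [hu, mem_confSet_iff]
    simp only [dataGap_truth, zero_sub, neg_sq]
    exact (hsup k k.isLt).trans hβle
  have hsel : ∀ k < K, ∑ i ∈ Finset.range k, ∑ h ∈ Finset.range M.H,
      M.dataGap P L (M.selectAt P L k (pastOf u k) (u k).1) i (pastOf u i) (u i) h ^ 2 ≤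
        (1 + η) * β + (1 + 1 / η) * (8 * Vbar ^ 2 * ℓ + 18 * Vbar) := by
    intro k hk
    have h3 := (mem_confSet_iff k _ _ _).1 (hacrl.select_mem k hk (pastOf u k) (u k).1)
    have h4 := hsup k hk
    set θhat := L.fit k (M.history P L k (pastOf u k))
    change ∑ i ∈ Finset.range k, ∑ h ∈ Finset.range M.H,
      (M.dataGap P L (M.selectAt P L k (pastOf u k) (u k).1) i (pastOf u i) (u i) h -
        M.dataGap P L θhat i (pastOf u i) (u i) h) ^ 2 ≤ β at h3
    calc _ ≤ ∑ i ∈ Finset.range k, ∑ h ∈ Finset.range M.H,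
          ((1 + η) * (M.dataGap P L (M.selectAt P L k (pastOf u k) (u k).1) i (pastOf u i) (u i) h -
            M.dataGap P L θhat i (pastOf u i) (u i) h) ^ 2 +
          (1 + 1 / η) * M.dataGap P L θhat i (pastOf u i) (u i) h ^ 2) := by
          refine Finset.sum_le_sum fun i _ => Finset.sum_le_sum fun h _ => ?_
          generalize M.dataGap P L (M.selectAt P L k (pastOf u k) (u k).1) i (pastOf u i) (u i) h
            = x
          generalize M.dataGap P L θhat i (pastOf u i) (u i) h = y
          have e : (1 + η) * (x - y) ^ 2 + (1 + 1 / η) * y ^ 2 - x ^ 2 =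
              (η * (x - y) - y) ^ 2 / η := by
            field_simp
            ring
          have : 0 ≤ (η * (x - y) - y) ^ 2 / η := by positivity
          linarith
      _ = (1 + η) * (∑ i ∈ Finset.range k, ∑ h ∈ Finset.range M.H,
            (M.dataGap P L (M.selectAt P L k (pastOf u k) (u k).1) i (pastOf u i) (u i) h -
              M.dataGap P L θhat i (pastOf u i) (u i) h) ^ 2) +
          (1 + 1 / η) * (∑ i ∈ Finset.range k, ∑ h ∈ Finset.range M.H,
            M.dataGap P L θhat i (pastOf u i) (u i) h ^ 2) := by
          simp only [Finset.sum_add_distrib, Finset.mul_sum]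
      _ ≤ _ := by gcongr
  have hsum := sum_gapSum_le hP hm hV.le hb hH hKH
    (show eluderDim (M.qClass P) (1 / (K * M.H)) ≤ d from hd.le) u K (B := √(κ * β))
    (Real.sqrt_nonneg _) (by rwa [Real.sq_sqrt (by positivity)]) hsel
  replace hreg := hreg hmem
  have hdev : ∑ k : Fin K, (∫ ξ, M.gapSum P L k (prefixOf ω k k.isLt.le) ξ ∂M.episodeLaw -
    M.gapSum P L k (prefixOf ω k k.isLt.le) (ω k)) ≤ Vbar * M.H * √(2 * K * ℓ') :=
    h2
  rw [Finset.sum_sub_distrib] at hdev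
  have hsum' : ∑ k : Fin K, M.gapSum P L k (prefixOf ω k k.isLt.le) (ω k) =
      ∑ k ∈ Finset.range K, M.gapSum P L k (pastOf u k) (u k) := by
    rw [Finset.sum_range]
    refine Finset.sum_congr rfl fun k _ => ?_
    rw [hu, huk]
  rw [hsum'] at hdev
  have hfin := regret_arith hV.le hH hS.K_pos hd1 hβ0 hκ (by linarith : 0 ≤ ℓ') (by
    rw [hβℓ]
    have : 2 * (Vbar * M.H) ^ 2 * ℓ' ≤ 2 * (Vbar * M.H) ^ 2 * ℓ := by gcongr
    have : 0 ≤ C * Vbar * M.H := by positivity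
    linarith) hκH
  linarith

/-- The regret bound in terms of the Eluder dimension and the covering number. -/
theorem regret_bound [IsProbabilityMeasure M.initLaw] {πopt : AugState X → A} {K : ℕ}
    {Vbar δ C : ℝ} (hC : 18 ≤ C) {N d : ℕ} (hS : M.Setting P πopt L K Vbar δ C)
    (hN : M.covNum P K δ = N) (hd : M.dimQ P K = d) :
    1 - δ ≤ (M.noiseLaw K).real {ω | M.pseudoRegret P L πopt K ω ≤
      1 + d * M.H * Vbar + 4 * √(d * M.conf P K Vbar δ C * K * M.H)} := by
  have : Nonempty A := hS.nonempty_action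
  have hV0 := hS.Vbar_nonneg
  have hδ := hS.δ_pos
  have hδ1 := hS.δ_lt_one
  have hP := hS.projection
  have hm := hS.measurable
  have hb := hS.bounded
  have hH1 : (1 : ℝ) ≤ M.H := by exact_mod_cast hS.H_pos
  have hK1 : (1 : ℝ) ≤ K := by exact_mod_cast hS.K_pos
  by_cases hclose : ∀ θ θ' (z : M.Triple P), |M.qFun P θ z - M.qFun P θ' z| ≤ 1 / (K * M.H)
  · have huniv : {ω | M.pseudoRegret P L πopt K ω ≤
        1 + d * M.H * Vbar + 4 * √(d * M.conf P K Vbar δ C * K * M.H)} = Set.univ := by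
      refine Set.eq_univ_of_forall fun ω => ?_
      refine (pseudoRegret_le_one (by linarith) hN hS hclose ω).trans ?_
      have : 0 ≤ d * M.H * Vbar := by positivity
      have := Real.sqrt_nonneg (d * M.conf P K Vbar δ C * K * M.H)
      linarith
    rw [huniv]
    simp only [probReal_univ]
    linarith
  push Not at hclose
  obtain ⟨θ₁, θ₂, z₀, hfar⟩ := hclose
  have hKH : 0 < 1 / (K * M.H : ℝ) := by positivity
  have hV : 0 < Vbar := by
    have := abs_qFun_sub_le hm hV0 hb θ₁ θ₂ z₀
    linarith
  have hH : 2 ≤ M.H := by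
    by_contra! hlt
    have h1 := hS.H_pos
    rw [qFun_eq_of_H_eq_one (by omega) θ₁ θ₂ z₀, sub_self, abs_zero] at hfar
    linarith
  have hd1 : 1 ≤ d := by
    by_contra! hlt
    obtain rfl : d = 0 := by omega
    have := abs_sub_le_of_eluderDim_zero (ε := 1 / (K * M.H)) hd hKH.le (qFun_mem θ₁)
      (qFun_mem θ₂) z₀
    linarith
  have hN1 : (1 : ℝ) ≤ N := by exact_mod_cast one_le_covNum hN
  set ℓ := Real.log (2 * N / δ) with hℓ
  set ℓ' := Real.log (2 / δ) with hℓ'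
  have hℓ'ℓ : ℓ' ≤ ℓ := Real.log_le_log (by positivity) (by gcongr; linarith)
  have hlog2 : Real.log 2 ≤ ℓ' := Real.log_le_log (by norm_num) (by rw [le_div_iff₀ hδ]; linarith)
  have hlog2pos := Real.log_two_gt_d9
  have hβ : M.conf P K Vbar δ C = 2 * (Vbar * M.H) ^ 2 * ℓ + C * Vbar * M.H := by
    rw [conf, hN, ENat.toNat_natCast]
  -- the net of models, and the resolution of the net
  set α := 1 / (K * M.H * Real.log (K * M.H / δ)) with hα
  have hKH2 : (2 : ℝ) ≤ K * M.H := by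
    have : (2 : ℝ) ≤ M.H := by exact_mod_cast hH
    nlinarith
  have hlogKH : Real.log 2 ≤ Real.log (K * M.H / δ) :=
    Real.log_le_log (by norm_num) (by rw [le_div_iff₀ hδ]; nlinarith)
  have hα0 : 0 ≤ α := by
    have : 0 ≤ Real.log (K * M.H / δ) := by linarith
    positivity
  have hαKH : 12 * α * (K * M.H) ≤ 18 := by
    have h1 : 0 < Real.log (K * M.H / δ) := by linarith
    have : 12 * α * (K * M.H) = 12 / Real.log (K * M.H / δ) := by
      rw [hα]; field_simp
    rw [this, div_le_iff₀ h1]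
    linarith
  obtain ⟨T, hTcard, hT⟩ := exists_net hα0 hN
  -- the two exceptional events
  let bad₁ : Θ → Set (Fin K → Noise X F M.H) := fun θ => {ω | ∃ k, ∃ hk : k ≤ K,
    ℓ ≤ partialSum (M.logIncrement P L Vbar θ) k (prefixOf ω k hk)}
  let bad₂ : Set (Fin K → Noise X F M.H) := {ω | Vbar * M.H * √(2 * K * ℓ') ≤
    ∑ k : Fin K, (∫ ξ, M.gapSum P L k (prefixOf ω k k.isLt.le) ξ ∂M.episodeLaw -
      M.gapSum P L k (prefixOf ω k k.isLt.le) (ω k))}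
  have hbad₁ : (M.noiseLaw K).real (⋃ θ ∈ T, bad₁ θ) ≤ δ / 2 := by
    refine (measureReal_biUnion_finset_le T bad₁).trans ?_
    calc ∑ θ ∈ T, (M.noiseLaw K).real (bad₁ θ) ≤ ∑ θ ∈ T, Real.exp (-ℓ) :=
          Finset.sum_le_sum fun θ _ => measure_exists_le_logIncrement_le hP hm hV.le hb θ ℓ K
      _ = T.card * (δ / (2 * N)) := by
          rw [Finset.sum_const, nsmul_eq_mul, Real.exp_neg, hℓ, Real.exp_log (by positivity),
            inv_div]
      _ ≤ N * (δ / (2 * N)) := by gcongr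
      _ = δ / 2 := by field_simp
  have hbad₂ : (M.noiseLaw K).real bad₂ ≤ δ / 2 := by
    have := measure_azuma_le M.episodeLaw (W := fun k => M.gapSum P L k)
      (fun k => measurable_gapSum hm k) (R := Vbar * M.H) (by positivity)
      (fun k w ξ => gapSum_mem_Icc hP hm hV.le hb k w ξ) (by linarith : 0 < ℓ') hS.K_pos
    rw [Real.exp_neg, hℓ', Real.exp_log (by positivity), inv_div] at this
    exact this
  have hgood : ∀ ω, ω ∉ (⋃ θ ∈ T, bad₁ θ) → ω ∉ bad₂ → M.pseudoRegret P L πopt K ω ≤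
      1 + d * M.H * Vbar + 4 * √(d * M.conf P K Vbar δ C * K * M.H) := by
    intro ω h1 h2
    refine pseudoRegret_le_of_good hC hS hV hH hd1 hd hℓ'ℓ hlog2 hβ hα0 hαKH hT ω ?_ (not_le.1 h2).le
    intro θ hθ k hk
    by_contra! hlt
    exact h1 (Set.mem_biUnion hθ ⟨k, hk, hlt⟩)
  have hcover : (Set.univ : Set (Fin K → Noise X F M.H)) ⊆
      {ω | M.pseudoRegret P L πopt K ω ≤ 1 + d * M.H * Vbar + 4 * √(d * M.conf P K Vbar δ C * K * M.H)} ∪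
        ((⋃ θ ∈ T, bad₁ θ) ∪ bad₂) := by
    intro ω _
    by_cases h1 : ω ∈ ⋃ θ ∈ T, bad₁ θ
    · exact Or.inr (Or.inl h1)
    · by_cases h2 : ω ∈ bad₂
      · exact Or.inr (Or.inr h2)
      · exact Or.inl (hgood ω h1 h2)
  have h1 := measureReal_mono (μ := M.noiseLaw K) hcover
  have h2 := measureReal_union_le (μ := M.noiseLaw K)
    {ω | M.pseudoRegret P L πopt K ω ≤ 1 + d * M.H * Vbar + 4 * √(d * M.conf P K Vbar δ C * K * M.H)}
    ((⋃ θ ∈ T, bad₁ θ) ∪ bad₂)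
  have h3 := measureReal_union_le (μ := M.noiseLaw K) (⋃ θ ∈ T, bad₁ θ) bad₂
  rw [probReal_univ] at h1
  linarith

end ACMDP

/-! ### The determinant potential -/

section Potential

open Matrix

variable {r : ℕ}

/-- The regularized Gram matrix of the first `k` vectors. -/
def gramMatrix (lam : ℝ) (c : ℕ → Fin r → ℝ) (k : ℕ) : Matrix (Fin r) (Fin r) ℝ :=
  lam • 1 + ∑ j ∈ Finset.range k, vecMulVec (c j) (c j)

theorem gramMatrix_succ (lam : ℝ) (c : ℕ → Fin r → ℝ) (k : ℕ) :
    gramMatrix lam c (k + 1) = gramMatrix lam c k + vecMulVec (c k) (c k) := by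
  rw [gramMatrix, Finset.sum_range_succ, ← add_assoc, ← gramMatrix]

theorem posDef_gramMatrix {lam : ℝ} (hlam : 0 < lam) (c : ℕ → Fin r → ℝ) (k : ℕ) :
    (gramMatrix lam c k).PosDef := by
  induction k with
  | zero =>
    simp only [gramMatrix, Finset.range_zero, Finset.sum_empty, add_zero]
    exact Matrix.PosDef.one.smul hlam
  | succ k ih =>
    rw [gramMatrix_succ]
    exact ih.add_posSemidef (by simpa using posSemidef_vecMulVec_self_star (c k))

theorem dotProduct_gramMatrix_mulVec (lam : ℝ) (c : ℕ → Fin r → ℝ) (k : ℕ) (v : Fin r → ℝ) :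
    v ⬝ᵥ (gramMatrix lam c k *ᵥ v) =
      lam * (v ⬝ᵥ v) + ∑ j ∈ Finset.range k, (c j ⬝ᵥ v) ^ 2 := by
  induction k with
  | zero =>
    simp only [gramMatrix, Finset.range_zero, Finset.sum_empty, add_zero]
    rw [smul_mulVec, one_mulVec, dotProduct_smul, smul_eq_mul]
  | succ k ih =>
    rw [gramMatrix_succ, add_mulVec, dotProduct_add, ih, Finset.sum_range_succ, vecMulVec_mulVec]
    simp only [op_smul_eq_smul, dotProduct_smul, smul_eq_mul]
    rw [dotProduct_comm v (c k)]
    ring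

theorem trace_gramMatrix (lam : ℝ) (c : ℕ → Fin r → ℝ) (k : ℕ) :
    (gramMatrix lam c k).trace = r * lam + ∑ j ∈ Finset.range k, c j ⬝ᵥ c j := by
  simp [gramMatrix, trace_add, trace_smul, trace_sum, trace_vecMulVec, mul_comm]

/-- A positive semidefinite matrix of trace at most `r a` has determinant at most `a ^ r`. -/
theorem det_le_pow_of_trace_le {A : Matrix (Fin r) (Fin r) ℝ} (hA : A.PosSemidef) {a : ℝ} (ha : 0 < a)
    (htr : A.trace ≤ r * a) : A.det ≤ a ^ r := by
  have hdet := hA.isHermitian.det_eq_prod_eigenvalues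
  have htrace := hA.isHermitian.trace_eq_sum_eigenvalues
  simp only [RCLike.ofReal_real_eq_id, id_eq] at hdet htrace
  set e := hA.isHermitian.eigenvalues
  have h0 : ∀ i, 0 ≤ e i := hA.eigenvalues_nonneg
  -- the inequality of the arithmetic and geometric means, from `x ≤ exp (x - 1)`
  have h1 : ∏ i, (e i / a) ≤ 1 := by
    calc ∏ i, (e i / a) ≤ ∏ i, Real.exp (e i / a - 1) :=
          Finset.prod_le_prod (fun i _ => div_nonneg (h0 i) ha.le) fun i _ => by
            have := Real.add_one_le_exp (e i / a - 1)
            linarith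
      _ = Real.exp ((∑ i, e i) / a - r) := by
          rw [← Real.exp_sum, Finset.sum_sub_distrib, ← Finset.sum_div]
          simp
      _ ≤ 1 := by
          rw [Real.exp_le_one_iff, ← htrace, sub_nonpos, div_le_iff₀ ha]
          exact htr
  rw [Finset.prod_div_distrib, Finset.prod_const, Finset.card_univ, Fintype.card_fin,
    div_le_one (by positivity)] at h1
  rw [hdet]
  exact h1

/-- A vector with a large value on an element of the ellipsoid enlarges the determinant. -/
theorem det_gramMatrix_succ_ge {lam : ℝ} (hlam : 0 < lam) (c : ℕ → Fin r → ℝ) (k : ℕ)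
    {v : Fin r → ℝ} {ε : ℝ} (hε : 0 ≤ ε)
    (hv : lam * (v ⬝ᵥ v) + ∑ j ∈ Finset.range k, (c j ⬝ᵥ v) ^ 2 ≤ 2 * ε ^ 2)
    (hlarge : ε < |c k ⬝ᵥ v|) :
    3 / 2 * (gramMatrix lam c k).det ≤ (gramMatrix lam c (k + 1)).det := by
  set A := gramMatrix lam c k with hA
  have hpos : A.PosDef := posDef_gramMatrix hlam c k
  have hunit : IsUnit A.det := hpos.det_pos.ne'.isUnit
  set w := A⁻¹ *ᵥ c k with hw
  have hAw : A *ᵥ w = c k := by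
    rw [hw, mulVec_mulVec, mul_nonsing_inv A hunit, one_mulVec]
  have hdet : (gramMatrix lam c (k + 1)).det = A.det * (1 + c k ⬝ᵥ w) := by
    rw [gramMatrix_succ, ← hA, vecMulVec_eq Unit,
      det_add_replicateCol_mul_replicateRow hunit]
    congr 1
    rw [det_unique, Matrix.add_apply, one_apply_eq, Matrix.mul_assoc,
      ← replicateCol_mulVec, replicateRow_mul_replicateCol_apply]
  have hsymm : ∀ x y : Fin r → ℝ, x ⬝ᵥ (A *ᵥ y) = y ⬝ᵥ (A *ᵥ x) := by
    intro x y
    have ht : Aᵀ = A := by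
      have := hpos.isHermitian.eq
      rwa [conjTranspose_eq_transpose_of_trivial] at this
    rw [dotProduct_mulVec, ← mulVec_transpose, ht, dotProduct_comm]
  have hhalf : 1 / 2 ≤ c k ⬝ᵥ w := by
    by_contra! hlt
    set b := c k ⬝ᵥ v with hb
    -- the quadratic form of `A` at `v - 2 b w` would be negative
    have h1 : 0 ≤ (v - (2 * b) • w) ⬝ᵥ (A *ᵥ (v - (2 * b) • w)) := by
      have := hpos.posSemidef.dotProduct_mulVec_nonneg (v - (2 * b) • w)
      simpa using this
    have h2 : v ⬝ᵥ (A *ᵥ w) = b := by rw [hAw, dotProduct_comm]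
    have h3 : w ⬝ᵥ (A *ᵥ w) = c k ⬝ᵥ w := by rw [hAw, dotProduct_comm]
    have h4 : (v - (2 * b) • w) ⬝ᵥ (A *ᵥ (v - (2 * b) • w)) =
        v ⬝ᵥ (A *ᵥ v) - 4 * b ^ 2 + 4 * b ^ 2 * (c k ⬝ᵥ w) := by
      simp only [mulVec_sub, mulVec_smul, dotProduct_sub, sub_dotProduct, dotProduct_smul,
        smul_dotProduct, smul_eq_mul, h3, hsymm w v, h2]
      ring
    have h6 : v ⬝ᵥ (A *ᵥ v) ≤ 2 * ε ^ 2 := by rw [hA, dotProduct_gramMatrix_mulVec]; exact hv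
    rw [h4] at h1
    have h5 : ε ^ 2 < b ^ 2 := by
      rw [← sq_abs b]
      gcongr
    nlinarith
  rw [hdet]
  have := hpos.det_pos
  nlinarith

/-- The elliptical potential argument: each step multiplies the determinant by at least `3 / 2`, while
the trace bounds its growth polynomially. -/
theorem pow_mul_pow_le_of_potential {lam R ε : ℝ} (hlam : 0 < lam) (hR : 0 ≤ R) (hε : 0 ≤ ε)
    (c v : ℕ → Fin r → ℝ) (n : ℕ)
    (hv : ∀ k < n, lam * (v k ⬝ᵥ v k) + ∑ j ∈ Finset.range k, (c j ⬝ᵥ v k) ^ 2 ≤ 2 * ε ^ 2)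
    (hlarge : ∀ k < n, ε < |c k ⬝ᵥ v k|) (hc : ∀ k < n, c k ⬝ᵥ c k ≤ r * R) :
    (3 / 2) ^ n * lam ^ r ≤ (lam + n * R) ^ r := by
  have h1 : ∀ k ≤ n, (3 / 2) ^ k * lam ^ r ≤ (gramMatrix lam c k).det := by
    intro k
    induction k with
    | zero => intro _; simp [gramMatrix]
    | succ k ih =>
      intro hk
      have := det_gramMatrix_succ_ge hlam c k hε (hv k hk) (hlarge k hk)
      have := ih (by omega)
      rw [pow_succ]
      linarith
  refine (h1 n le_rfl).trans (det_le_pow_of_trace_le (posDef_gramMatrix hlam c n).posSemidef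
    (by positivity) ?_)
  rw [trace_gramMatrix]
  have h2 : ∑ j ∈ Finset.range n, c j ⬝ᵥ c j ≤ n * (r * R) := by
    have := Finset.sum_le_card_nsmul (Finset.range n) (fun j => c j ⬝ᵥ c j) (r * R)
      fun j hj => hc j (Finset.mem_range.1 hj)
    simpa using this
  linarith

end Potential

/-! ### Barycentric spanners -/

section Spanner

open Matrix

variable {Z : Type*}

/-- The evaluations of linearly independent functions at suitable points are linearly independent. -/
theorem exists_det_eval_ne_zero {r : ℕ} (b : Fin r → Z → ℝ) (hb : LinearIndependent ℝ b) :
    ∃ y : Fin r → Z, (Matrix.of fun j i => b i (y j)).det ≠ 0 := by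
  let ψ : Z → Fin r → ℝ := fun z i => b i z
  have hspan : Submodule.span ℝ (Set.range ψ) = ⊤ := by
    by_contra hne
    obtain ⟨f, hf0, hf⟩ := Submodule.exists_le_ker_of_lt_top _ (lt_top_iff_ne_top.2 hne)
    apply hf0
    have h1 : ∑ i, f (Pi.single i 1) • b i = 0 := by
      funext z
      have h2 : f (ψ z) = 0 := hf (Submodule.subset_span ⟨z, rfl⟩)
      rw [← Finset.univ_sum_single (ψ z), map_sum] at h2
      rw [Finset.sum_apply, Pi.zero_apply, ← h2]
      refine Finset.sum_congr rfl fun i _ => ?_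
      rw [Pi.smul_apply, smul_eq_mul, mul_comm]
      have : (Pi.single i (ψ z i) : Fin r → ℝ) = ψ z i • Pi.single i 1 := by
        rw [← Pi.single_smul, smul_eq_mul, mul_one]
      rw [this, map_smul, smul_eq_mul]
    have h3 := Fintype.linearIndependent_iff.1 hb _ h1
    refine LinearMap.pi_ext' fun i => LinearMap.ext_ring ?_
    simpa using h3 i
  obtain ⟨B, hBsub, hBspan, hBli⟩ := exists_linearIndependent ℝ (Set.range ψ)
  rw [hspan] at hBspan
  let basis : Module.Basis B ℝ (Fin r → ℝ) := Module.Basis.mk hBli (by simp [hBspan])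
  have : Fintype B := FiniteDimensional.fintypeBasisIndex basis
  have hcard : Fintype.card B = r := by
    rw [← Module.finrank_eq_card_basis basis, Module.finrank_fin_fun]
  let e : Fin r ≃ B := (Fintype.equivFinOfCardEq hcard).symm
  choose g hg using fun x : B => hBsub x.2
  refine ⟨fun j => g (e j), ?_⟩
  have hrows : LinearIndependent ℝ
      (Matrix.of fun (j i : Fin r) => b i (g (e j))).row := by
    have h1 : (Matrix.of fun (j i : Fin r) => b i (g (e j))).row = Subtype.val ∘ e :=
      funext fun j => hg (e j)
    rw [h1]
    exact hBli.comp e e.injective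
  exact (isUnit_iff_isUnit_det _).1 (linearIndependent_rows_iff_isUnit.1 hrows) |>.ne_zero

/-- An approximate barycentric spanner: the evaluation at any point is a combination, with coefficients
in `[-2, 2]`, of the evaluations at `r` fixed points. The points are chosen such that the
determinant of their evaluations is at least half of the supremum, and the coefficients come from
Cramer's rule. -/
theorem exists_spanner {r : ℕ} (b : Fin r → Z → ℝ) (hb : LinearIndependent ℝ b) {R : ℝ}
    (hR : ∀ i z, |b i z| ≤ R) :
    ∃ (y : Fin r → Z) (c : Z → Fin r → ℝ), (∀ z j, |c z j| ≤ 2) ∧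
      ∀ i z, b i z = ∑ j, c z j * b i (y j) := by
  let A : (Fin r → Z) → Matrix (Fin r) (Fin r) ℝ := fun y => Matrix.of fun j i => b i (y j)
  have hbdd : BddAbove (Set.range fun y => |(A y).det|) := by
    refine ⟨(r.factorial : ℕ) • R ^ r, ?_⟩
    rintro _ ⟨y, rfl⟩
    have := Matrix.det_le (A := A y) (abv := AbsoluteValue.abs) (x := R) fun i j => hR j (y i)
    simpa using this
  obtain ⟨y₀, hy₀⟩ := exists_det_eval_ne_zero b hb
  set s := ⨆ y, |(A y).det| with hs
  have hspos : 0 < s := (abs_pos.2 hy₀).trans_le (le_ciSup hbdd y₀)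
  have : Nonempty (Fin r → Z) := ⟨y₀⟩
  obtain ⟨y, hy⟩ := exists_lt_of_lt_ciSup (show s / 2 < ⨆ y, |(A y).det| by rw [← hs]; linarith)
  have hdet : (A y).det ≠ 0 := abs_pos.1 (lt_trans (by positivity) hy)
  refine ⟨y, fun z j => (A (Function.update y j z)).det / (A y).det, fun z j => ?_, fun i z => ?_⟩
  · rw [abs_div, div_le_iff₀ (abs_pos.2 hdet)]
    have := le_ciSup hbdd (Function.update y j z)
    linarith
  · have h1 : ∀ j, (A (Function.update y j z)).det = (cramer (A y)ᵀ fun i => b i z) j := by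
      intro j
      rw [cramer_transpose_apply]
      congr 1
      ext k l
      by_cases hk : k = j
      · subst hk; simp [A]
      · simp [A, hk]
    have h2 := congrFun (mulVec_cramer (A y)ᵀ fun i => b i z) i
    rw [det_transpose] at h2
    simp only [mulVec, dotProduct, transpose_apply, Pi.smul_apply, smul_eq_mul] at h2
    have h3 : ∑ j, (A (Function.update y j z)).det / (A y).det * b i (y j) =
        (∑ j, A y j i * (cramer (A y)ᵀ fun i => b i z) j) / (A y).det := by
      rw [Finset.sum_div]
      refine Finset.sum_congr rfl fun j _ => ?_
      rw [h1 j]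
      simp only [A, of_apply]
      ring
    rw [h3, h2]
    field_simp

/-- A class of bounded functions in a space of dimension at most `m` has a spanner of at most `m`
points. -/
theorem exists_spanner_of_finrank_le {Q : Set (Z → ℝ)} {m : ℕ} {V : ℝ}
    [FiniteDimensional ℝ (Submodule.span ℝ Q)]
    (hm : Module.finrank ℝ (Submodule.span ℝ Q) ≤ m) (hQ : ∀ q ∈ Q, ∀ z, |q z| ≤ V) :
    ∃ r ≤ m, ∃ (y : Fin r → Z) (c : Z → Fin r → ℝ), (∀ z j, |c z j| ≤ 2) ∧
      ∀ q ∈ Q, ∀ z, q z = ∑ j, c z j * q (y j) := by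
  let E := Submodule.span ℝ Q
  let b := Module.finBasis ℝ E
  have hbdd : ∀ q ∈ E, ∃ R, ∀ z, |q z| ≤ R := by
    intro q hq
    induction hq using Submodule.span_induction with
    | mem q hq => exact ⟨V, hQ q hq⟩
    | zero => exact ⟨0, fun z => by simp⟩
    | add q q' _ _ h h' =>
      obtain ⟨R, hR⟩ := h
      obtain ⟨R', hR'⟩ := h'
      exact ⟨R + R', fun z => (abs_add_le _ _).trans (add_le_add (hR z) (hR' z))⟩
    | smul a q _ h =>
      obtain ⟨R, hR⟩ := h
      refine ⟨|a| * R, fun z => ?_⟩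
      rw [Pi.smul_apply, smul_eq_mul, abs_mul]
      exact mul_le_mul_of_nonneg_left (hR z) (abs_nonneg a)
  choose R hR using fun i => hbdd (b i) (b i).2
  have hli : LinearIndependent ℝ fun i => (b i : Z → ℝ) :=
    b.linearIndependent.map' E.subtype (Submodule.ker_subtype E)
  obtain ⟨y, c, hc, hy⟩ := exists_spanner (fun i => (b i : Z → ℝ)) hli (R := ∑ i, |R i|)
    fun i z => (hR i z).trans ((le_abs_self _).trans
      (Finset.single_le_sum (f := fun i => |R i|) (fun _ _ => abs_nonneg _) (Finset.mem_univ i)))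
  refine ⟨_, hm, y, c, hc, fun q hq z => ?_⟩
  have hrep := congrArg Subtype.val (b.sum_repr ⟨q, Submodule.subset_span hq⟩)
  set x := b.repr ⟨q, Submodule.subset_span hq⟩
  simp only [Submodule.coe_sum, Submodule.coe_smul] at hrep
  have hval : ∀ z, q z = ∑ i, x i * (b i : Z → ℝ) z := by
    intro z
    rw [← hrep]
    simp [Finset.sum_apply]
  rw [hval z]
  simp only [hval (y _), Finset.mul_sum]
  rw [Finset.sum_comm]
  refine Finset.sum_congr rfl fun i _ => ?_
  rw [hy i z, Finset.mul_sum]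
  exact Finset.sum_congr rfl fun j _ => by ring

end Spanner

/-! ### Complexity of finite-dimensional classes -/

section Complexity

variable {Z : Type*} {Q : Set (Z → ℝ)} {r : ℕ} {V : ℝ} {y : Fin r → Z} {c : Z → Fin r → ℝ}

/-- Functions are grouped into cells according to their rounded values at the points of a spanner. -/
theorem supCoveringNumber_le_of_spanner (hQ : ∀ q ∈ Q, ∀ z, |q z| ≤ V)
    (hc : ∀ z j, |c z j| ≤ 2) (hy : ∀ q ∈ Q, ∀ z, q z = ∑ j, c z j * q (y j)) {α : ℝ} (hα : 0 < α) :
    supCoveringNumber Q α.toNNReal ≤ (((⌊4 * r * V / α⌋₊ + 1) ^ r : ℕ) : ℕ∞) := by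
  classical
  set m := ⌊4 * r * V / α⌋₊ with hm
  let cell : (Z → ℝ) → Fin r → Fin (m + 1) := fun q j =>
    Fin.ofNat (m + 1) ⌊(q (y j) + V) * (2 * r / α)⌋₊
  have hclose : ∀ q ∈ Q, ∀ q' ∈ Q, cell q = cell q' → ∀ z, |q z - q' z| ≤ α := by
    intro q hq q' hq' hcell z
    have hj : ∀ j, |q (y j) - q' (y j)| ≤ α / (2 * r) := by
      intro j
      have hr : (0 : ℝ) < r := by exact_mod_cast j.pos
      have hfl : ∀ f ∈ Q, 0 ≤ (f (y j) + V) * (2 * r / α) ∧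
          ⌊(f (y j) + V) * (2 * r / α)⌋₊ < m + 1 := by
        intro f hf
        have h1 := abs_le.1 (hQ f hf (y j))
        refine ⟨mul_nonneg (by linarith) (by positivity), Nat.lt_succ_of_le (Nat.floor_le_floor ?_)⟩
        calc (f (y j) + V) * (2 * r / α) ≤ (V + V) * (2 * r / α) := by
              gcongr; exact h1.2
          _ = 4 * r * V / α := by ring
      have h2 := congrArg Fin.val (congrFun hcell j)
      simp only [cell, Fin.ofNat, Nat.mod_eq_of_lt (hfl q hq).2,
        Nat.mod_eq_of_lt (hfl q' hq').2] at h2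
      have a1 := Nat.floor_le (hfl q hq).1
      have a2 := Nat.lt_floor_add_one ((q (y j) + V) * (2 * r / α))
      have a3 := Nat.floor_le (hfl q' hq').1
      have a4 := Nat.lt_floor_add_one ((q' (y j) + V) * (2 * r / α))
      rw [h2] at a1 a2
      have h3 : |q (y j) - q' (y j)| * (2 * r / α) ≤ 1 := by
        rw [← abs_of_pos (by positivity : 0 < 2 * r / α), ← abs_mul, abs_le]
        constructor <;> nlinarith
      rw [← le_div_iff₀ (by positivity)] at h3
      refine h3.trans (le_of_eq ?_)
      field_simp
    rw [hy q hq z, hy q' hq' z, ← Finset.sum_sub_distrib]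
    calc |∑ j, (c z j * q (y j) - c z j * q' (y j))|
        ≤ ∑ j, |c z j * q (y j) - c z j * q' (y j)| := Finset.abs_sum_le_sum_abs _ _
      _ ≤ ∑ j : Fin r, 2 * (α / (2 * r)) := by
          refine Finset.sum_le_sum fun j _ => ?_
          rw [← mul_sub, abs_mul]
          exact mul_le_mul (hc z j) (hj j) (abs_nonneg _) (by norm_num)
      _ ≤ α := by
          rw [Finset.sum_const, Finset.card_univ, Fintype.card_fin, nsmul_eq_mul]
          rcases Nat.eq_zero_or_pos r with h | h
          · subst h; simpa using hα.le
          · have : (0 : ℝ) < r := by exact_mod_cast h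
            refine le_of_eq ?_
            field_simp
  -- one representative for each occupied cell
  have hrep : ∀ k : cell '' Q, ∃ q ∈ Q, cell q = k := fun k => k.2
  choose g hgQ hg using hrep
  let C : Set (UniformFun Z ℝ) := Set.range fun k => UniformFun.ofFun (g k)
  have hcov : Metric.IsCover α.toNNReal (UniformFun.ofFun '' Q) C := by
    rintro _ ⟨q, hq, rfl⟩
    refine ⟨UniformFun.ofFun (g ⟨cell q, q, hq, rfl⟩), ⟨_, rfl⟩, ?_⟩
    refine UniformFun.edist_le.2 fun z => ?_
    rw [edist_dist, Real.dist_eq]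
    exact ENNReal.ofReal_le_ofReal (hclose q hq _ (hgQ _) (hg ⟨cell q, q, hq, rfl⟩).symm z)
  have hsub : C ⊆ UniformFun.ofFun '' Q := by
    rintro _ ⟨k, rfl⟩
    exact ⟨g k, hgQ k, rfl⟩
  refine (hcov.coveringNumber_le_encard hsub).trans ?_
  calc C.encard ≤ (Set.univ : Set (cell '' Q)).encard := by
        change (Set.range _).encard ≤ _
        rw [← Set.image_univ]
        exact Set.encard_image_le _ _
    _ = (cell '' Q).encard := by rw [Set.encard_univ]; rfl
    _ ≤ (Set.univ : Set (Fin r → Fin (m + 1))).encard := Set.encard_le_encard (Set.subset_univ _)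
    _ = _ := by
        rw [Set.encard_univ, ENat.card_eq_coe_fintype_card]
        simp

/-- The length of an independent sequence, by the determinant potential. -/
theorem pow_le_of_spanner (hQ : ∀ q ∈ Q, ∀ z, |q z| ≤ V)
    (hc : ∀ z j, |c z j| ≤ 2) (hy : ∀ q ∈ Q, ∀ z, q z = ∑ j, c z j * q (y j)) {ε : ℝ} (hε : 0 < ε)
    {n : ℕ} (z : Fin n → Z)
    (hz : ∀ i : Fin n, ¬ EluderDependent Q ε (fun j : Fin i => z (Fin.castLE i.isLt.le j)) (z i)) :
    ((3 : ℝ) / 2) ^ n ≤ (1 + 16 * n * V ^ 2 * r / ε ^ 2) ^ r := by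
  rcases Nat.eq_zero_or_pos n with hn | hn
  · subst hn; simp
  have hdata : ∀ k : Fin n, ∃ q ∈ Q, ∃ q' ∈ Q,
      ∑ j : Fin k, (q (z (Fin.castLE k.isLt.le j)) - q' (z (Fin.castLE k.isLt.le j))) ^ 2 ≤ ε ^ 2 ∧
      ε < |q (z k) - q' (z k)| := by
    intro k
    have := hz k
    simp only [EluderDependent, not_forall, not_le] at this
    obtain ⟨q, hq, q', hq', h1, h2⟩ := this
    exact ⟨q, hq, q', hq', (Real.sqrt_le_iff.1 h1).2, h2⟩
  choose q hq q' hq' hsq hlt using hdata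
  have hV0 : 0 < V := by
    have h1 := hlt ⟨0, hn⟩
    have h2 := abs_sub (q ⟨0, hn⟩ (z ⟨0, hn⟩)) (q' ⟨0, hn⟩ (z ⟨0, hn⟩))
    have h3 := hQ _ (hq ⟨0, hn⟩) (z ⟨0, hn⟩)
    have h4 := hQ _ (hq' ⟨0, hn⟩) (z ⟨0, hn⟩)
    linarith
  have hr : 0 < r := by
    by_contra hr0
    obtain rfl : r = 0 := by omega
    have h1 := hlt ⟨0, hn⟩
    rw [hy _ (hq _), hy _ (hq' _)] at h1
    simp at h1
    linarith
  have hr0 : (0 : ℝ) < r := by exact_mod_cast hr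
  let idx : ℕ → Fin n := fun k => if hk : k < n then ⟨k, hk⟩ else ⟨0, hn⟩
  have hidx : ∀ k : Fin n, idx k = k := fun k => by simp [idx]
  let cc : ℕ → Fin r → ℝ := fun k => c (z (idx k))
  let vv : ℕ → Fin r → ℝ := fun k j => q (idx k) (y j) - q' (idx k) (y j)
  have hdot : ∀ k l, cc k ⬝ᵥ vv l = q (idx l) (z (idx k)) - q' (idx l) (z (idx k)) := by
    intro k l
    rw [hy _ (hq (idx l)) (z (idx k)), hy _ (hq' (idx l)) (z (idx k)), ← Finset.sum_sub_distrib]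
    exact Finset.sum_congr rfl fun j _ => mul_sub _ _ _
  set lam := ε ^ 2 / (4 * V ^ 2 * r) with hlam
  have hlam0 : 0 < lam := by positivity
  have hvv : ∀ k, vv k ⬝ᵥ vv k ≤ 4 * V ^ 2 * r := by
    intro k
    have := Finset.sum_le_card_nsmul Finset.univ (fun j => vv k j * vv k j) (4 * V ^ 2) fun j _ => by
      have h1 := abs_le.1 (hQ _ (hq (idx k)) (y j))
      have h2 := abs_le.1 (hQ _ (hq' (idx k)) (y j))
      have h3 : |vv k j| ≤ 2 * V := by rw [abs_le]; constructor <;> simp only [vv] <;> linarith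
      rw [← abs_mul_abs_self]
      nlinarith [abs_nonneg (vv k j)]
    rw [Finset.card_univ, Fintype.card_fin, nsmul_eq_mul] at this
    calc vv k ⬝ᵥ vv k ≤ r * (4 * V ^ 2) := this
      _ = _ := by ring
  have key := pow_mul_pow_le_of_potential hlam0 (R := 4) (by norm_num) hε.le cc vv n ?_ ?_ ?_
  · have h1 : (lam + n * 4) ^ r = (1 + 16 * n * V ^ 2 * r / ε ^ 2) ^ r * lam ^ r := by
      rw [← mul_pow]
      congr 1
      rw [hlam]
      field_simp
      ring
    rw [h1] at key
    exact le_of_mul_le_mul_right key (by positivity)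
  · intro k hk
    have h1 : lam * (vv k ⬝ᵥ vv k) ≤ ε ^ 2 := by
      calc lam * (vv k ⬝ᵥ vv k) ≤ lam * (4 * V ^ 2 * r) := by gcongr; exact hvv k
        _ = ε ^ 2 := by rw [hlam]; field_simp
    have h2 : ∑ j ∈ Finset.range k, (cc j ⬝ᵥ vv k) ^ 2 ≤ ε ^ 2 := by
      have h3 := hsq ⟨k, hk⟩
      refine le_trans (le_of_eq ?_) h3
      rw [Finset.sum_range]
      refine Finset.sum_congr rfl fun j _ => ?_
      rw [hdot]
      have e1 : idx k = ⟨k, hk⟩ := hidx ⟨k, hk⟩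
      have e2 : idx j = ⟨j, j.isLt.trans hk⟩ := hidx ⟨j, j.isLt.trans hk⟩
      rw [e1, e2]
      rfl
    linarith
  · intro k hk
    rw [hdot]
    have e1 : idx k = ⟨k, hk⟩ := hidx ⟨k, hk⟩
    rw [e1]
    exact hlt ⟨k, hk⟩
  · intro k _
    have := Finset.sum_le_card_nsmul Finset.univ (fun j => cc k j * cc k j) 4 fun j _ => by
      have := hc (z (idx k)) j
      rw [← abs_mul_abs_self]
      change |c (z (idx k)) j| * |c (z (idx k)) j| ≤ 4
      nlinarith [abs_nonneg (c (z (idx k)) j)]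
    rw [Finset.card_univ, Fintype.card_fin, nsmul_eq_mul] at this
    exact this

end Complexity

/-! ### Numerical estimates for linear models -/

theorem Real.log_one_add_le_quarter {t : ℝ} (ht : 0 ≤ t) : Real.log (1 + t) ≤ t / 4 + Real.log 2 := by
  have h1 : Real.log (1 + t) = Real.log ((1 + t) / 4) + 2 * Real.log 2 := by
    rw [Real.log_div (by positivity) (by norm_num), show (4 : ℝ) = 2 ^ 2 by norm_num, Real.log_pow]
    push_cast
    ring
  have h2 := Real.log_le_sub_one_of_pos (show 0 < (1 + t) / 4 by positivity)
  have h3 := Real.log_two_lt_d9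
  linarith

theorem log_one_add_sixteen_mul_sq_le {u : ℝ} (hu : 0 ≤ u) :
    Real.log (1 + 16 * u ^ 2) ≤ 6 * Real.log (2 + u) := by
  have h2 : Real.log 2 ≤ Real.log (2 + u) := Real.log_le_log (by norm_num) (by linarith)
  calc Real.log (1 + 16 * u ^ 2) ≤ Real.log (2 ^ 4 * (2 + u) ^ 2) :=
        Real.log_le_log (by positivity) (by nlinarith)
    _ = 4 * Real.log 2 + 2 * Real.log (2 + u) := by
        rw [Real.log_mul (by positivity) (by positivity), Real.log_pow, Real.log_pow]
        push_cast
        ring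
    _ ≤ _ := by linarith

/-- Solving `(3 / 2) ^ n ≤ (1 + O(n)) ^ r` for `n`. -/
theorem eluder_length_le {n r m : ℕ} {V k ε : ℝ} (hm : 1 ≤ m) (hr : r ≤ m) (hV : 0 ≤ V) (hk : 0 < k)
    (hε : 1 / k ≤ ε)
    (h : ((3 : ℝ) / 2) ^ n ≤ (1 + 16 * n * V ^ 2 * r / ε ^ 2) ^ r) :
    (n : ℝ) ≤ 84 * (m * Real.log (2 + m * k * V)) := by
  have hm0 : (0 : ℝ) < m := by exact_mod_cast hm
  have hrm : (r : ℝ) ≤ m := by exact_mod_cast hr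
  have hε0 : 0 < ε := lt_of_lt_of_le (by positivity) hε
  set u := m * k * V with hu
  have hu0 : 0 ≤ u := by positivity
  set t := (n : ℝ) / m with ht
  have ht0 : 0 ≤ t := by positivity
  have htm : t * m = n := by rw [ht]; field_simp
  have hle : 1 + 16 * n * V ^ 2 * r / ε ^ 2 ≤ (1 + t) * (1 + 16 * u ^ 2) := by
    have h1 : 1 / ε ≤ k := by
      rw [div_le_iff₀ hε0]
      rw [div_le_iff₀ hk] at hε
      linarith
    have h2 : 16 * n * V ^ 2 * r / ε ^ 2 ≤ 16 * n * V ^ 2 * m * k ^ 2 := by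
      calc 16 * n * V ^ 2 * r / ε ^ 2 = 16 * n * V ^ 2 * r * (1 / ε) ^ 2 := by field_simp
        _ ≤ 16 * n * V ^ 2 * m * k ^ 2 := by gcongr
    have h3 : 16 * n * V ^ 2 * m * k ^ 2 = 16 * t * u ^ 2 := by
      rw [← htm, hu]; ring
    nlinarith [sq_nonneg u]
  have hlog := Real.log_le_log (by positivity) h
  rw [Real.log_pow, Real.log_pow] at hlog
  have hbase : 0 ≤ 16 * n * V ^ 2 * r / ε ^ 2 := by positivity
  have h3 : Real.log (1 + 16 * n * V ^ 2 * r / ε ^ 2) ≤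
      Real.log (1 + t) + Real.log (1 + 16 * u ^ 2) := by
    rw [← Real.log_mul (by positivity) (by positivity)]
    exact Real.log_le_log (by positivity) hle
  have h4 : (r : ℝ) * Real.log (1 + 16 * n * V ^ 2 * r / ε ^ 2) ≤
      m * (Real.log (1 + t) + Real.log (1 + 16 * u ^ 2)) :=
    mul_le_mul hrm h3 (Real.log_nonneg (by linarith)) hm0.le
  have h5 : (1 : ℝ) / 3 ≤ Real.log (3 / 2) := by
    have := Real.one_sub_inv_le_log_of_pos (show (0 : ℝ) < 3 / 2 by norm_num)
    norm_num at this ⊢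
    linarith
  have h6 := Real.log_one_add_le_quarter ht0
  have h7 := log_one_add_sixteen_mul_sq_le hu0
  have h8 : Real.log 2 ≤ Real.log (2 + u) := Real.log_le_log (by norm_num) (by linarith)
  have h9 : (n : ℝ) * (1 / 3) ≤ n * Real.log (3 / 2) := by gcongr
  have h10 : (m : ℝ) * (Real.log (1 + t) + Real.log (1 + 16 * u ^ 2)) ≤
      m * (t / 4 + 7 * Real.log (2 + u)) :=
    mul_le_mul_of_nonneg_left (by linarith) hm0.le
  have h11 : (m : ℝ) * (t / 4 + 7 * Real.log (2 + u)) = n / 4 + 7 * (m * Real.log (2 + u)) := by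
    rw [← htm]; ring
  linarith

theorem log_covering_le {r m : ℕ} {V k D : ℝ} (hm : 1 ≤ m) (hr : r ≤ m) (hV : 1 ≤ V) (hk : 1 ≤ k)
    (hD : 0 ≤ D) {α : ℝ} (hα : α = 1 / (k * (Real.log k + D))) :
    Real.log (((⌊4 * r * V / α⌋₊ + 1) ^ r : ℕ) : ℝ) ≤ m * (6 * Real.log (2 + m * k * V) + D) := by
  have hm1 : (1 : ℝ) ≤ m := by exact_mod_cast hm
  have hrm : (r : ℝ) ≤ m := by exact_mod_cast hr
  set u := m * k * V with hu
  have hku : k ≤ u := by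
    have : k * 1 ≤ k * (m * V) := by gcongr; nlinarith
    rw [hu]; linarith
  have hlogk0 : 0 ≤ Real.log k := Real.log_nonneg hk
  have hlogk : Real.log k ≤ k := by
    have := Real.log_le_sub_one_of_pos (show 0 < k by linarith)
    linarith
  have h1 : 4 * r * V / α = 4 * (r * k * V) * (Real.log k + D) := by
    rw [hα]
    field_simp
  have h2 : 4 * r * V / α ≤ 4 * u * (u + D) := by
    rw [h1, hu]
    gcongr
    linarith
  have h0 : 0 ≤ 4 * r * V / α := by
    rw [h1]; positivity
  have hfl := Nat.floor_le h0
  push_cast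
  rw [Real.log_pow]
  have h3 : Real.log (⌊4 * r * V / α⌋₊ + 1) ≤ 6 * Real.log (2 + u) + D := by
    have h4 : Real.log (⌊4 * r * V / α⌋₊ + 1) ≤ Real.log ((1 + 16 * u ^ 2) * (1 + D)) := by
      refine Real.log_le_log (by positivity) ?_
      have hu1 : 1 ≤ u := hk.trans hku
      have : u * D ≤ u ^ 2 * D := by
        have : u * 1 ≤ u * u := by gcongr
        nlinarith
      nlinarith
    rw [Real.log_mul (by positivity) (by positivity)] at h4
    have h5 := log_one_add_sixteen_mul_sq_le (show 0 ≤ u by linarith)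
    have h6 := Real.log_le_sub_one_of_pos (show 0 < 1 + D by linarith)
    linarith
  refine mul_le_mul hrm h3 (Real.log_nonneg (by
    have : (0 : ℝ) ≤ ⌊4 * r * V / α⌋₊ := Nat.cast_nonneg _
    linarith)) (by positivity)

/-- The regret bound for a class with Eluder dimension and metric entropy linear in `m`. -/
theorem linear_regret_arith {m d N K H : ℕ} {V δ C lam : ℝ} (hm : 1 ≤ m) (hH : 1 ≤ H) (hK : 1 ≤ K)
    (hV : 1 ≤ V) (hδ : 0 < δ) (hδ2 : δ ≤ 1 / 2) (hC : 0 ≤ C) (hN : 1 ≤ N)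
    (hlam : Real.log 2 ≤ lam) (hd : (d : ℝ) ≤ 84 * (m * lam))
    (hlogN : Real.log N ≤ m * (6 * lam + Real.log (1 / δ))) :
    1 + d * H * V + 4 * √(d * (2 * (V * H) ^ 2 * Real.log (2 * N / δ) + C * V * H) * K * H) ≤
      (4 * √(84 * (30 + 3 * C)) + 171) * m * lam *
        √((H : ℝ) ^ 3 * V ^ 2 * K * Real.log (1 / δ)) := by
  have hl2 := Real.log_two_gt_d9
  have hm1 : (1 : ℝ) ≤ m := by exact_mod_cast hm
  have hH1 : (1 : ℝ) ≤ H := by exact_mod_cast hH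
  have hK1 : (1 : ℝ) ≤ K := by exact_mod_cast hK
  have hN1 : (1 : ℝ) ≤ N := by exact_mod_cast hN
  set D := Real.log (1 / δ) with hD
  have hD2 : Real.log 2 ≤ D := Real.log_le_log (by norm_num) (by
    rw [le_div_iff₀ hδ]; linarith)
  have hlogsplit : Real.log (2 * N / δ) = Real.log 2 + Real.log N + D := by
    rw [hD, show 2 * (N : ℝ) / δ = 2 * N * (1 / δ) by ring,
      Real.log_mul (by positivity) (by positivity), Real.log_mul (by positivity) (by positivity)]
  have hD' : (2 / 3 : ℝ) ≤ D := by linarith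
  have hlam' : (2 / 3 : ℝ) ≤ lam := by linarith
  have hmlam : (2 / 3 : ℝ) ≤ m * lam := by nlinarith
  set G := m * lam * D with hG
  have hmD : 2 / 3 * (m * D) ≤ G := by
    have : m * D * (2 / 3) ≤ m * D * lam := by gcongr
    rw [hG]; linarith
  have hml : 2 / 3 * (m * lam) ≤ G := by
    have : m * lam * (2 / 3) ≤ m * lam * D := by gcongr
    rw [hG]; linarith
  have hDm : D ≤ m * D := le_mul_of_one_le_left (by linarith) hm1
  have hG0 : 4 / 9 ≤ G := by linarith
  have hlog : Real.log (2 * N / δ) ≤ 14 * G := by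
    rw [hlogsplit]
    have : (m : ℝ) * (6 * lam + D) = 6 * (m * lam) + m * D := by ring
    linarith
  have hVH : 1 ≤ V * H := by nlinarith
  have hconf : 2 * (V * H) ^ 2 * Real.log (2 * N / δ) + C * V * H ≤
      (V * H) ^ 2 * ((30 + 3 * C) * G) := by
    have h1 : 2 * (V * H) ^ 2 * Real.log (2 * N / δ) ≤ 2 * (V * H) ^ 2 * (14 * G) := by gcongr
    have h2 : C * (V * H) ≤ C * (V * H) ^ 2 := by gcongr; nlinarith
    have h3 : C * (V * H) ^ 2 * 1 ≤ C * (V * H) ^ 2 * (3 * G) := by gcongr; linarith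
    nlinarith [mul_nonneg (sq_nonneg (V * H)) (show 0 ≤ G by linarith)]
  set S := √((H : ℝ) ^ 3 * V ^ 2 * K * D) with hS
  have hS2 : S ^ 2 = (H : ℝ) ^ 3 * V ^ 2 * K * D := Real.sq_sqrt (by positivity)
  have hS0 : 0 ≤ S := Real.sqrt_nonneg _
  have hVHS : V * H ≤ 2 * S := by
    have h1 : V * H / 2 ≤ S := by
      apply Real.le_sqrt_of_sq_le
      calc (V * H / 2) ^ 2 = (H : ℝ) ^ 2 * V ^ 2 * 1 * (1 / 4) := by ring
        _ ≤ (H : ℝ) ^ 3 * V ^ 2 * K * D := by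
            gcongr
            · norm_num
            · linarith
    linarith
  have hfirst : (1 : ℝ) ≤ 3 * (m * lam * S) := by
    have : (2 / 3 : ℝ) * (1 / 2) ≤ m * lam * S := by
      gcongr
      linarith
    linarith
  have hsecond : d * H * V ≤ 168 * (m * lam * S) := by
    calc d * H * V = d * (V * H) := by ring
      _ ≤ 84 * (m * lam) * (2 * S) := by gcongr
      _ = _ := by ring
  have hnn : 0 ≤ 2 * (V * H) ^ 2 * Real.log (2 * N / δ) + C * V * H := by
    have : 0 ≤ Real.log (2 * N / δ) := Real.log_nonneg (by rw [le_div_iff₀ hδ]; linarith)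
    positivity
  have hthird : √(d * (2 * (V * H) ^ 2 * Real.log (2 * N / δ) + C * V * H) * K * H) ≤
      √(84 * (30 + 3 * C)) * (m * lam * S) := by
    rw [← Real.sqrt_sq (show 0 ≤ m * lam * S by positivity), ← Real.sqrt_mul (by positivity)]
    apply Real.sqrt_le_sqrt
    calc d * (2 * (V * H) ^ 2 * Real.log (2 * N / δ) + C * V * H) * K * H
        ≤ (84 * (m * lam)) * ((V * H) ^ 2 * ((30 + 3 * C) * G)) * K * H := by
          gcongr
      _ = 84 * (30 + 3 * C) * ((m * lam) ^ 2 * ((H : ℝ) ^ 3 * V ^ 2 * K * D)) := by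
          rw [hG]; ring
      _ = 84 * (30 + 3 * C) * (m * lam * S) ^ 2 := by rw [← hS2]; ring
  calc _ ≤ 3 * (m * lam * S) + 168 * (m * lam * S) + 4 * (√(84 * (30 + 3 * C)) * (m * lam * S)) := by
        linarith
    _ = _ := by ring

namespace ACMDP

variable {X A F Θ : Type*} [MetricSpace X] [MeasurableSpace X] [MetricSpace A] [MeasurableSpace A]
  [MeasurableSpace F] [MeasurableSpace Θ] {M : ACMDP X A F Θ} {P : AugState X → A → A}
  [SecondCountableTopology A] [BorelSpace A] [IsMarkovKernel M.trans]
  {L : Learner X A Θ M.H} {V : ℝ}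

/-! ### Linear transition kernels -/

theorem abs_qFun_le [Nonempty A] (hm : M.IsMeasurable P L) (hV : 0 ≤ V) (hb : M.ValueBounded P V)
    (θ : Θ) (z : M.Triple P) : |M.qFun P θ z| ≤ V := by
  obtain ⟨⟨s, a, v⟩, hs, ha, hv⟩ := z
  obtain ⟨η, rfl⟩ : ∃ η, M.optValue P η = v := hv
  exact (isBdd_optValue hm hV hb η).abs_expNext_le hs ha θ

theorem IsLinear.one_le {d : ℕ} (hlin : M.IsLinear d) : 1 ≤ d := by
  obtain ⟨ν, φ, w, -, hw⟩ := hlin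
  by_contra hd
  obtain rfl : d = 0 := by omega
  have h0 : M.trans M.truth = 0 := by
    rw [(hw M.truth).2]
    have : (fun f => ENNReal.ofReal (inner ℝ (φ f) (w M.truth))) = 0 := by
      funext f
      simp [Subsingleton.elim (φ f) 0]
    rw [this, withDensity_zero]
  exact IsProbabilityMeasure.ne_zero (M.trans M.truth) h0

/-- The class `𝒬` of a linear model spans a space of dimension at most `d`. Feature vectors need not be
integrable; only their products with the span of the parameters are. -/
theorem IsLinear.finrank_span_qClass_le [Nonempty A] {d : ℕ} (hlin : M.IsLinear d)
    (hm : M.IsMeasurable P L) (hV : 0 ≤ V) (hb : M.ValueBounded P V) :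
    FiniteDimensional ℝ (Submodule.span ℝ (M.qClass P)) ∧
      Module.finrank ℝ (Submodule.span ℝ (M.qClass P)) ≤ d := by
  obtain ⟨ν, φ, w, hφ, hw⟩ := hlin
  let U := Submodule.span ℝ (Set.range w)
  have hinner : ∀ x : EuclideanSpace ℝ (Fin d), Measurable fun f => inner ℝ (φ f) x := fun x =>
    (by fun_prop : Measurable fun y : EuclideanSpace ℝ (Fin d) => inner ℝ y x).comp hφ
  have hint : ∀ x ∈ U, Integrable (fun f => inner ℝ (φ f) x) ν := by
    intro x hx
    induction hx using Submodule.span_induction with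
    | mem x hx =>
      obtain ⟨θ, rfl⟩ := hx
      refine ⟨(hinner _).aestronglyMeasurable, ?_⟩
      rw [hasFiniteIntegral_iff_ofReal (hw θ).1]
      have h1 : (M.trans θ) Set.univ = 1 := measure_univ
      rw [(hw θ).2, withDensity_apply _ MeasurableSet.univ, Measure.restrict_univ] at h1
      rw [h1]
      exact ENNReal.one_lt_top
    | zero => simp
    | add x x' _ _ h h' =>
      simp only [inner_add_right]
      exact h.add h'
    | smul a x _ h =>
      simp only [inner_smul_right]
      exact h.const_mul a
  have hvm : ∀ z : M.Triple P, Measurable fun f => z.1.2.2 (M.next z.1.1 z.1.2.1 f) := by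
    rintro ⟨⟨s, a, v⟩, hs, ha, hv⟩
    obtain ⟨η, rfl⟩ : ∃ η, M.optValue P η = v := hv
    exact (isBdd_optValue hm hV hb η).measurable.comp
      ((measurable_next hm).comp (measurable_prodMk_left (x := (s, a))))
  have hvb : ∀ (z : M.Triple P) f, ‖z.1.2.2 (M.next z.1.1 z.1.2.1 f)‖ ≤ V := by
    rintro ⟨⟨s, a, v⟩, hs, ha, hv⟩ f
    obtain ⟨η, rfl⟩ : ∃ η, M.optValue P η = v := hv
    exact (isBdd_optValue hm hV hb η).abs_next_le hs ha f
  have hint' : ∀ (z : M.Triple P) (x : U), Integrable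
      (fun f => z.1.2.2 (M.next z.1.1 z.1.2.1 f) * inner ℝ (φ f) x) ν := fun z x =>
    (hint x x.2).bdd_mul (hvm z).aestronglyMeasurable (.of_forall (hvb z))
  let Φ : U →ₗ[ℝ] (M.Triple P → ℝ) :=
    { toFun := fun x z => ∫ f, z.1.2.2 (M.next z.1.1 z.1.2.1 f) * inner ℝ (φ f) x ∂ν
      map_add' := fun x x' => by
        funext z
        rw [Pi.add_apply, ← integral_add (hint' z x) (hint' z x')]
        simp only [Submodule.coe_add, inner_add_right, mul_add]
      map_smul' := fun a x => by
        funext z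
        rw [Pi.smul_apply, smul_eq_mul, RingHom.id_apply, ← integral_const_mul]
        simp only [Submodule.coe_smul, inner_smul_right]
        refine integral_congr_ae (.of_forall fun f => ?_)
        ring }
  have hrange : Submodule.span ℝ (M.qClass P) ≤ LinearMap.range Φ := by
    rw [Submodule.span_le, qClass_eq_range]
    rintro _ ⟨θ, rfl⟩
    refine ⟨⟨w θ, Submodule.subset_span ⟨θ, rfl⟩⟩, ?_⟩
    funext z
    change ∫ f, z.1.2.2 (M.next z.1.1 z.1.2.1 f) * inner ℝ (φ f) (w θ) ∂ν =
      ∫ f, z.1.2.2 (M.next z.1.1 z.1.2.1 f) ∂(M.trans θ)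
    rw [(hw θ).2, integral_withDensity_eq_integral_toReal_smul (hinner _).ennreal_ofReal
      (.of_forall fun f => ENNReal.ofReal_lt_top)]
    refine integral_congr_ae ?_
    filter_upwards [(hw θ).1] with f hf
    rw [ENNReal.toReal_ofReal hf, smul_eq_mul, mul_comm]
  have : FiniteDimensional ℝ (LinearMap.range Φ) := inferInstance
  refine ⟨Submodule.finiteDimensional_of_le hrange, ?_⟩
  calc Module.finrank ℝ (Submodule.span ℝ (M.qClass P))
      ≤ Module.finrank ℝ (LinearMap.range Φ) := Submodule.finrank_mono hrange
    _ ≤ Module.finrank ℝ U := LinearMap.finrank_range_le Φ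
    _ ≤ Module.finrank ℝ (EuclideanSpace ℝ (Fin d)) := Submodule.finrank_le U
    _ = d := by simp

/-- The regret bound for linear transition kernels. -/
theorem linear_regret_bound [IsProbabilityMeasure M.initLaw] {πopt : AugState X → A} {K : ℕ}
    {Vbar δ C : ℝ} (hC : 18 ≤ C) {m : ℕ} (hS : M.Setting P πopt L K Vbar δ C)
    (hlin : M.IsLinear m) (hV1 : 1 ≤ Vbar) (hδ2 : δ ≤ 1 / 2) :
    1 - δ ≤ (M.noiseLaw K).real {ω | M.pseudoRegret P L πopt K ω ≤
      (4 * √(84 * (30 + 3 * C)) + 171) * m * Real.log (2 + m * K * M.H * Vbar) *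
        √((M.H : ℝ) ^ 3 * Vbar ^ 2 * K * Real.log (1 / δ))} := by
  have : Nonempty A := hS.nonempty_action
  have hV0 := hS.Vbar_nonneg
  have hδ := hS.δ_pos
  have hm := hS.measurable
  have hb := hS.bounded
  have hm1 := hlin.one_le
  have hH1 : (1 : ℝ) ≤ M.H := by exact_mod_cast hS.H_pos
  have hK1 : (1 : ℝ) ≤ K := by exact_mod_cast hS.K_pos
  have hKH1 : (1 : ℝ) ≤ K * M.H := by nlinarith
  have hQ : ∀ q ∈ M.qClass P, ∀ z, |q z| ≤ Vbar := by
    rw [qClass_eq_range]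
    rintro _ ⟨θ, rfl⟩ z
    exact abs_qFun_le hm hV0 hb θ z
  obtain ⟨hfin, hrank⟩ := hlin.finrank_span_qClass_le hm hV0 hb
  obtain ⟨r, hr, y, c, hc, hy⟩ := exists_spanner_of_finrank_le hrank hQ
  set D := Real.log (1 / δ) with hD
  have hDpos : 0 < D := Real.log_pos (by rw [lt_div_iff₀ hδ]; linarith)
  have hlogKH : Real.log (K * M.H / δ) = Real.log (K * M.H) + D := by
    rw [hD, ← Real.log_mul (by positivity) (by positivity), mul_one_div]
  have hlogKH0 : 0 ≤ Real.log (K * M.H) := Real.log_nonneg hKH1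
  set α := 1 / (K * M.H * Real.log (K * M.H / δ)) with hα
  have hα0 : 0 < α := by
    rw [hα, hlogKH]; positivity
  -- the covering number
  have hcov : M.covNum P K δ ≤ (((⌊4 * r * Vbar / α⌋₊ + 1) ^ r : ℕ) : ℕ∞) :=
    supCoveringNumber_le_of_spanner hQ hc hy hα0
  obtain ⟨N, hN⟩ : ∃ N : ℕ, M.covNum P K δ = N :=
    (ENat.ne_top_iff_exists.1 (ne_top_of_le_ne_top (ENat.natCast_ne_top _) hcov)).imp
      fun _ h => h.symm
  have hN1 := one_le_covNum hN
  have hlogN : Real.log N ≤ m * (6 * Real.log (2 + m * K * M.H * Vbar) + D) := by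
    rw [hN] at hcov
    have h1 : (N : ℝ) ≤ ((⌊4 * r * Vbar / α⌋₊ + 1) ^ r : ℕ) := by exact_mod_cast hcov
    refine (Real.log_le_log (by exact_mod_cast hN1) h1).trans ?_
    have := log_covering_le hm1 hr hV1 hKH1 hDpos.le (α := α) (by rw [hα, hlogKH])
    rwa [← mul_assoc (m : ℝ)] at this
  -- the Eluder dimension
  have hdim : M.dimQ P K ≤ ((⌊84 * (m * Real.log (2 + m * K * M.H * Vbar))⌋₊ : ℕ) : ℕ∞) := by
    refine iSup₂_le fun n hn => ?_
    obtain ⟨ε, hε, z, hz⟩ := hn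
    have hε0 : 0 < ε := lt_of_lt_of_le (by positivity) hε
    have h1 := pow_le_of_spanner hQ hc hy hε0 z hz
    have h2 := eluder_length_le hm1 hr hV0 (by positivity : (0 : ℝ) < K * M.H) hε h1
    rw [← mul_assoc (m : ℝ)] at h2
    exact_mod_cast Nat.le_floor h2
  obtain ⟨d, hd⟩ : ∃ d : ℕ, M.dimQ P K = d :=
    (ENat.ne_top_iff_exists.1 (ne_top_of_le_ne_top (ENat.natCast_ne_top _) hdim)).imp
      fun _ h => h.symm
  have hlam : Real.log 2 ≤ Real.log (2 + m * K * M.H * Vbar) :=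
    Real.log_le_log (by norm_num) (by
      have : 0 ≤ m * K * M.H * Vbar := by positivity
      linarith)
  have hd84 : (d : ℝ) ≤ 84 * (m * Real.log (2 + m * K * M.H * Vbar)) := by
    rw [hd] at hdim
    have h1 : (d : ℝ) ≤ (⌊84 * (m * Real.log (2 + m * K * M.H * Vbar))⌋₊ : ℕ) := by
      exact_mod_cast hdim
    refine h1.trans (Nat.floor_le ?_)
    have := Real.log_two_gt_d9
    have : 0 ≤ Real.log (2 + m * K * M.H * Vbar) := by linarith
    positivity
  refine (regret_bound hC hS hN hd).trans (measureReal_mono fun ω hω => ?_)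
  refine Set.mem_ofPred.2 ((Set.mem_ofPred.1 hω).trans ?_)
  rw [conf, hN, ENat.toNat_natCast]
  exact linear_regret_arith hm1 hS.H_pos hS.K_pos hV1 hδ hδ2 (by linarith) hN1 hlam hd84 hlogN

end ACMDP

end

theorem theorem2 :
    ∃ C₀ : ℝ, 0 < C₀ ∧ ∀ C : ℝ, C₀ ≤ C →
      (∀ (X A F Θ : Type*) [MetricSpace X] [SecondCountableTopology X] [MeasurableSpace X]
          [BorelSpace X] [MetricSpace A] [SecondCountableTopology A] [MeasurableSpace A]
          [BorelSpace A] [MeasurableSpace F] [MeasurableSpace Θ]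
          (M : ACMDP X A F Θ) [IsProbabilityMeasure M.initLaw] [IsMarkovKernel M.trans]
          (P : AugState X → A → A) (πopt : AugState X → A) (L : Learner X A Θ M.H)
          (K : ℕ) (Vbar δ : ℝ) (N d : ℕ),
          M.Setting P πopt L K Vbar δ C →
          M.covNum P K δ = N → M.dimQ P K = d →
          1 - δ ≤ (M.noiseLaw K).real {ω | M.pseudoRegret P L πopt K ω ≤
            1 + d * M.H * Vbar + 4 * √(d * M.conf P K Vbar δ C * K * M.H) +
              M.H * √(2 * K * M.H * Real.log (1 / δ))}) ∧
      (∃ c : ℝ, 0 < c ∧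
        ∀ (X A F Θ : Type*) [MetricSpace X] [SecondCountableTopology X] [MeasurableSpace X]
          [BorelSpace X] [MetricSpace A] [SecondCountableTopology A] [MeasurableSpace A]
          [BorelSpace A] [MeasurableSpace F] [MeasurableSpace Θ]
          (M : ACMDP X A F Θ) [IsProbabilityMeasure M.initLaw] [IsMarkovKernel M.trans]
          (P : AugState X → A → A) (πopt : AugState X → A) (L : Learner X A Θ M.H)
          (K : ℕ) (Vbar δ : ℝ) (dθ : ℕ),
          M.Setting P πopt L K Vbar δ C →
          M.IsLinear dθ → 1 ≤ Vbar → δ ≤ 1 / 2 →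
          1 - δ ≤ (M.noiseLaw K).real {ω | M.pseudoRegret P L πopt K ω ≤
            c * dθ * Real.log (2 + dθ * K * M.H * Vbar) *
              √((M.H : ℝ) ^ 3 * Vbar ^ 2 * K * Real.log (1 / δ))}) := by
  refine ⟨18, by norm_num, fun C hC => ⟨?_, 4 * √(84 * (30 + 3 * C)) + 171, by positivity, ?_⟩⟩
  · intro X A F Θ _ _ _ _ _ _ _ _ _ _ M _ _ P πopt L K Vbar δ N d hS hN hd
    refine (ACMDP.regret_bound hC hS hN hd).trans (measureReal_mono fun ω hω => ?_)
    refine Set.mem_ofPred.2 ((Set.mem_ofPred.1 hω).trans ?_)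
    exact le_add_of_nonneg_right (by positivity)
  · intro X A F Θ _ _ _ _ _ _ _ _ _ _ M _ _ P πopt L K Vbar δ dθ hS hlin hV hδ
    exact ACMDP.linear_regret_bound hC hS hlin hV hδ
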